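/- Conventions. All lattices are bounded; a filter (ideal) of a poset is a nonempty, down-directed upset (nonempty, up-directed downset). ${\sf Lat}$ is the category of bounded lattices and bounded lattice homomorphisms. For $R\subseteq X\times Y$ write $R[A]=\{y:\exists x\in A,\ x\,R\,y\}$, $R^{-1}[B]=\{x:\exists y\in B,\ x\,R\,y\}$, $R[x]=R[\{x\}]$, $R^{-1}[y]=R^{-1}[\{y\}]$, $\Box_R B=\{x: R[x]\subseteq B\}$, and $-$ for complement. Finite joins, meets, intersections and unions include the empty ones. ${\sf CLF}(X)$ is the set of clopen filters of $X$; joins of filters are taken in the lattice of filters. A *coherent lattice* is an algebraic lattice in which $1$ and binary meets of compact elements are compact. ${\sf CohLat}_\lambda$ has as objects coherent lattices with the Lawson topology, and as morphisms the continuous maps that preserve finite meets and have a left adjoint preserving finite meets. * ${\sf DH}$: objects are triples $(X,R,Y)$ with $X,Y\in{\sf CohLat}_\lambda$ and $R\subseteq X\times Y$ such that (i) all $R[x]$ and $R^{-1}[y]$ are closed, and $R[U]$, $R^{-1}[V]$ are clopen for clopen $U\subseteq X$, $V\subseteq Y$; (ii) all $-R[x]$ and $-R^{-1}[y]$ are filters;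 (iii) $R[x]\subseteq R[x']$ implies $x'\le x$, and $R^{-1}[y]\subseteq R^{-1}[y']$ implies $y'\le y$. A morphism $(X_1,R_1,Y_1)\to(X_2,R_2,Y_2)$ is a pair of ${\sf CohLat}_\lambda$-morphisms $f:X_1\to X_2$, $g:Y_1\to Y_2$ such that $x\,R_1\,y$ implies $f(x)\,R_2\,g(y)$; if $x'\,R_2\,g(y)$, then there is $x$ with $x\,R_1\,y$ and $x'\le f(x)$; if $f(x)\,R_2\,y'$, then there is $y$ with $x\,R_1\,y$ and $y'\le g(y)$. Composition is componentwise. * ${\sf JM}$: for a space $X$, let ${\sf KOF}(X)$ be the set of compact open filters with respect to the specialization order ($x\le y$ iff $x\in\overline{\{y\}}$), and ${\sf FSat}(X)$ the complete lattice of intersections of open filters. Objects are sober spaces $X$ such that ${\sf KOF}(X)$ is a basis closed under finite intersections and is a bounded sublattice of ${\sf FSat}(X)$. Morphisms are maps $f:X\to Y$ such that $f^{-1}$ sends ${\sf KOF}(Y)$ to ${\sf KOF}(X)$ and preserves finite joins (taken in ${\sf FSat}$) of compact open filters. * ${\sf BDGM}$: objects are compact spaces $X$ that are meet-semilattices with $1$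 such that if $x\not\le y$, then some clopen filter contains $x$ but not $y$, and such that finite joins of clopen filters are clopen. Morphisms are continuous maps $f:X\to Y$ preserving finite meets such that $f(x)=1$ implies $x=1$, and $y'\wedge z'\le f(x)$ implies that there are $y,z$ with $y'\le f(y)$, $z'\le f(z)$, $y\wedge z\le x$. * ${\sf Hs}$: for a poset $X$, let $\Gamma(A)=A^{lu}$ be the set of upper bounds of the set of lower bounds of $A$, let $\Gamma X=\{\Gamma(A):A\subseteq X\}$, and for a partially ordered Stone space let $\Lambda X$ be the set of clopen members of $\Gamma X$. Objects are partially ordered Stone spaces $X$ that are complete lattices, whose topology is generated by $\Lambda X\cup\{-U:U\in\Lambda X\}$, such that each member of $\Gamma X$ is an intersection of members of $\Lambda X$, and such that $\Lambda X$ is a bounded sublattice of $\Gamma X$. Morphisms are continuous maps $f:X\to Y$ such that $f^{-1}$ sends $\Lambda Y$ to $\Lambda X$ and preserves finite joins of members of $\Lambda Y$ (taken in $\Gamma Y$ and $\Gamma X$). * ${\sf CG}$: for a space $X$ with a fixed subbasis $\mathcal K$ let $L=\{-U:U\in\mathcal K\}$ and $\Delta(Y)=\bigcap\{A\in L:Y\subseteq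 A\}$. Objects are pairs $(X,\mathcal K)$ such that $X$ is $T_0$ and $X=\bigcup\mathcal K$; the members of $\mathcal K$ are compact open and $\mathcal K$ is closed under finite unions; for $U,V\in\mathcal K$ and $x\in U\cap V$ there are $W,D\in\mathcal K$ with $x\in D-W$ and $D\subseteq(U\cap V)\cup W$; if $Y=\Delta(Y)$ and $\mathcal Z\subseteq L$ is nonempty such that for all $A,B\in\mathcal Z$ there are $H\in L$, $C\in\mathcal Z$ with $Y\subseteq H$ and $A\cap H,B\cap H\subseteq C$, and if $Y-A\neq\varnothing$ for all $A\in\mathcal Z$, then $Y\cap\bigcap\{-A:A\in\mathcal Z\}\ne\varnothing$; moreover $X\in\mathcal K$, and $\bigcup\{W\in\mathcal K:W\subseteq U\cap V\}\in\mathcal K$ for all $U,V\in\mathcal K$. Morphisms $(X_1,\mathcal K_1)\to(X_2,\mathcal K_2)$ are relations $S\subseteq X_1\times X_2$ such that $\Box_S B\in L_1$ for $B\in L_2$; $S[x]$ is nonempty and $S[x]=\Delta_2(S[x])$ for each $x$; and $\Box_S\Delta_2(B_1\cup B_2)\subseteq\Delta_1(\Box_SB_1\cup\Box_SB_2)$ for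 $B_1,B_2\in L_2$. The composite is $x\,(S_2\star S_1)\,z$ iff for every $B\in L_3$, $x\in\Box_{S_1}\Box_{S_2}B$ implies $z\in B$; the identity of $X$ relates $x$ to $y$ iff $y\in\overline{\{x\}}$. **Theorem.** 1. ${\sf DH}$ is equivalent to each of ${\sf JM}$, ${\sf BDGM}$, ${\sf Hs}$ and ${\sf CG}$. 2. ${\sf DH}$ is dually equivalent to ${\sf Lat}$. More precisely, the following two assignments are well-defined contravariant functors and are the two functors of a dual equivalence: the functor ${\sf DH}\to{\sf Lat}$ that sends $(X,R,Y)$ to the bounded lattice ${\sf CLF}(X)$ (ordered by inclusion) and a morphism $(f,g):(X,R,Y)\to(X',R',Y')$ to $f^{-1}:{\sf CLF}(X')\to{\sf CLF}(X)$; and the functor ${\sf Lat}\to{\sf DH}$ that sends $A$ to $({\sf Filt}(A),R,{\sf Idl}(A))$, where the filters and the ideals of $A$ are ordered by inclusion and carry the Lawson topology and $F\,R\,I$ iff $F\cap I=\varnothing$, and a homomorphism $\alpha:A\to B$ to the pair of inverse image maps $\alpha^{-1}:{\sf Filt}(B)\to{\sf Filt}(A)$ and $\alpha^{-1}:{\sf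 Idl}(B)\to{\sf Idl}(A)$. -/

import Mathlib

universe u

open CategoryTheory Order

namespace LatDual

/-! ### Filters, clopen filters and their joins -/

section FilterGen

variable {X : Type*} [Preorder X]

/-- The filter generated by `S`: the least (nonempty, down-directed, upward closed) filter
containing `S`. Joins in the lattice of filters of `X` are computed by `filterGen (⋃₀ 𝒮)`. -/
def filterGen (S : Set X) : Set X := ⋂₀ {G | IsPFilter G ∧ S ⊆ G}

theorem subset_filterGen (S : Set X) : S ⊆ filterGen S := fun _ hx _ hG => hG.2 hx

theorem filterGen_subset {S G : Set X} (hG : IsPFilter G) (h : S ⊆ G) : filterGen S ⊆ G :=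
  fun _ hx => hx G ⟨hG, h⟩

end FilterGen

section Filters

variable {X : Type*} [SemilatticeInf X] [OrderTop X]

theorem isPFilter_iff {F : Set X} :
    IsPFilter F ↔ ⊤ ∈ F ∧ (∀ a ∈ F, ∀ b ∈ F, a ⊓ b ∈ F) ∧ ∀ a ∈ F, ∀ b, a ≤ b → b ∈ F := by
  constructor
  · intro h
    have hup : ∀ a ∈ F, ∀ b, a ≤ b → b ∈ F := fun a ha b hab => h.toPFilter.mem_of_le hab ha
    exact ⟨h.toPFilter.top_mem, fun a ha b hb => h.toPFilter.inf_mem ha hb, hup⟩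
  · rintro ⟨h1, h2, h3⟩
    exact IsPFilter.of_def ⟨_, h1⟩
      (fun a ha b hb => ⟨a ⊓ b, h2 a ha b hb, inf_le_left, inf_le_right⟩)
      (fun {a b} hab ha => h3 a ha b hab)

theorem isPFilter_sInter {𝒮 : Set (Set X)} (h : ∀ G ∈ 𝒮, IsPFilter G) : IsPFilter (⋂₀ 𝒮) := by
  simp only [isPFilter_iff] at h ⊢
  exact ⟨fun G hG => (h G hG).1,
    fun a ha b hb G hG => (h G hG).2.1 a (ha G hG) b (hb G hG),
    fun a ha b hab G hG => (h G hG).2.2 a (ha G hG) b hab⟩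

theorem isPFilter_filterGen (S : Set X) : IsPFilter (filterGen S) :=
  isPFilter_sInter fun _ hG => hG.1

variable (X) in
/-- `CLF X`: the clopen filters of `X`. -/
def CLF [TopologicalSpace X] : Set (Set X) := {F | IsClopen F ∧ IsPFilter F}

variable (X) in
/-- Finite joins (including the empty one) of clopen filters are clopen. -/
def ClopenFilterJoins [TopologicalSpace X] : Prop :=
  ∀ 𝒮 : Set (Set X), 𝒮.Finite → 𝒮 ⊆ CLF X → IsClopen (filterGen (⋃₀ 𝒮))

/-- The inverse image map of `f` preserves finite joins (including the empty one) of
clopen filters. -/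
def PreservesClopenFilterJoins {Y : Type*} [SemilatticeInf Y] [OrderTop Y] [TopologicalSpace Y]
    (f : X → Y) : Prop :=
  ∀ 𝒮 : Set (Set Y), 𝒮.Finite → 𝒮 ⊆ CLF Y →
    f ⁻¹' filterGen (⋃₀ 𝒮) = filterGen (⋃ V ∈ 𝒮, f ⁻¹' V)

end Filters

/-! ### Jipsen–Moshier spaces -/

section JMDefs

variable (X : Type*) [TopologicalSpace X]

/-- Open filters with respect to the specialization order, in which `z ≤ x` means
`z ∈ closure {x}`, that is `x ⤳ z`. (Open sets are automatically upward closed.) -/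
def OF : Set (Set X) :=
  {F | IsOpen F ∧ F.Nonempty ∧ ∀ x ∈ F, ∀ y ∈ F, ∃ z ∈ F, (x ⤳ z) ∧ (y ⤳ z)}

/-- Compact open filters. -/
def KOF : Set (Set X) := {F | F ∈ OF X ∧ IsCompact F}

variable {X} in
/-- The F-saturation of a set. The fixpoints form the complete lattice `FSat X`, in which the
meet is the intersection and the join of a family is the F-saturation of its union. -/
def fsat (A : Set X) : Set X := ⋂₀ {U | U ∈ OF X ∧ A ⊆ U}

end JMDefs

/-- Objects of `JM`: Jipsen–Moshier spaces (sober spaces in which the compact open filters form a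
basis that is closed under finite intersections) such that the compact open filters form a
bounded sublattice of the lattice of F-saturated sets. -/
structure JM where
  carrier : Type u
  [top : TopologicalSpace carrier]
  t0 : T0Space carrier
  quasiSober : QuasiSober carrier
  basis : TopologicalSpace.IsTopologicalBasis (KOF carrier)
  univ_mem : Set.univ ∈ KOF carrier
  inter_mem : ∀ U ∈ KOF carrier, ∀ V ∈ KOF carrier, U ∩ V ∈ KOF carrier
  bot_mem : fsat (∅ : Set carrier) ∈ KOF carrier
  sup_mem : ∀ U ∈ KOF carrier, ∀ V ∈ KOF carrier, fsat (U ∪ V) ∈ KOF carrier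

instance : CoeSort JM.{u} (Type u) := ⟨JM.carrier⟩
instance (X : JM.{u}) : TopologicalSpace X := X.top

/-- Morphisms of `JM`: maps whose inverse image map sends compact open filters to compact open
filters and preserves finite joins of compact open filters (in the F-saturated sets). -/
@[ext]
structure JMHom (X Y : JM.{u}) where
  f : X → Y
  preimage_mem : ∀ U ∈ KOF Y, f ⁻¹' U ∈ KOF X
  preimage_join : ∀ 𝒮 : Set (Set Y), 𝒮.Finite → 𝒮 ⊆ KOF Y →
    f ⁻¹' fsat (⋃₀ 𝒮) = fsat (⋃ U ∈ 𝒮, f ⁻¹' U)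

instance : LargeCategory JM.{u} where
  Hom := JMHom
  id X := ⟨id, fun _ hU => hU, fun 𝒮 _ _ => by simp [Set.sUnion_eq_biUnion]⟩
  comp {X Y Z} a b :=
    { f := b.f ∘ a.f
      preimage_mem := fun U hU => a.preimage_mem _ (b.preimage_mem U hU)
      preimage_join := fun 𝒮 h𝒮 hK => by
        have h := a.preimage_join ((fun U => b.f ⁻¹' U) '' 𝒮) (h𝒮.image _)
          (by rintro _ ⟨U, hU, rfl⟩; exact b.preimage_mem U (hK hU))
        rw [Set.preimage_comp, b.preimage_join 𝒮 h𝒮 hK]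
        simpa [Set.preimage_comp, Set.sUnion_image] using h }

/-! ### Bezhanishvili–Dmitrieva–de Groot–Moraschini spaces -/

/-- Objects of `BDGM`: compact topological spaces carrying a meet-semilattice (with top) such
that points with `x ≰ y` are separated by a clopen filter, and in which finite joins of clopen
filters are clopen. -/
structure BDGM where
  carrier : Type u
  [top : TopologicalSpace carrier]
  [inf : SemilatticeInf carrier]
  [orderTop : OrderTop carrier]
  compact : CompactSpace carrier
  separation : ∀ x y : carrier, ¬ x ≤ y → ∃ F ∈ CLF carrier, x ∈ F ∧ y ∉ F
  joins : ClopenFilterJoins carrier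

instance : CoeSort BDGM.{u} (Type u) := ⟨BDGM.carrier⟩
instance (X : BDGM.{u}) : TopologicalSpace X := X.top
instance (X : BDGM.{u}) : SemilatticeInf X := X.inf
instance (X : BDGM.{u}) : OrderTop X := X.orderTop

/-- Morphisms of `BDGM`. -/
@[ext]
structure BDGMHom (X Y : BDGM.{u}) where
  f : X → Y
  continuous : Continuous f
  map_top : f ⊤ = ⊤
  map_inf : ∀ a b, f (a ⊓ b) = f a ⊓ f b
  eq_top : ∀ x, f x = ⊤ → x = ⊤
  exists_inf_le : ∀ (x : X) (y' z' : Y), y' ⊓ z' ≤ f x →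
    ∃ y z : X, y' ≤ f y ∧ z' ≤ f z ∧ y ⊓ z ≤ x

theorem monotone_of_map_inf {X Y : Type*} [SemilatticeInf X] [SemilatticeInf Y] {f : X → Y}
    (h : ∀ a b, f (a ⊓ b) = f a ⊓ f b) : Monotone f := fun a b hab => by
  have := h a b
  rw [inf_eq_left.2 hab] at this
  exact inf_eq_left.1 this.symm

instance : LargeCategory BDGM.{u} where
  Hom := BDGMHom
  id X := ⟨id, continuous_id, rfl, fun _ _ => rfl, fun _ h => h,
    fun _ y' z' h => ⟨y', z', le_rfl, le_rfl, h⟩⟩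
  comp a b :=
    { f := b.f ∘ a.f
      continuous := b.continuous.comp a.continuous
      map_top := by simp [a.map_top, b.map_top]
      map_inf := fun x y => by simp [a.map_inf, b.map_inf]
      eq_top := fun x h => a.eq_top x (b.eq_top _ h)
      exists_inf_le := fun x y'' z'' h => by
        obtain ⟨y', z', hy', hz', h'⟩ := b.exists_inf_le _ _ _ h
        obtain ⟨y, z, hy, hz, h''⟩ := a.exists_inf_le _ _ _ h'
        have hb := monotone_of_map_inf b.map_inf
        exact ⟨y, z, hy'.trans (hb hy), hz'.trans (hb hz), h''⟩ }

/-! ### Hartonas spaces -/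

section HsDefs

variable {X : Type*} [PartialOrder X]

/-- The closure operator `A ↦ Aˡᵘ`. -/
def Gam (A : Set X) : Set X := upperBounds (lowerBounds A)

variable (X) in
/-- The complete lattice of sets closed under `Gam`: the meet is the intersection, and the join
of a family is `Gam` of its union. -/
def GamSets : Set (Set X) := Set.range (Gam : Set X → Set X)

variable (X) in
/-- The clopen members of `GamSets X`. -/
def LamSets [TopologicalSpace X] : Set (Set X) := {U | U ∈ GamSets X ∧ IsClopen U}

end HsDefs

/-- Objects of `Hs`: Stone spaces with a partial order that is a complete lattice, such that the
topology is generated by the clopen `Gam`-closed sets and their complements, every `Gam`-closed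
set is an intersection of clopen ones, and the clopen ones form a bounded sublattice of the
lattice of `Gam`-closed sets. -/
structure Hs where
  carrier : Type u
  [top : TopologicalSpace carrier]
  [lat : CompleteLattice carrier]
  compact : CompactSpace carrier
  t2 : T2Space carrier
  totallyDisconnected : TotallyDisconnectedSpace carrier
  generate : top = TopologicalSpace.generateFrom
    (LamSets carrier ∪ {V | ∃ U ∈ LamSets carrier, V = Uᶜ})
  meetDense : ∀ A ∈ GamSets carrier, ∃ 𝒮 ⊆ LamSets carrier, A = ⋂₀ 𝒮
  univ_mem : Set.univ ∈ LamSets carrier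
  bot_mem : Gam (∅ : Set carrier) ∈ LamSets carrier
  inter_mem : ∀ U ∈ LamSets carrier, ∀ V ∈ LamSets carrier, U ∩ V ∈ LamSets carrier
  sup_mem : ∀ U ∈ LamSets carrier, ∀ V ∈ LamSets carrier, Gam (U ∪ V) ∈ LamSets carrier

instance : CoeSort Hs.{u} (Type u) := ⟨Hs.carrier⟩
instance (X : Hs.{u}) : TopologicalSpace X := X.top
instance (X : Hs.{u}) : CompleteLattice X := X.lat

/-- Morphisms of `Hs`: continuous maps whose inverse image map restricts to a map between the
clopen `Gam`-closed sets which preserves finite joins. -/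
@[ext]
structure HsHom (X Y : Hs.{u}) where
  f : X → Y
  continuous : Continuous f
  preimage_mem : ∀ U ∈ LamSets Y, f ⁻¹' U ∈ LamSets X
  preimage_join : ∀ 𝒮 : Set (Set Y), 𝒮.Finite → 𝒮 ⊆ LamSets Y →
    f ⁻¹' Gam (⋃₀ 𝒮) = Gam (⋃ U ∈ 𝒮, f ⁻¹' U)

instance : LargeCategory Hs.{u} where
  Hom := HsHom
  id X := ⟨id, continuous_id, fun _ hU => hU, fun 𝒮 _ _ => by simp [Set.sUnion_eq_biUnion]⟩
  comp {X Y Z} a b :=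
    { f := b.f ∘ a.f
      continuous := b.continuous.comp a.continuous
      preimage_mem := fun U hU => a.preimage_mem _ (b.preimage_mem U hU)
      preimage_join := fun 𝒮 h𝒮 hK => by
        have h := a.preimage_join ((fun U => b.f ⁻¹' U) '' 𝒮) (h𝒮.image _)
          (by rintro _ ⟨U, hU, rfl⟩; exact b.preimage_mem U (hK hU))
        rw [Set.preimage_comp, b.preimage_join 𝒮 h𝒮 hK]
        simpa [Set.preimage_comp, Set.sUnion_image] using h }

/-! ### Celani–González spaces -/

section CGDefs

variable {X : Type*} (𝒦 : Set (Set X))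

/-- The complements of the members of `𝒦`. -/
def compls : Set (Set X) := {A | Aᶜ ∈ 𝒦}

/-- The closure operator induced by `compls 𝒦`. -/
def Del (Y : Set X) : Set X := ⋂₀ {A | A ∈ compls 𝒦 ∧ Y ⊆ A}

/-- `𝒵` is a `Y`-family. -/
def IsFam (Y : Set X) (𝒵 : Set (Set X)) : Prop :=
  𝒵 ⊆ compls 𝒦 ∧
    ∀ A ∈ 𝒵, ∀ B ∈ 𝒵, ∃ H ∈ compls 𝒦, ∃ C ∈ 𝒵, Y ⊆ H ∧ A ∩ H ⊆ C ∧ B ∩ H ⊆ C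

end CGDefs

/-- Objects of `CG`: Celani–González spaces, i.e. pairs of a topological space and a subbasis
`𝒦` with the properties `t0`, ..., `fam`, subject to the additional conditions `univ_mem` and
`meet_mem`. -/
structure CG where
  carrier : Type u
  [top : TopologicalSpace carrier]
  𝒦 : Set (Set carrier)
  subbasis : top = TopologicalSpace.generateFrom 𝒦
  t0 : T0Space carrier
  sUnion_eq : ⋃₀ 𝒦 = Set.univ
  compact_open : ∀ U ∈ 𝒦, IsCompact U ∧ IsOpen U
  empty_mem : ∅ ∈ 𝒦
  union_mem : ∀ U ∈ 𝒦, ∀ V ∈ 𝒦, U ∪ V ∈ 𝒦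
  exists_diff : ∀ U ∈ 𝒦, ∀ V ∈ 𝒦, ∀ x ∈ U ∩ V,
    ∃ W ∈ 𝒦, ∃ D ∈ 𝒦, x ∈ D \ W ∧ D ⊆ (U ∩ V) ∪ W
  fam : ∀ (Y : Set carrier) (𝒵 : Set (Set carrier)), Del 𝒦 Y = Y → 𝒵.Nonempty → IsFam 𝒦 Y 𝒵 →
    (∀ A ∈ 𝒵, (Y \ A).Nonempty) → (Y ∩ ⋂ A ∈ 𝒵, Aᶜ).Nonempty
  univ_mem : Set.univ ∈ 𝒦
  meet_mem : ∀ U ∈ 𝒦, ∀ V ∈ 𝒦, ⋃₀ {W | W ∈ 𝒦 ∧ W ⊆ U ∩ V} ∈ 𝒦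

instance : CoeSort CG.{u} (Type u) := ⟨CG.carrier⟩
instance (X : CG.{u}) : TopologicalSpace X := X.top

/-- Morphisms of `CG`: relations `S`, where `S.rel.core B` is the box operator
`{x | S[x] ⊆ B}` and `S.rel.image {x}` is `S[x]`. -/
@[ext]
structure CGHom (X Y : CG.{u}) where
  rel : SetRel X Y
  core_mem : ∀ B ∈ compls Y.𝒦, rel.core B ∈ compls X.𝒦
  image_closed : ∀ x, Del Y.𝒦 (rel.image {x}) = rel.image {x}
  serial : ∀ x, (rel.image {x}).Nonempty
  core_join : ∀ B₁ ∈ compls Y.𝒦, ∀ B₂ ∈ compls Y.𝒦,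
    rel.core (Del Y.𝒦 (B₁ ∪ B₂)) ⊆ Del X.𝒦 (rel.core B₁ ∪ rel.core B₂)

/-- The composite `T ⋆ S` of `S : X → Y` and `T : Y → Z`. -/
def CGStar {X Y Z : CG.{u}} (S : CGHom X Y) (T : CGHom Y Z) : SetRel X Z :=
  {p | ∀ B ∈ compls Z.𝒦, p.1 ∈ S.rel.core (T.rel.core B) → p.2 ∈ B}

theorem subset_Del {X : Type*} (𝒦 : Set (Set X)) (Y : Set X) : Y ⊆ Del 𝒦 Y :=
  fun _ hy _ hA => hA.2 hy

theorem Del_mono {X : Type*} (𝒦 : Set (Set X)) {Y Z : Set X} (h : Y ⊆ Z) : Del 𝒦 Y ⊆ Del 𝒦 Z :=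
  fun _ hy A hA => hy A ⟨hA.1, h.trans hA.2⟩

theorem Del_eq_of_mem {X : Type*} (𝒦 : Set (Set X)) {B : Set X} (h : B ∈ compls 𝒦) :
    Del 𝒦 B = B :=
  Set.Subset.antisymm (fun _ hy => hy B ⟨h, subset_rfl⟩) (subset_Del 𝒦 B)

theorem core_CGStar_subset {X Y Z : CG.{u}} (S : CGHom X Y) (T : CGHom Y Z) (B : Set Z) :
    SetRel.core (CGStar S T) B ⊆ S.rel.core (T.rel.core B) :=
  fun _ hx _ hy _ hz => hx fun _ _ h => h hy hz

theorem core_CGStar {X Y Z : CG.{u}} (S : CGHom X Y) (T : CGHom Y Z) {B : Set Z}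
    (hB : B ∈ compls Z.𝒦) : SetRel.core (CGStar S T) B = S.rel.core (T.rel.core B) :=
  Set.Subset.antisymm (core_CGStar_subset S T B) fun _ hx _ hz => hz B hB hx

theorem CGHom.mem_rel_iff {X Y : CG.{u}} (S : CGHom X Y) (x : X) (y : Y) :
    (x, y) ∈ S.rel ↔ ∀ B ∈ compls Y.𝒦, x ∈ S.rel.core B → y ∈ B := by
  constructor
  · intro h B _ hx
    exact hx h
  · intro h
    have : y ∈ Del Y.𝒦 (S.rel.image {x}) := fun B hB =>
      h B hB.1 fun z hz => hB.2 ⟨x, rfl, hz⟩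
    rw [S.image_closed] at this
    obtain ⟨x', rfl, hx⟩ := this
    exact hx

theorem CGHom.ext_core {X Y : CG.{u}} {S T : CGHom X Y}
    (h : ∀ B ∈ compls Y.𝒦, S.rel.core B = T.rel.core B) : S = T := by
  ext ⟨x, y⟩
  rw [S.mem_rel_iff, T.mem_rel_iff]
  exact forall₂_congr fun B hB => by rw [h B hB]

/-- Composition of morphisms of `CG`. -/
def CGHom.comp {X Y Z : CG.{u}} (S : CGHom X Y) (T : CGHom Y Z) : CGHom X Z where
  rel := CGStar S T
  core_mem B hB := by
    rw [core_CGStar S T hB]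
    exact S.core_mem _ (T.core_mem _ hB)
  image_closed x := by
    refine Set.Subset.antisymm (fun z hz => ⟨x, rfl, fun B hB hx => ?_⟩) (subset_Del _ _)
    refine hz B ⟨hB, ?_⟩
    rintro w ⟨_, rfl, hw⟩
    exact hw B hB hx
  serial x := by
    obtain ⟨y, _, rfl, hy⟩ := S.serial x
    obtain ⟨z, _, rfl, hz⟩ := T.serial y
    exact ⟨z, _, rfl, fun B _ hx => hx hy hz⟩
  core_join B₁ h₁ B₂ h₂ := by
    rw [core_CGStar S T h₁, core_CGStar S T h₂]
    refine (core_CGStar_subset S T _).trans ?_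
    refine subset_trans ?_ (S.core_join _ (T.core_mem _ h₁) _ (T.core_mem _ h₂))
    intro x hx y hy
    exact T.core_join _ h₁ _ h₂ (hx hy)

theorem core_specializes {X : CG.{u}} {B : Set X} (hB : B ∈ compls X.𝒦) :
    SetRel.core {p : X × X | p.1 ⤳ p.2} B = B := by
  refine Set.Subset.antisymm (fun x hx => hx (specializes_rfl (x := x))) fun x hx y hy => ?_
  have : IsClosed B := isOpen_compl_iff.1 (X.compact_open _ hB).2
  exact Specializes.mem_closed hy this hx

/-- The identity of `X`: the dual of the specialization order, `x ≤ y` iff `y ∈ closure {x}`. -/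
def CGHom.id (X : CG.{u}) : CGHom X X where
  rel := {p : X × X | p.1 ⤳ p.2}
  core_mem B hB := by rwa [core_specializes hB]
  image_closed x := by
    refine Set.Subset.antisymm (fun y hy => ⟨x, rfl, ?_⟩) (subset_Del _ _)
    have key : ∀ U ∈ X.𝒦, y ∈ U → x ∈ U := by
      intro U hU hyU
      by_contra hx
      refine hy Uᶜ ⟨by simpa [compls] using hU, ?_⟩ hyU
      rintro z ⟨_, rfl, hz⟩ hzU
      exact hx (Specializes.mem_open hz (X.compact_open U hU).2 hzU)
    have h : @Specializes X (TopologicalSpace.generateFrom X.𝒦) x y := by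
      let _ : TopologicalSpace X := TopologicalSpace.generateFrom X.𝒦
      rw [specializes_iff_pure, TopologicalSpace.nhds_generateFrom]
      simp only [le_iInf_iff]
      rintro U ⟨hyU, hU⟩
      simpa using key U hU hyU
    have h2 := X.subbasis
    change @Specializes X X.top x y
    rw [h2]
    exact h
  serial x := ⟨x, x, rfl, specializes_rfl⟩
  core_join B₁ h₁ B₂ h₂ := by
    rw [core_specializes h₁, core_specializes h₂]
    exact fun x hx => hx (specializes_rfl (x := x))

instance : LargeCategory CG.{u} where
  Hom := CGHom
  id := CGHom.id
  comp := CGHom.comp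
  id_comp {X Y} S := CGHom.ext_core fun B hB => by
    change SetRel.core (CGStar (CGHom.id X) S) B = _
    rw [core_CGStar _ _ hB]
    exact core_specializes (S.core_mem B hB)
  comp_id {X Y} S := CGHom.ext_core fun B hB => by
    change SetRel.core (CGStar S (CGHom.id Y)) B = _
    rw [core_CGStar _ _ hB]
    exact congrArg S.rel.core (core_specializes hB)
  assoc {W X Y Z} S T V := CGHom.ext_core fun B hB => by
    change SetRel.core (CGStar (CGHom.comp S T) V) B = SetRel.core (CGStar S (CGHom.comp T V)) B
    rw [core_CGStar _ _ hB, core_CGStar _ _ hB]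
    change SetRel.core (CGStar S T) _ = S.rel.core (SetRel.core (CGStar T V) B)
    rw [core_CGStar _ _ hB, core_CGStar _ _ (V.core_mem B hB)]

/-! ### Coherent lattices with the Lawson topology -/

/-- Coherent lattices: algebraic lattices in which the top element is compact and binary meets of
compact elements are compact. -/
structure IsCoherent (L : Type*) [CompleteLattice L] : Prop where
  algebraic : IsCompactlyGenerated L
  top_compact : IsCompactElement (⊤ : L)
  inf_compact : ∀ a b : L, IsCompactElement a → IsCompactElement b → IsCompactElement (a ⊓ b)

/-- Lawson-continuous meet-semilattice homomorphisms that have a left adjoint which preserves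
finite meets. -/
structure IsCohHom {X Y : Type*} [CompleteLattice X] [TopologicalSpace X] [CompleteLattice Y]
    [TopologicalSpace Y] (f : X → Y) : Prop where
  continuous : Continuous f
  map_top : f ⊤ = ⊤
  map_inf : ∀ a b, f (a ⊓ b) = f a ⊓ f b
  adjoint : ∃ l : Y → X, GaloisConnection l f ∧ l ⊤ = ⊤ ∧ ∀ a b, l (a ⊓ b) = l a ⊓ l b

theorem IsCohHom.id (X : Type*) [CompleteLattice X] [TopologicalSpace X] :
    IsCohHom (fun x : X => x) :=
  ⟨continuous_id, rfl, fun _ _ => rfl, ⟨fun x => x, GaloisConnection.id, rfl, fun _ _ => rfl⟩⟩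

theorem IsCohHom.comp {X Y Z : Type*} [CompleteLattice X] [TopologicalSpace X]
    [CompleteLattice Y] [TopologicalSpace Y] [CompleteLattice Z] [TopologicalSpace Z]
    {g : Y → Z} {f : X → Y} (hg : IsCohHom g) (hf : IsCohHom f) : IsCohHom (g ∘ f) := by
  obtain ⟨l, hl, hlt, hli⟩ := hf.adjoint
  obtain ⟨m, hm, hmt, hmi⟩ := hg.adjoint
  exact ⟨hg.continuous.comp hf.continuous, by simp [hf.map_top, hg.map_top],
    fun a b => by simp [hf.map_inf, hg.map_inf],
    ⟨l ∘ m, hm.compose hl, by simp [hlt, hmt], fun a b => by simp [hli, hmi]⟩⟩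

/-- A coherent lattice with the Lawson topology. -/
structure CohLat where
  carrier : Type u
  [lat : CompleteLattice carrier]
  [top : TopologicalSpace carrier]
  lawson : Topology.IsLawson carrier
  coherent : IsCoherent carrier

instance : CoeSort CohLat.{u} (Type u) := ⟨CohLat.carrier⟩
instance (X : CohLat.{u}) : CompleteLattice X := X.lat
instance (X : CohLat.{u}) : TopologicalSpace X := X.top

/-! ### Dunn–Hartonas spaces -/

/-- DH-relations; `R.image {x}` is `R[x]` and `R.preimage {y}` is `R⁻¹[y]`. The first four fields
say that `R` is an interior relation. -/
structure IsDHRelation {X Y : Type*} [CompleteLattice X] [TopologicalSpace X]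
    [CompleteLattice Y] [TopologicalSpace Y] (R : SetRel X Y) : Prop where
  image_closed : ∀ x, IsClosed (R.image {x})
  image_clopen : ∀ U, IsClopen U → IsClopen (R.image U)
  preimage_closed : ∀ y, IsClosed (R.preimage {y})
  preimage_clopen : ∀ V, IsClopen V → IsClopen (R.preimage V)
  image_compl_filter : ∀ x, IsPFilter (R.image {x})ᶜ
  preimage_compl_filter : ∀ y, IsPFilter (R.preimage {y})ᶜ
  le_of_image : ∀ x x', R.image {x} ⊆ R.image {x'} → x' ≤ x
  le_of_preimage : ∀ y y', R.preimage {y} ⊆ R.preimage {y'} → y' ≤ y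

/-- The conditions on a pair `(f, g)` to be a DH-morphism. -/
structure IsDHMorphism {X₁ Y₁ X₂ Y₂ : Type*} [CompleteLattice X₁] [TopologicalSpace X₁]
    [CompleteLattice Y₁] [TopologicalSpace Y₁] [CompleteLattice X₂] [TopologicalSpace X₂]
    [CompleteLattice Y₂] [TopologicalSpace Y₂] (R₁ : SetRel X₁ Y₁) (R₂ : SetRel X₂ Y₂)
    (f : X₁ → X₂) (g : Y₁ → Y₂) : Prop where
  left : IsCohHom f
  right : IsCohHom g
  map_rel : ∀ x y, (x, y) ∈ R₁ → (f x, g y) ∈ R₂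
  lift_left : ∀ x' y, (x', g y) ∈ R₂ → ∃ x, (x, y) ∈ R₁ ∧ x' ≤ f x
  lift_right : ∀ x y', (f x, y') ∈ R₂ → ∃ y, (x, y) ∈ R₁ ∧ y' ≤ g y

/-- Objects of `DH`: Dunn–Hartonas spaces. -/
structure DH where
  X : CohLat.{u}
  Y : CohLat.{u}
  R : SetRel X Y
  isDHRelation : IsDHRelation R

/-- Morphisms of `DH`. -/
@[ext]
structure DHHom (D E : DH.{u}) where
  f : D.X → E.X
  g : D.Y → E.Y
  isDHMorphism : IsDHMorphism D.R E.R f g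

instance : LargeCategory DH.{u} where
  Hom := DHHom
  id D := ⟨fun x => x, fun y => y, ⟨IsCohHom.id _, IsCohHom.id _, fun _ _ h => h,
    fun x _ h => ⟨x, h, le_rfl⟩, fun _ y h => ⟨y, h, le_rfl⟩⟩⟩
  comp a b :=
    { f := b.f ∘ a.f
      g := b.g ∘ a.g
      isDHMorphism :=
        { left := b.isDHMorphism.left.comp a.isDHMorphism.left
          right := b.isDHMorphism.right.comp a.isDHMorphism.right
          map_rel := fun x y h => b.isDHMorphism.map_rel _ _ (a.isDHMorphism.map_rel _ _ h)
          lift_left := fun x'' y h => by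
            obtain ⟨x', h', hx'⟩ := b.isDHMorphism.lift_left _ _ h
            obtain ⟨x, h'', hx⟩ := a.isDHMorphism.lift_left _ _ h'
            exact ⟨x, h'', hx'.trans (monotone_of_map_inf b.isDHMorphism.left.map_inf hx)⟩
          lift_right := fun x y'' h => by
            obtain ⟨y', h', hy'⟩ := b.isDHMorphism.lift_right _ _ h
            obtain ⟨y, h'', hy⟩ := a.isDHMorphism.lift_right _ _ h'
            exact ⟨y, h'', hy'.trans (monotone_of_map_inf b.isDHMorphism.right.map_inf hy)⟩ } }

/-! ### The functor `CLF`

Bounded lattices and their homomorphisms are Mathlib's category `BddLat`. -/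

section CLFFunctor

/-- The lattice of clopen filters, ordered by inclusion. -/
@[reducible]
def clfLattice {X : Type*} [SemilatticeInf X] [OrderTop X] [TopologicalSpace X]
    (h : ClopenFilterJoins X) : Lattice (CLF X) where
  __ := (inferInstance : PartialOrder (CLF X))
  inf F G := ⟨F.1 ∩ G.1, F.2.1.inter G.2.1, by
    have := isPFilter_sInter (𝒮 := {F.1, G.1}) (by simp [F.2.2, G.2.2])
    simpa using this⟩
  inf_le_left _ _ := Set.inter_subset_left
  inf_le_right _ _ := Set.inter_subset_right
  le_inf _ _ _ h1 h2 := Set.subset_inter h1 h2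
  sup F G := ⟨filterGen (⋃₀ {F.1, G.1}),
    h _ (Set.toFinite _) (by rintro _ (rfl | rfl); exacts [F.2, G.2]), isPFilter_filterGen _⟩
  le_sup_left F G := fun _ hx => subset_filterGen _ ⟨F.1, by simp, hx⟩
  le_sup_right F G := fun _ hx => subset_filterGen _ ⟨G.1, by simp, hx⟩
  sup_le F G H h1 h2 := filterGen_subset H.2.2 (by
    rintro x ⟨_, (rfl | rfl), hx⟩
    exacts [h1 hx, h2 hx])

/-- The bounded lattice of clopen filters. -/
@[reducible]
def clfBounded {X : Type*} [SemilatticeInf X] [OrderTop X] [TopologicalSpace X]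
    (h : ClopenFilterJoins X) : BoundedOrder (CLF X) where
  top := ⟨Set.univ, isClopen_univ, by simp [isPFilter_iff]⟩
  le_top F := Set.subset_univ F.1
  bot := ⟨filterGen (⋃₀ ∅), h _ Set.finite_empty (by simp), isPFilter_filterGen _⟩
  bot_le F := filterGen_subset F.2.2 (by simp)

/-- The bounded lattice of clopen filters, bundled. -/
def clfObj {X : Type u} [SemilatticeInf X] [OrderTop X] [TopologicalSpace X]
    (h : ClopenFilterJoins X) : BddLat.{u} :=
  letI := clfLattice h
  letI := clfBounded h
  BddLat.of (CLF X)

theorem preimage_mem_CLF {X Y : Type*} [CompleteLattice X] [TopologicalSpace X]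
    [CompleteLattice Y] [TopologicalSpace Y] {f : X → Y} (hf : IsCohHom f) {F : Set Y}
    (hF : F ∈ CLF Y) : f ⁻¹' F ∈ CLF X := by
  refine ⟨hF.1.preimage hf.continuous, ?_⟩
  have h := isPFilter_iff.1 hF.2
  rw [isPFilter_iff]
  refine ⟨by simpa [hf.map_top] using h.1, fun a ha b hb => ?_, fun a ha b hab => ?_⟩
  · simpa [hf.map_inf] using h.2.1 _ ha _ hb
  · exact h.2.2 _ ha _ (monotone_of_map_inf hf.map_inf hab)

/-- Inverse image, as a bounded lattice homomorphism between the lattices of clopen filters. -/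
def clfMap {X Y : Type u} [CompleteLattice X] [TopologicalSpace X]
    [CompleteLattice Y] [TopologicalSpace Y] (hX : ClopenFilterJoins X)
    (hY : ClopenFilterJoins Y) {f : X → Y} (hf : IsCohHom f)
    (hp : PreservesClopenFilterJoins f) : clfObj hY ⟶ clfObj hX :=
  letI := clfLattice hX
  letI := clfBounded hX
  letI := clfLattice hY
  letI := clfBounded hY
  BddLat.ofHom (X := CLF Y) (Y := CLF X)
    { toFun := fun F => ⟨f ⁻¹' F.1, preimage_mem_CLF hf F.2⟩
      map_sup' := fun F G => Subtype.ext (by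
        have h := hp {F.1, G.1} (Set.toFinite _)
          (by rintro _ (rfl | rfl); exacts [F.2, G.2])
        change f ⁻¹' filterGen (⋃₀ {F.1, G.1}) = filterGen (⋃₀ {f ⁻¹' F.1, f ⁻¹' G.1})
        rw [h]
        simp)
      map_inf' := fun _ _ => rfl
      map_top' := rfl
      map_bot' := Subtype.ext (by
        have h := hp ∅ Set.finite_empty (by simp)
        change f ⁻¹' filterGen (⋃₀ ∅) = filterGen (⋃₀ ∅)
        rw [h]
        simp) }

/-- The functor `(X, R, Y) ↦ CLF X`, `(f, g) ↦ f⁻¹`, given that the values on objects are bounded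
lattices and that the values on morphisms preserve finite joins. -/
def clfFunctor (hj : ∀ D : DH.{u}, ClopenFilterJoins D.X)
    (hp : ∀ (D E : DH.{u}) (φ : D ⟶ E), PreservesClopenFilterJoins (DHHom.f φ)) :
    DH.{u}ᵒᵖ ⥤ BddLat.{u} where
  obj D := clfObj (hj D.unop)
  map {D E} φ := clfMap (hj E.unop) (hj D.unop) (DHHom.isDHMorphism φ.unop).left (hp _ _ φ.unop)
  map_id _ := rfl
  map_comp _ _ := rfl

end CLFFunctor

/-! ### The functor `A ↦ (Filt A, R, Idl A)` -/

section FiltIdl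

/-- The filters of a bounded lattice, ordered by inclusion. -/
def Filt (A : Type*) [Lattice A] [BoundedOrder A] : Type _ := PFilter A

/-- The ideals of a bounded lattice, ordered by inclusion. -/
def Idl (A : Type*) [Lattice A] [BoundedOrder A] : Type _ := Ideal A

variable {A B : Type*} [Lattice A] [BoundedOrder A] [Lattice B] [BoundedOrder B]

instance : SetLike (Filt A) A := inferInstanceAs (SetLike (PFilter A) A)
instance : PartialOrder (Filt A) := inferInstanceAs (PartialOrder (PFilter A))
instance : SetLike (Idl A) A := inferInstanceAs (SetLike (Ideal A) A)

/-- The complete lattice of filters: its order is inclusion, its meet is intersection. -/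
noncomputable instance : CompleteLattice (Filt A) :=
  letI : InfSet (Filt A) := ⟨fun 𝒮 => IsPFilter.toPFilter
    (isPFilter_sInter (𝒮 := (fun F : Filt A => (F : Set A)) '' 𝒮)
      (by rintro _ ⟨F, _, rfl⟩; exact PFilter.isPFilter F))⟩
  completeLatticeOfInf (Filt A) fun 𝒮 =>
    ⟨fun F hF x hx => hx F ⟨F, hF, rfl⟩, fun F hF x hx => by
      rintro _ ⟨G, hG, rfl⟩
      exact hF hG hx⟩

instance : CompleteLattice (Idl A) := inferInstanceAs (CompleteLattice (Ideal A))

instance : TopologicalSpace (Filt A) := Topology.lawson (Filt A)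
instance : TopologicalSpace (Idl A) := Topology.lawson (Idl A)

/-- `F R I` iff `F ∩ I = ∅`. -/
def disjRel (A : Type*) [Lattice A] [BoundedOrder A] : SetRel (Filt A) (Idl A) :=
  {p | (p.1 : Set A) ∩ (p.2 : Set A) = ∅}

/-- The inverse image of a filter under a bounded lattice homomorphism. -/
def filtComap (α : BoundedLatticeHom A B) (F : Filt B) : Filt A :=
  IsPFilter.toPFilter (F := α ⁻¹' (F : Set B)) (by
    have h0 : IsPFilter (F : Set B) := PFilter.isPFilter (F := F)
    have h := isPFilter_iff.1 h0
    rw [isPFilter_iff]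
    refine ⟨?_, fun a ha b hb => ?_, fun a ha b hab => ?_⟩
    · rw [Set.mem_preimage, map_top]
      exact h.1
    · rw [Set.mem_preimage, map_inf]
      exact h.2.1 _ ha _ hb
    · exact h.2.2 _ ha _ (OrderHomClass.mono α hab))

/-- The inverse image of an ideal under a bounded lattice homomorphism. -/
def idlComap (α : BoundedLatticeHom A B) (I : Idl B) : Idl A :=
  IsIdeal.toIdeal (I := α ⁻¹' (I : Set B))
    { IsLowerSet := fun _ _ hba ha => Ideal.lower I (OrderHomClass.mono α hba) ha
      Nonempty := ⟨⊥, by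
        have : (⊥ : B) ∈ (I : Set B) := Ideal.bot_mem I
        simpa using this⟩
      Directed := fun a ha b hb => ⟨a ⊔ b, by
        have : α a ⊔ α b ∈ (I : Set B) := Ideal.sup_mem (s := I) ha hb
        simpa using this, le_sup_left, le_sup_right⟩ }

theorem coe_filtComap (α : BoundedLatticeHom A B) (F : Filt B) :
    (filtComap α F : Set A) = α ⁻¹' (F : Set B) := rfl

theorem coe_idlComap (α : BoundedLatticeHom A B) (I : Idl B) :
    (idlComap α I : Set A) = α ⁻¹' (I : Set B) := rfl

end FiltIdl

/-- The triple `(Filt A, R, Idl A)` with the Lawson topologies as a DH-space, given that it is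
one. -/
noncomputable def filtIdlObj (A : BddLat.{u}) (hF : IsCoherent (Filt A)) (hI : IsCoherent (Idl A))
    (hR : IsDHRelation (disjRel A)) : DH.{u} where
  X := { carrier := Filt A, lawson := ⟨rfl⟩, coherent := hF }
  Y := { carrier := Idl A, lawson := ⟨rfl⟩, coherent := hI }
  R := disjRel A
  isDHRelation := hR

/-- The functor `A ↦ (Filt A, R, Idl A)`, `α ↦ (α⁻¹, α⁻¹)`, given that its values on objects are
DH-spaces and that its values on morphisms are DH-morphisms. -/
noncomputable def filtIdlFunctor (hF : ∀ A : BddLat.{u}, IsCoherent (Filt A))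
    (hI : ∀ A : BddLat.{u}, IsCoherent (Idl A))
    (hR : ∀ A : BddLat.{u}, IsDHRelation (disjRel A))
    (hα : ∀ (A B : BddLat.{u}) (α : A ⟶ B),
      IsDHMorphism (disjRel B) (disjRel A) (filtComap α.hom) (idlComap α.hom)) :
    BddLat.{u} ⥤ DH.{u}ᵒᵖ where
  obj A := Opposite.op (filtIdlObj A (hF A) (hI A) (hR A))
  map {A B} α := Quiver.Hom.op
    (show filtIdlObj B (hF B) (hI B) (hR B) ⟶ filtIdlObj A (hF A) (hI A) (hR A) from
      ⟨filtComap α.hom, idlComap α.hom, hα A B α⟩)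
  map_id _ := rfl
  map_comp _ _ := rfl

end LatDual

namespace LatDual

/-! ### Hulls -/

section Hull

variable {X : Type*}

/-! All these categories encode one kind of object. Take a set `X` with a family `𝒦` of subsets that
is a bounded lattice under inclusion, with finite intersections as meets, and suppose that each
filter of `𝒦` consists of the members containing exactly one point (`IsFilterFamily`). Then `X` is
the set of filters of the lattice `𝒦`. Such filter spaces, with the maps whose inverse image is a
lattice homomorphism, are dually equivalent to bounded lattices: a homomorphism is induced by a
unique map (`exists_isFamilyMap`), and a lattice is represented on its filters
(`isFilterFamily_filtSets`).

`JM`, `BDGM` and `Hs` equip `X` with a topology, and the latter two also with an order. The topology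
is generated by `𝒦`, or by `𝒦` and its complements (the patch topology); the order is
specialization. Conversely, `𝒦` is recovered as the compact open filters, the clopen filters, or the
clopen Galois closed sets. Two facts carry this: members of `𝒦` have a least point, and in the
compact patch topology a clopen principal upset belongs to `𝒦` (`mem_of_isClopen`). In the other
direction, sobriety or compactness turns filters into points (`JM.isFilterFamily`,
`isFilterFamily_of_compact`). Joins prescribed in larger closure systems agree with joins in `𝒦` by
`hull_eq_hull`.

`CG` has only the irreducible filters as points, and its morphisms are relations, so it is compared
with bounded lattices directly. Fullness is a compactness argument (`CG.exists_hom`); essential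
surjectivity comes from Zorn's lemma (`Filt.exists_isIrreducible`).

For `DH`, the Lawson topology of a coherent lattice is the patch topology of the principal filters
of compact elements (`IsCoherent.lawson_eq_patch`). Hence `X` and `Y` are the filters of `CLF X` and
of `CLF Y`. The relation induces polars, which form a dual isomorphism between `CLF X` and `CLF Y`
(`IsDHRelation.polar_polar`), so `Y` is also the set of ideals of `CLF X`. Under these
identifications the relation becomes disjointness (`IsDHRelation.rel_iff`). -/

/-- The closure operator induced by a family of sets. -/
def hull (𝒢 : Set (Set X)) (A : Set X) : Set X := ⋂₀ {G | G ∈ 𝒢 ∧ A ⊆ G}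

variable {𝒢 𝒦 : Set (Set X)} {A B G : Set X}

theorem subset_hull (𝒢 : Set (Set X)) (A : Set X) : A ⊆ hull 𝒢 A := fun _ hx _ hG => hG.2 hx

theorem hull_subset (hG : G ∈ 𝒢) (h : A ⊆ G) : hull 𝒢 A ⊆ G := fun _ hx => hx G ⟨hG, h⟩

theorem hull_mono (h : A ⊆ B) : hull 𝒢 A ⊆ hull 𝒢 B := fun _ hx G hG => hx G ⟨hG.1, h.trans hG.2⟩

theorem hull_eq_self (hA : A ∈ 𝒢) : hull 𝒢 A = A :=
  (hull_subset hA subset_rfl).antisymm (subset_hull _ _)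

theorem hull_union_hull (A B : Set X) : hull 𝒢 (A ∪ hull 𝒢 B) = hull 𝒢 (A ∪ B) := by
  refine Set.Subset.antisymm (fun x hx G hG => hx G ⟨hG.1, ?_⟩)
    (hull_mono (Set.union_subset_union_right _ (subset_hull _ _)))
  have h := Set.union_subset_iff.1 hG.2
  exact Set.union_subset h.1 (hull_subset hG.1 h.2)

/-- This makes the ambient closure system irrelevant. The join of members of `𝒦` may be taken among
F-saturated sets, filters or Galois closed sets; once it lies in `𝒦`, it is the least member of `𝒦`
above them. -/
theorem hull_eq_hull (h𝒦 : 𝒦 ⊆ 𝒢) (hA : hull 𝒢 A ∈ 𝒦) : hull 𝒢 A = hull 𝒦 A :=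
  Set.Subset.antisymm (fun _ hx G hG => hx G ⟨h𝒦 hG.1, hG.2⟩) (hull_subset hA (subset_hull _ _))

/-- The family `𝒦` consists of closed sets of the closure operator `hull 𝒢`, and is closed under
finite joins of closed sets. -/
structure JoinClosed (𝒦 𝒢 : Set (Set X)) : Prop where
  subset : 𝒦 ⊆ 𝒢
  hull_empty_mem : hull 𝒢 ∅ ∈ 𝒦
  hull_union_mem : ∀ U ∈ 𝒦, ∀ V ∈ 𝒦, hull 𝒢 (U ∪ V) ∈ 𝒦

theorem JoinClosed.hull_sUnion_mem (h : JoinClosed 𝒦 𝒢) {𝒮 : Set (Set X)} (hfin : 𝒮.Finite) :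
    𝒮 ⊆ 𝒦 → hull 𝒢 (⋃₀ 𝒮) ∈ 𝒦 := by
  induction 𝒮, hfin using Set.Finite.induction_on with
  | empty => intro _; simpa using h.hull_empty_mem
  | @insert U 𝒮 _ _ ih =>
    intro hU
    rw [Set.insert_subset_iff] at hU
    rw [Set.sUnion_insert, ← hull_union_hull]
    exact h.hull_union_mem _ hU.1 _ (ih hU.2)

theorem JoinClosed.hull_empty_eq (h : JoinClosed 𝒦 𝒢) : hull 𝒢 ∅ = hull 𝒦 ∅ :=
  hull_eq_hull h.subset h.hull_empty_mem

theorem JoinClosed.hull_union_eq (h : JoinClosed 𝒦 𝒢) {U V : Set X} (hU : U ∈ 𝒦) (hV : V ∈ 𝒦) :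
    hull 𝒢 (U ∪ V) = hull 𝒦 (U ∪ V) :=
  hull_eq_hull h.subset (h.hull_union_mem U hU V hV)

/-- A larger closure system has smaller hulls, so only one inclusion has to be checked. -/
theorem joinClosed_of_hull_eq (h𝒦 : JoinClosed 𝒦 𝒦) (h : 𝒦 ⊆ 𝒢) (h0 : hull 𝒦 ∅ ⊆ hull 𝒢 ∅)
    (h2 : ∀ U ∈ 𝒦, ∀ V ∈ 𝒦, hull 𝒦 (U ∪ V) ⊆ hull 𝒢 (U ∪ V)) : JoinClosed 𝒦 𝒢 where
  subset := h
  hull_empty_mem := by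
    rw [← h0.antisymm (hull_subset (h h𝒦.hull_empty_mem) (subset_hull _ _))]
    exact h𝒦.hull_empty_mem
  hull_union_mem U hU V hV := by
    rw [← (h2 U hU V hV).antisymm
      (hull_subset (h (h𝒦.hull_union_mem U hU V hV)) (subset_hull _ _))]
    exact h𝒦.hull_union_mem U hU V hV

/-- Maps whose inverse image map sends `ℒ` to `𝒦` and preserves finite joins. -/
structure IsFamilyMap {Y : Type*} (𝒦 : Set (Set X)) (ℒ : Set (Set Y)) (f : X → Y) : Prop where
  preimage_mem : ∀ U ∈ ℒ, f ⁻¹' U ∈ 𝒦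
  preimage_hull_empty : f ⁻¹' hull ℒ ∅ = hull 𝒦 ∅
  preimage_hull_union : ∀ U ∈ ℒ, ∀ V ∈ ℒ, f ⁻¹' hull ℒ (U ∪ V) = hull 𝒦 (f ⁻¹' U ∪ f ⁻¹' V)

/-- Preservation of all finite joins, computed in the ambient systems, is cut down to the empty and
the binary join inside the lattices. `IsFamilyMap.preserves` returns by induction on the finite
family. -/
theorem isFamilyMap_of_preserves {Y : Type*} {ℋ ℒ : Set (Set Y)} (h : JoinClosed 𝒦 𝒢)
    (h' : JoinClosed ℒ ℋ) {f : X → Y} (hf : ∀ U ∈ ℒ, f ⁻¹' U ∈ 𝒦)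
    (hp : ∀ 𝒮 : Set (Set Y), 𝒮.Finite → 𝒮 ⊆ ℒ →
      f ⁻¹' hull ℋ (⋃₀ 𝒮) = hull 𝒢 (⋃ U ∈ 𝒮, f ⁻¹' U)) : IsFamilyMap 𝒦 ℒ f where
  preimage_mem := hf
  preimage_hull_empty := by
    have := hp ∅ Set.finite_empty (by simp)
    simp only [Set.sUnion_empty, Set.mem_empty_iff_false, Set.iUnion_of_empty,
      Set.iUnion_empty] at this
    rw [← h.hull_empty_eq, ← h'.hull_empty_eq, this]
  preimage_hull_union U hU V hV := by
    have := hp {U, V} (Set.toFinite _) (Set.pair_subset hU hV)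
    rw [Set.sUnion_pair, Set.biUnion_pair] at this
    rw [← h.hull_union_eq (hf U hU) (hf V hV), ← h'.hull_union_eq hU hV, this]

theorem IsFamilyMap.preserves {Y : Type*} {ℋ ℒ : Set (Set Y)} {f : X → Y}
    (hf : IsFamilyMap 𝒦 ℒ f) (h : JoinClosed 𝒦 𝒢) (h' : JoinClosed ℒ ℋ)
    {𝒮 : Set (Set Y)} (hfin : 𝒮.Finite) : 𝒮 ⊆ ℒ →
      f ⁻¹' hull ℋ (⋃₀ 𝒮) = hull 𝒢 (⋃ U ∈ 𝒮, f ⁻¹' U) := by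
  induction 𝒮, hfin using Set.Finite.induction_on with
  | empty =>
    intro _
    simpa [h.hull_empty_eq, h'.hull_empty_eq] using hf.preimage_hull_empty
  | @insert U 𝒮 _ hfin ih =>
    intro hU
    rw [Set.insert_subset_iff] at hU
    have hj := h'.hull_sUnion_mem hfin hU.2
    rw [Set.sUnion_insert, ← hull_union_hull, h'.hull_union_eq hU.1 hj,
      hf.preimage_hull_union U hU.1 _ hj, ← h.hull_union_eq (hf.preimage_mem U hU.1)
        (hf.preimage_mem _ hj), ih hU.2, hull_union_hull, Set.biUnion_insert]

end Hull

/-! ### Bounded lattices of sets -/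

section Families

variable {X Y : Type*}

/-- Families of sets that are bounded lattices with respect to inclusion, with finite
intersections as meets. -/
structure IsLatticeFamily (𝒦 : Set (Set X)) : Prop where
  univ_mem : Set.univ ∈ 𝒦
  inter_mem : ∀ U ∈ 𝒦, ∀ V ∈ 𝒦, U ∩ V ∈ 𝒦
  joinClosed : JoinClosed 𝒦 𝒦

/-- Bounded lattices of sets on `X` whose filters correspond to the points of `X`. -/
structure IsFilterFamily (𝒦 : Set (Set X)) : Prop extends IsLatticeFamily 𝒦 where
  ext : ∀ x y, (∀ U ∈ 𝒦, x ∈ U ↔ y ∈ U) → x = y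
  exists_point : ∀ φ ⊆ 𝒦, Set.univ ∈ φ → (∀ U ∈ φ, ∀ V ∈ φ, U ∩ V ∈ φ) →
    (∀ U ∈ φ, ∀ V ∈ 𝒦, U ⊆ V → V ∈ φ) → ∃ x, ∀ U ∈ 𝒦, x ∈ U ↔ U ∈ φ

/-- The lattice structure of a lattice of sets. -/
@[reducible]
def famLattice {𝒦 : Set (Set X)} (h : IsLatticeFamily 𝒦) : Lattice 𝒦 where
  __ := (inferInstance : PartialOrder 𝒦)
  inf U V := ⟨U.1 ∩ V.1, h.inter_mem _ U.2 _ V.2⟩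
  inf_le_left _ _ := Set.inter_subset_left
  inf_le_right _ _ := Set.inter_subset_right
  le_inf _ _ _ h1 h2 := Set.subset_inter h1 h2
  sup U V := ⟨hull 𝒦 (U.1 ∪ V.1), h.joinClosed.hull_union_mem _ U.2 _ V.2⟩
  le_sup_left _ _ := Set.subset_union_left.trans (subset_hull _ _)
  le_sup_right _ _ := Set.subset_union_right.trans (subset_hull _ _)
  sup_le _ _ W h1 h2 := hull_subset W.2 (Set.union_subset h1 h2)

/-- The bounds of a lattice of sets. -/
@[reducible]
def famBounded {𝒦 : Set (Set X)} (h : IsLatticeFamily 𝒦) : BoundedOrder 𝒦 where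
  top := ⟨Set.univ, h.univ_mem⟩
  le_top U := Set.subset_univ U.1
  bot := ⟨hull 𝒦 ∅, h.joinClosed.hull_empty_mem⟩
  bot_le U := hull_subset U.2 (Set.empty_subset _)

/-- A lattice of sets as a bundled bounded lattice. -/
def famObj {X : Type u} {𝒦 : Set (Set X)} (h : IsLatticeFamily 𝒦) : BddLat.{u} :=
  letI := famLattice h
  letI := famBounded h
  BddLat.of 𝒦

/-- The bounded lattice homomorphism given by a map between sets. -/
def famHom {X Y : Type u} {𝒦 : Set (Set X)} {ℒ : Set (Set Y)} (h𝒦 : IsLatticeFamily 𝒦)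
    (hℒ : IsLatticeFamily ℒ) (φ : Set Y → Set X) (hmem : ∀ U ∈ ℒ, φ U ∈ 𝒦)
    (huniv : φ Set.univ = Set.univ) (hinter : ∀ U ∈ ℒ, ∀ V ∈ ℒ, φ (U ∩ V) = φ U ∩ φ V)
    (hempty : φ (hull ℒ ∅) = hull 𝒦 ∅)
    (hunion : ∀ U ∈ ℒ, ∀ V ∈ ℒ, φ (hull ℒ (U ∪ V)) = hull 𝒦 (φ U ∪ φ V)) :
    famObj hℒ ⟶ famObj h𝒦 :=
  letI := famLattice h𝒦
  letI := famBounded h𝒦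
  letI := famLattice hℒ
  letI := famBounded hℒ
  BddLat.ofHom (X := ℒ) (Y := 𝒦)
    { toFun := fun U => ⟨φ U.1, hmem _ U.2⟩
      map_sup' := fun U V => Subtype.ext (hunion _ U.2 _ V.2)
      map_inf' := fun U V => Subtype.ext (hinter _ U.2 _ V.2)
      map_top' := Subtype.ext huniv
      map_bot' := Subtype.ext hempty }

/-- An order isomorphism from a bounded lattice to a lattice of sets, bundled. -/
def famIso {X : Type u} {𝒦 : Set (Set X)} (h : IsLatticeFamily 𝒦) (A : BddLat.{u})
    (e : A ≃o 𝒦) : A ≅ famObj h :=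
  letI := famLattice h
  letI := famBounded h
  BddLat.Iso.mk (α := A) (β := BddLat.of 𝒦) e

section Hom

variable {X Y : Type u} {𝒦 : Set (Set X)} {ℒ : Set (Set Y)} {h𝒦 : IsLatticeFamily 𝒦}
  {hℒ : IsLatticeFamily ℒ} (α : famObj hℒ ⟶ famObj h𝒦)

/-- The function underlying a morphism between lattices of sets. -/
def famFun (U : ℒ) : 𝒦 := α.hom U

theorem famFun_ext {α β : famObj hℒ ⟶ famObj h𝒦} (h : ∀ U, famFun α U = famFun β U) : α = β :=
  BddLat.ext h

theorem famFun_univ : (famFun α ⟨Set.univ, hℒ.univ_mem⟩ : Set X) = Set.univ :=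
  congrArg Subtype.val (map_top α.hom)

theorem famFun_inter (U V : ℒ) :
    (famFun α ⟨U.1 ∩ V.1, hℒ.inter_mem _ U.2 _ V.2⟩ : Set X) = (famFun α U : Set X) ∩ famFun α V :=
  congrArg Subtype.val (α.hom.map_inf' U V)

theorem famFun_empty :
    (famFun α ⟨hull ℒ ∅, hℒ.joinClosed.hull_empty_mem⟩ : Set X) = hull 𝒦 ∅ :=
  congrArg Subtype.val (map_bot α.hom)

theorem famFun_union (U V : ℒ) :
    (famFun α ⟨hull ℒ (U.1 ∪ V.1), hℒ.joinClosed.hull_union_mem _ U.2 _ V.2⟩ : Set X)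
      = hull 𝒦 ((famFun α U : Set X) ∪ famFun α V) :=
  congrArg Subtype.val (α.hom.map_sup' U V)

theorem famFun_mono {U V : ℒ} (h : U.1 ⊆ V.1) : (famFun α U : Set X) ⊆ famFun α V :=
  OrderHomClass.mono α.hom h

end Hom

end Families

/-! ### The category of filter spaces -/

/-- Sets with a lattice of subsets whose filters correspond to the points. -/
structure FSpace where
  carrier : Type u
  sets : Set (Set carrier)
  isFilterFamily : IsFilterFamily sets

/-- Morphisms of filter spaces. -/
@[ext]
structure FHom (X Y : FSpace.{u}) where
  f : X.carrier → Y.carrier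
  isFamilyMap : IsFamilyMap X.sets Y.sets f

theorem IsFamilyMap.comp {X Y Z : Type*} {𝒦 : Set (Set X)} {ℒ : Set (Set Y)} {ℳ : Set (Set Z)}
    {g : Y → Z} {f : X → Y} (hg : IsFamilyMap ℒ ℳ g) (hf : IsFamilyMap 𝒦 ℒ f) :
    IsFamilyMap 𝒦 ℳ (g ∘ f) where
  preimage_mem U hU := hf.preimage_mem _ (hg.preimage_mem U hU)
  preimage_hull_empty := by
    rw [Set.preimage_comp, hg.preimage_hull_empty, hf.preimage_hull_empty]
  preimage_hull_union U hU V hV := by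
    rw [Set.preimage_comp, hg.preimage_hull_union U hU V hV,
      hf.preimage_hull_union _ (hg.preimage_mem U hU) _ (hg.preimage_mem V hV)]
    rfl

theorem isFamilyMap_id {X : Type*} (𝒦 : Set (Set X)) : IsFamilyMap 𝒦 𝒦 (id : X → X) :=
  ⟨fun _ h => h, rfl, fun _ _ _ _ => rfl⟩

instance : LargeCategory FSpace.{u} where
  Hom := FHom
  id X := ⟨id, isFamilyMap_id _⟩
  comp a b := ⟨b.f ∘ a.f, b.isFamilyMap.comp a.isFamilyMap⟩

/-- The bounded lattice of a filter space. -/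
def famFunctor : FSpace.{u}ᵒᵖ ⥤ BddLat.{u} where
  obj X := famObj X.unop.isFilterFamily.toIsLatticeFamily
  map {X Y} φ :=
    famHom Y.unop.isFilterFamily.toIsLatticeFamily X.unop.isFilterFamily.toIsLatticeFamily
      (fun U => FHom.f φ.unop ⁻¹' U) (FHom.isFamilyMap φ.unop).preimage_mem rfl
      (fun _ _ _ _ => rfl) (FHom.isFamilyMap φ.unop).preimage_hull_empty
      (FHom.isFamilyMap φ.unop).preimage_hull_union
  map_id _ := rfl
  map_comp _ _ := rfl

instance : famFunctor.{u}.Faithful where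
  map_injective {X Y a b} h := by
    apply Quiver.Hom.unop_inj
    refine FHom.ext (funext fun y => X.unop.isFilterFamily.ext _ _ fun U hU => ?_)
    have h' : famFun (famFunctor.map a) ⟨U, hU⟩ = famFun (famFunctor.map b) ⟨U, hU⟩ := by rw [h]
    exact Set.ext_iff.1 (congrArg Subtype.val h') y

/-- The map must send `x` to the point whose filter is `{U | x ∈ α U}`. This is a filter because `α`
preserves top and binary meets, and `exists_point` supplies the point. -/
theorem exists_isFamilyMap {X Y : Type u} {𝒦 : Set (Set X)} {ℒ : Set (Set Y)}
    {h𝒦 : IsLatticeFamily 𝒦} (hℒ : IsFilterFamily ℒ)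
    (α : famObj hℒ.toIsLatticeFamily ⟶ famObj h𝒦) :
    ∃ f : X → Y, IsFamilyMap 𝒦 ℒ f ∧ ∀ U (hU : U ∈ ℒ), f ⁻¹' U = famFun α ⟨U, hU⟩ := by
  let φ (x : X) : Set (Set Y) := {U | ∃ hU : U ∈ ℒ, x ∈ (famFun α ⟨U, hU⟩ : Set _)}
  have hex (x : X) : ∃ y, ∀ U ∈ ℒ, y ∈ U ↔ U ∈ φ x := by
    refine hℒ.exists_point _ (fun U hU => hU.1) ⟨hℒ.univ_mem, ?_⟩ ?_ ?_
    · rw [famFun_univ]; trivial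
    · rintro U ⟨hU, hyU⟩ V ⟨hV, hyV⟩
      refine ⟨hℒ.inter_mem U hU V hV, ?_⟩
      rw [famFun_inter α ⟨U, hU⟩ ⟨V, hV⟩]
      exact ⟨hyU, hyV⟩
    · rintro U ⟨hU, hyU⟩ V hV hUV
      exact ⟨hV, famFun_mono α (U := ⟨U, hU⟩) (V := ⟨V, hV⟩) hUV hyU⟩
  choose f hf using hex
  have hpre (U) (hU : U ∈ ℒ) : f ⁻¹' U = famFun α ⟨U, hU⟩ := by
    ext y
    exact (hf y U hU).trans ⟨fun h => h.2, fun h => ⟨hU, h⟩⟩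
  refine ⟨f, ⟨?_, ?_, ?_⟩, hpre⟩
  · intro U hU
    rw [hpre U hU]
    exact Subtype.coe_prop _
  · rw [hpre _ hℒ.joinClosed.hull_empty_mem]
    exact famFun_empty α
  · intro U hU V hV
    rw [hpre _ (hℒ.joinClosed.hull_union_mem U hU V hV), hpre U hU, hpre V hV]
    exact famFun_union α ⟨U, hU⟩ ⟨V, hV⟩

instance : famFunctor.{u}.Full where
  map_surjective {X Y} α := by
    obtain ⟨f, hf, hpre⟩ := exists_isFamilyMap X.unop.isFilterFamily α
    exact ⟨Quiver.Hom.op (show Y.unop ⟶ X.unop from ⟨f, hf⟩),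
      famFun_ext fun U => Subtype.ext (hpre U.1 U.2)⟩

/-! ### Representation of a bounded lattice on its filters and on its ideals. -/

section Filt

variable (A : Type*) [Lattice A] [BoundedOrder A]

/-- The sets of filters containing a given element. -/
def filtSets : Set (Set (Filt A)) := Set.range fun a : A => {F | a ∈ F}

/-- The sets of ideals containing a given element. -/
def idlSets : Set (Set (Idl A)) := Set.range fun a : A => {I | a ∈ I}

variable {A}

/-- The filter with a given underlying set. -/
def Filt.mk (F : Set A) (htop : ⊤ ∈ F) (hinf : ∀ a ∈ F, ∀ b ∈ F, a ⊓ b ∈ F)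
    (hup : ∀ a ∈ F, ∀ b, a ≤ b → b ∈ F) : Filt A :=
  IsPFilter.toPFilter (F := F) (isPFilter_iff.2 ⟨htop, hinf, hup⟩)

theorem Filt.isPFilter (F : Filt A) : IsPFilter (F : Set A) := PFilter.isPFilter (F := F)

theorem Filt.top_mem (F : Filt A) : ⊤ ∈ F := (isPFilter_iff.1 F.isPFilter).1

theorem Filt.inf_mem (F : Filt A) {a b : A} (ha : a ∈ F) (hb : b ∈ F) : a ⊓ b ∈ F :=
  (isPFilter_iff.1 F.isPFilter).2.1 a ha b hb

theorem Filt.mem_of_le (F : Filt A) {a b : A} (ha : a ∈ F) (hab : a ≤ b) : b ∈ F :=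
  (isPFilter_iff.1 F.isPFilter).2.2 a ha b hab

/-- The ideal with a given underlying set. -/
def Idl.mk (I : Set A) (hbot : ⊥ ∈ I) (hsup : ∀ a ∈ I, ∀ b ∈ I, a ⊔ b ∈ I)
    (hlow : ∀ a ∈ I, ∀ b, b ≤ a → b ∈ I) : Idl A :=
  IsIdeal.toIdeal (I := I)
    ⟨fun a b hba ha => hlow a ha b hba, ⟨⊥, hbot⟩,
      fun a ha b hb => ⟨a ⊔ b, hsup a ha b hb, le_sup_left, le_sup_right⟩⟩

theorem Idl.bot_mem (I : Idl A) : ⊥ ∈ I := Ideal.bot_mem (s := (show Ideal A from I))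

theorem Idl.sup_mem (I : Idl A) {a b : A} (ha : a ∈ I) (hb : b ∈ I) : a ⊔ b ∈ I :=
  Ideal.sup_mem (s := (show Ideal A from I)) ha hb

theorem Idl.mem_of_le (I : Idl A) {a b : A} (ha : a ∈ I) (hba : b ≤ a) : b ∈ I :=
  Ideal.lower (show Ideal A from I) hba ha

/-- The principal filter of an element. -/
def Filt.principal (a : A) : Filt A :=
  Filt.mk (Set.Ici a) le_top (fun _ h1 _ h2 => le_inf h1 h2) (fun _ h1 _ h2 => le_trans h1 h2)

/-- The principal ideal of an element. -/
def Idl.principal (a : A) : Idl A :=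
  Idl.mk (Set.Iic a) bot_le (fun _ h1 _ h2 => sup_le h1 h2) (fun _ h1 _ h2 => le_trans h2 h1)

theorem Filt.mem_principal {a b : A} : b ∈ Filt.principal a ↔ a ≤ b := Iff.rfl

theorem Idl.mem_principal {a b : A} : b ∈ Idl.principal a ↔ b ≤ a := Iff.rfl

theorem filtSets_subset_iff {a b : A} : {F : Filt A | a ∈ F} ⊆ {F | b ∈ F} ↔ a ≤ b :=
  ⟨fun h => h (a := Filt.principal a) (Filt.mem_principal.2 le_rfl), fun h F hF => F.mem_of_le hF h⟩

/-- The reversal of the order makes `idlSets A` a copy of the order dual of `A`, so joins there come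
from meets of `A`. -/
theorem idlSets_subset_iff {a b : A} : {I : Idl A | a ∈ I} ⊆ {I | b ∈ I} ↔ b ≤ a :=
  ⟨fun h => h (a := Idl.principal a) (Idl.mem_principal.2 le_rfl), fun h F hF => F.mem_of_le hF h⟩

theorem hull_filtSets_union (a b : A) :
    hull (filtSets A) ({F | a ∈ F} ∪ {F | b ∈ F}) = {F | a ⊔ b ∈ F} := by
  refine Set.Subset.antisymm (hull_subset ⟨_, rfl⟩ (Set.union_subset ?_ ?_)) ?_
  · exact filtSets_subset_iff.2 le_sup_left
  · exact filtSets_subset_iff.2 le_sup_right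
  · rintro F hF _ ⟨⟨c, rfl⟩, hc⟩
    rw [Set.union_subset_iff] at hc
    exact F.mem_of_le hF (sup_le (filtSets_subset_iff.1 hc.1) (filtSets_subset_iff.1 hc.2))

theorem hull_idlSets_union (a b : A) :
    hull (idlSets A) ({F | a ∈ F} ∪ {F | b ∈ F}) = {F | a ⊓ b ∈ F} := by
  refine Set.Subset.antisymm (hull_subset ⟨_, rfl⟩ (Set.union_subset ?_ ?_)) ?_
  · exact idlSets_subset_iff.2 inf_le_left
  · exact idlSets_subset_iff.2 inf_le_right
  · rintro F hF _ ⟨⟨c, rfl⟩, hc⟩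
    rw [Set.union_subset_iff] at hc
    exact F.mem_of_le hF (le_inf (idlSets_subset_iff.1 hc.1) (idlSets_subset_iff.1 hc.2))

variable (A)

/-- A filter of the lattice of sets pulls back along `a ↦ {F | a ∈ F}` to a filter of `A`, and that
filter is itself the point sought. -/
theorem isFilterFamily_filtSets : IsFilterFamily (filtSets A) where
  univ_mem := ⟨⊤, Set.eq_univ_of_forall fun F => F.top_mem⟩
  inter_mem := by
    rintro _ ⟨a, rfl⟩ _ ⟨b, rfl⟩
    exact ⟨a ⊓ b, Set.ext fun F => ⟨fun h => ⟨F.mem_of_le h inf_le_left,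
      F.mem_of_le h inf_le_right⟩, fun h => F.inf_mem h.1 h.2⟩⟩
  joinClosed :=
    { subset := subset_rfl
      hull_empty_mem := ⟨⊥, Set.Subset.antisymm (by
          rintro F hF _ ⟨⟨c, rfl⟩, -⟩
          exact F.mem_of_le hF bot_le) (hull_subset ⟨⊥, rfl⟩ (Set.empty_subset _))⟩
      hull_union_mem := by
        rintro _ ⟨a, rfl⟩ _ ⟨b, rfl⟩
        exact ⟨a ⊔ b, (hull_filtSets_union a b).symm⟩ }
  ext F G h := SetLike.ext fun a => h _ ⟨a, rfl⟩
  exists_point φ _ h1 h2 h3 := by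
    refine ⟨Filt.mk {a | {F : Filt A | a ∈ F} ∈ φ} ?_ ?_ ?_, ?_⟩
    · exact h3 _ h1 _ ⟨_, rfl⟩ fun F _ => F.top_mem
    · exact fun a ha b hb => h3 _ (h2 _ ha _ hb) _ ⟨_, rfl⟩ fun F hF => F.inf_mem hF.1 hF.2
    · exact fun a ha b hab => h3 _ ha _ ⟨_, rfl⟩ (filtSets_subset_iff.2 hab)
    · rintro _ ⟨a, rfl⟩
      exact Iff.rfl

theorem isFilterFamily_idlSets : IsFilterFamily (idlSets A) where
  univ_mem := ⟨⊥, Set.eq_univ_of_forall fun F => F.bot_mem⟩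
  inter_mem := by
    rintro _ ⟨a, rfl⟩ _ ⟨b, rfl⟩
    exact ⟨a ⊔ b, Set.ext fun F => ⟨fun h => ⟨F.mem_of_le h le_sup_left,
      F.mem_of_le h le_sup_right⟩, fun h => F.sup_mem h.1 h.2⟩⟩
  joinClosed :=
    { subset := subset_rfl
      hull_empty_mem := ⟨⊤, Set.Subset.antisymm (by
          rintro F hF _ ⟨⟨c, rfl⟩, -⟩
          exact F.mem_of_le hF le_top) (hull_subset ⟨⊤, rfl⟩ (Set.empty_subset _))⟩
      hull_union_mem := by
        rintro _ ⟨a, rfl⟩ _ ⟨b, rfl⟩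
        exact ⟨a ⊓ b, (hull_idlSets_union a b).symm⟩ }
  ext F G h := SetLike.ext fun a => h _ ⟨a, rfl⟩
  exists_point φ _ h1 h2 h3 := by
    refine ⟨Idl.mk {a | {F : Idl A | a ∈ F} ∈ φ} ?_ ?_ ?_, ?_⟩
    · exact h3 _ h1 _ ⟨_, rfl⟩ fun F _ => F.bot_mem
    · exact fun a ha b hb => h3 _ (h2 _ ha _ hb) _ ⟨_, rfl⟩ fun F hF => F.sup_mem hF.1 hF.2
    · exact fun a ha b hab => h3 _ ha _ ⟨_, rfl⟩ (idlSets_subset_iff.2 hab)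
    · rintro _ ⟨a, rfl⟩
      exact Iff.rfl

/-- A bounded lattice is isomorphic to its representation on its set of filters. -/
noncomputable def filtSetsIso : A ≃o filtSets A where
  toEquiv := Equiv.ofBijective (fun a => ⟨{F | a ∈ F}, a, rfl⟩)
    ⟨fun a b h => by
      have h' : {F : Filt A | a ∈ F} = {F | b ∈ F} := congrArg Subtype.val h
      exact le_antisymm (filtSets_subset_iff.1 h'.le) (filtSets_subset_iff.1 h'.ge),
    by rintro ⟨_, a, rfl⟩; exact ⟨a, rfl⟩⟩
  map_rel_iff' := filtSets_subset_iff

end Filt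

instance : famFunctor.{u}.EssSurj where
  mem_essImage A :=
    ⟨Opposite.op ⟨Filt A, filtSets A, isFilterFamily_filtSets A⟩,
      ⟨(famIso (isFilterFamily_filtSets A).toIsLatticeFamily A (filtSetsIso A)).symm⟩⟩

instance : famFunctor.{u}.IsEquivalence where

/-! ### The patch topology and the order of a filter family -/

section Patch

variable {X : Type*} {𝒦 : Set (Set X)}

/-- The topology generated by a family of sets and their complements. -/
@[reducible]
def patch (𝒦 : Set (Set X)) : TopologicalSpace X :=
  TopologicalSpace.generateFrom (𝒦 ∪ {V | ∃ U ∈ 𝒦, V = Uᶜ})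

/-- The least point of `U` is the point of the principal filter that `U` generates in `𝒦`. -/
theorem IsFilterFamily.exists_least (h : IsFilterFamily 𝒦) {U : Set X} (hU : U ∈ 𝒦) :
    ∃ u ∈ U, ∀ V ∈ 𝒦, u ∈ V → U ⊆ V := by
  obtain ⟨u, hu⟩ := h.exists_point {V | V ∈ 𝒦 ∧ U ⊆ V} (fun V hV => hV.1)
    ⟨h.univ_mem, Set.subset_univ _⟩
    (fun V hV W hW => ⟨h.inter_mem V hV.1 W hW.1, Set.subset_inter hV.2 hW.2⟩)
    (fun V hV W hW hVW => ⟨hW, hV.2.trans hVW⟩)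
  exact ⟨u, (hu U hU).2 ⟨hU, subset_rfl⟩, fun V hV huV => ((hu V hV).1 huV).2⟩

/-! ### The patch topology: compactness, basic open sets, recovery of the family. -/

section Top

variable [t : TopologicalSpace X]

theorem isClopen_of_mem (ht : t = patch 𝒦) {U : Set X} (hU : U ∈ 𝒦) : IsClopen U := by
  refine ⟨isOpen_compl_iff.1 ?_, ?_⟩
  · rw [ht]
    exact TopologicalSpace.isOpen_generateFrom_of_mem (Or.inr ⟨U, hU, rfl⟩)
  · rw [ht]
    exact TopologicalSpace.isOpen_generateFrom_of_mem (Or.inl hU)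

theorem continuous_of_isClopen_preimage {Z : Type*} [TopologicalSpace Z] (ht : t = patch 𝒦)
    {f : Z → X} (hf : ∀ U ∈ 𝒦, IsClopen (f ⁻¹' U)) : Continuous f := by
  rw [ht]
  refine continuous_generateFrom_iff.2 ?_
  rintro _ (hU | ⟨U, hU, rfl⟩)
  · exact (hf _ hU).isOpen
  · exact (hf _ hU).compl.isOpen

/-- An ultrafilter converges to the point whose filter consists of the members of `𝒦` in the
ultrafilter. Complements cause no trouble, since an ultrafilter contains one of each complementary
pair. -/
theorem IsFilterFamily.compactSpace (h : IsFilterFamily 𝒦) (ht : t = patch 𝒦) :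
    CompactSpace X := by
  refine ⟨isCompact_iff_ultrafilter_le_nhds.2 fun f _ => ?_⟩
  obtain ⟨x, hx⟩ := h.exists_point {U | U ∈ 𝒦 ∧ U ∈ f} (fun U hU => hU.1)
    ⟨h.univ_mem, Filter.univ_mem⟩
    (fun U hU V hV => ⟨h.inter_mem U hU.1 V hV.1, Filter.inter_mem hU.2 hV.2⟩)
    (fun U hU V hV hUV => ⟨hV, Filter.mem_of_superset hU.2 hUV⟩)
  refine ⟨x, trivial, ?_⟩
  rw [ht, patch, TopologicalSpace.nhds_generateFrom]
  simp only [le_iInf_iff, Filter.le_principal_iff]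
  rintro _ ⟨hxU, hU | ⟨U, hU, rfl⟩⟩
  · exact ((hx _ hU).1 hxU).2
  · exact Ultrafilter.compl_mem_iff_notMem.2 fun hUf => hxU ((hx U hU).2 ⟨hU, hUf⟩)

theorem totallySeparatedSpace_of_clopen (hclopen : ∀ U ∈ 𝒦, IsClopen U)
    (hext : ∀ x y : X, (∀ U ∈ 𝒦, x ∈ U ↔ y ∈ U) → x = y) : TotallySeparatedSpace X := by
  refine ⟨fun x _ y _ hxy => ?_⟩
  have : ∃ U : Set X, IsClopen U ∧ x ∈ U ∧ y ∉ U := by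
    by_contra! hc
    refine hxy (hext x y fun U hU => ⟨hc U (hclopen U hU), fun hy => ?_⟩)
    by_contra hx
    exact hc Uᶜ (hclopen U hU).compl hx hy
  obtain ⟨U, hU, hx, hy⟩ := this
  exact ⟨U, Uᶜ, hU.isOpen, hU.compl.isOpen, hx, hy, by simp, disjoint_compl_right⟩

/-- The given topology is compact and finer than the Hausdorff patch topology, so the identity is a
closed map and the two agree. -/
theorem eq_patch [CompactSpace X] (hclopen : ∀ U ∈ 𝒦, IsClopen U)
    (hext : ∀ x y : X, (∀ U ∈ 𝒦, x ∈ U ↔ y ∈ U) → x = y) : t = patch 𝒦 := by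
  have hle : t ≤ patch 𝒦 := by
    refine le_generateFrom ?_
    rintro _ (hU | ⟨U, hU, rfl⟩)
    · exact (hclopen _ hU).isOpen
    · exact (hclopen _ hU).compl.isOpen
  have hsep : @TotallySeparatedSpace X (patch 𝒦) :=
    @totallySeparatedSpace_of_clopen X 𝒦 (patch 𝒦)
      (fun U hU => @isClopen_of_mem X 𝒦 (patch 𝒦) rfl U hU) hext
  have hT2 : @T2Space X (patch 𝒦) := @TotallySeparatedSpace.t2Space X (patch 𝒦) hsep
  have hcont : @Continuous X X t (patch 𝒦) id := continuous_id_iff_le.2 hle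
  have hclosed : @IsClosedMap X X t (patch 𝒦) id :=
    @Continuous.isClosedMap X X t (patch 𝒦) _ hT2 id hcont
  refine hle.antisymm fun U hU => ?_
  have := hclosed Uᶜ (isClosed_compl_iff.2 hU)
  rw [Set.image_id] at this
  exact (@isClosed_compl_iff X (patch 𝒦) U).1 this

/-- Closure of `𝒦` under intersections merges the positive generators into one `V`; the negative
ones remain as the finite family `𝒮` to be removed. -/
theorem exists_basic_subset (h : IsLatticeFamily 𝒦) (ht : t = patch 𝒦) {O : Set X}
    (hO : IsOpen O) : ∀ x ∈ O,
    ∃ V ∈ 𝒦, ∃ 𝒮 ⊆ 𝒦, 𝒮.Finite ∧ x ∈ V ∧ x ∉ ⋃₀ 𝒮 ∧ V \ ⋃₀ 𝒮 ⊆ O := by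
  rw [ht] at hO
  induction hO with
  | basic s hs =>
    intro x hx
    obtain hs | ⟨U, hU, rfl⟩ := hs
    · exact ⟨s, hs, ∅, Set.empty_subset _, Set.finite_empty, hx, by simp, by simp⟩
    · exact ⟨Set.univ, h.univ_mem, {U}, by simpa using hU, Set.finite_singleton _, trivial,
        by simpa using hx, by simp [Set.compl_eq_univ_sdiff]⟩
  | univ =>
    intro x _
    exact ⟨Set.univ, h.univ_mem, ∅, Set.empty_subset _, Set.finite_empty, trivial, by simp, by simp⟩
  | inter s s' _ _ ih ih' =>
    rintro x ⟨hx, hx'⟩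
    obtain ⟨V, hV, 𝒮, h𝒮, hfin, hxV, hx𝒮, hsub⟩ := ih x hx
    obtain ⟨V', hV', 𝒮', h𝒮', hfin', hxV', hx𝒮', hsub'⟩ := ih' x hx'
    refine ⟨V ∩ V', h.inter_mem V hV V' hV', 𝒮 ∪ 𝒮', Set.union_subset h𝒮 h𝒮', hfin.union hfin',
      ⟨hxV, hxV'⟩, ?_, ?_⟩
    · rw [Set.sUnion_union]
      exact fun hx => hx.elim hx𝒮 hx𝒮'
    · rw [Set.sUnion_union]
      exact fun y hy => ⟨hsub ⟨hy.1.1, fun hh => hy.2 (Or.inl hh)⟩,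
        hsub' ⟨hy.1.2, fun hh => hy.2 (Or.inr hh)⟩⟩
  | sUnion S _ ih =>
    rintro x ⟨s, hs, hx⟩
    obtain ⟨V, hV, 𝒮, h𝒮, hfin, hxV, hx𝒮, hsub⟩ := ih s hs x hx
    exact ⟨V, hV, 𝒮, h𝒮, hfin, hxV, hx𝒮, hsub.trans (Set.subset_sUnion_of_mem hs)⟩

/-- The members of `𝒦` containing `x` are closed and down-directed, and their intersection lies in
`O`; by compactness one of them already does. -/
theorem exists_mem_subset_of_isOpen [CompactSpace X] (h : IsLatticeFamily 𝒦)
    (hclopen : ∀ U ∈ 𝒦, IsClopen U) {O : Set X} (hO : IsOpen O) {x : X}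
    (hx : ∀ y, (∀ V ∈ 𝒦, x ∈ V → y ∈ V) → y ∈ O) : ∃ V ∈ 𝒦, x ∈ V ∧ V ⊆ O := by
  have : Nonempty {V | V ∈ 𝒦 ∧ x ∈ V} := ⟨⟨Set.univ, h.univ_mem, trivial⟩⟩
  obtain ⟨⟨V, hV⟩, hVO⟩ := hO.isClosed_compl.isCompact.elim_directed_family_closed
    (fun V : {V | V ∈ 𝒦 ∧ x ∈ V} => V.1) (fun V => (hclopen _ V.2.1).isClosed)
    (by
      refine Set.eq_empty_of_forall_notMem fun y hy => hy.1 (hx y fun V hV hxV => ?_)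
      exact Set.mem_iInter.1 hy.2 ⟨V, hV, hxV⟩)
    (fun V W => ⟨⟨V.1 ∩ W.1, h.inter_mem _ V.2.1 _ W.2.1, V.2.2, W.2.2⟩,
      Set.inter_subset_left, Set.inter_subset_right⟩)
  refine ⟨V, hV.1, hV.2, fun y hy => ?_⟩
  by_contra hyO
  have : y ∈ Oᶜ ∩ V := ⟨hyO, hy⟩
  exact (Set.ext_iff.1 hVO y).1 this

/-- By `hu`, `U` is the intersection of the members of `𝒦` containing `u`. Being open, it contains
one of them, and so equals it. This recovers `𝒦` from topology and order alone. -/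
theorem mem_of_isClopen [CompactSpace X] (h : IsLatticeFamily 𝒦)
    (hclopen : ∀ U ∈ 𝒦, IsClopen U) {U : Set X} {u : X} (hU : IsClopen U)
    (hu : ∀ x, x ∈ U ↔ ∀ V ∈ 𝒦, u ∈ V → x ∈ V) : U ∈ 𝒦 := by
  obtain ⟨V, hV, huV, hVU⟩ := exists_mem_subset_of_isOpen h hclopen hU.isOpen fun y hy => (hu y).2 hy
  have : U = V := Set.Subset.antisymm (fun x hx => (hu x).1 hx V hV huV) hVU
  rwa [this]

/-- The point of `φ` must lie in every member of `φ` and outside all other members of `𝒦`. By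
compactness it is enough to meet one `U ∈ φ` at a time, and the least point of `U` does so: any `V ∈
𝒦` containing it contains `U` and hence belongs to `φ`. -/
theorem isFilterFamily_of_compact [CompactSpace X] (h : IsLatticeFamily 𝒦)
    (hclopen : ∀ U ∈ 𝒦, IsClopen U) (hext : ∀ x y : X, (∀ U ∈ 𝒦, x ∈ U ↔ y ∈ U) → x = y)
    (hleast : ∀ U ∈ 𝒦, ∃ u ∈ U, ∀ V ∈ 𝒦, u ∈ V → U ⊆ V) : IsFilterFamily 𝒦 where
  toIsLatticeFamily := h
  ext := hext
  exists_point φ hφ h1 h2 h3 := by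
    have : Nonempty φ := ⟨⟨_, h1⟩⟩
    have hcl (U : φ) : IsClosed (U.1 ∩ ⋂ V ∈ 𝒦 \ φ, Vᶜ) :=
      (hclopen _ (hφ U.2)).isClosed.inter
        (isClosed_biInter fun V hV => (hclopen V hV.1).compl.isClosed)
    obtain ⟨x, hx⟩ := IsCompact.nonempty_iInter_of_directed_nonempty_isCompact_isClosed
      (fun U : φ => U.1 ∩ ⋂ V ∈ 𝒦 \ φ, Vᶜ)
      (fun U V => ⟨⟨U.1 ∩ V.1, h2 _ U.2 _ V.2⟩,
        Set.inter_subset_inter_left _ Set.inter_subset_left,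
        Set.inter_subset_inter_left _ Set.inter_subset_right⟩)
      (fun U => by
        obtain ⟨u, hu, hl⟩ := hleast U.1 (hφ U.2)
        refine ⟨u, hu, Set.mem_iInter₂.2 fun V hV huV => hV.2 ?_⟩
        exact h3 _ U.2 V hV.1 (hl V hV.1 huV))
      (fun U => (hcl U).isCompact) hcl
    rw [Set.mem_iInter] at hx
    refine ⟨x, fun U hU => ⟨fun hxU => ?_, fun hUφ => (hx ⟨U, hUφ⟩).1⟩⟩
    by_contra hUφ
    exact Set.mem_iInter₂.1 (hx ⟨_, h1⟩).2 U ⟨hU, hUφ⟩ hxU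

end Top

/-! ### The order -/

/-- The order is the specialization order of the family `𝒦`. -/
def OrderedBy (𝒦 : Set (Set X)) [LE X] : Prop := ∀ x y : X, x ≤ y ↔ ∀ U ∈ 𝒦, x ∈ U → y ∈ U

/-- The points of a filter family form a complete lattice. -/
@[reducible]
noncomputable def IsFilterFamily.completeLattice (h : IsFilterFamily 𝒦) : CompleteLattice X :=
  letI : PartialOrder X :=
    { le := fun x y => ∀ U ∈ 𝒦, x ∈ U → y ∈ U
      le_refl := fun _ _ _ hx => hx
      le_trans := fun _ _ _ h1 h2 U hU hx => h2 U hU (h1 U hU hx)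
      le_antisymm := fun x y h1 h2 => h.ext x y fun U hU => ⟨h1 U hU, h2 U hU⟩ }
  have hex (S : Set X) : ∃ x, ∀ U ∈ 𝒦, x ∈ U ↔ U ∈ {V | V ∈ 𝒦 ∧ S ⊆ V} :=
    h.exists_point _ (fun _ hV => hV.1) ⟨h.univ_mem, Set.subset_univ _⟩
      (fun V hV W hW => ⟨h.inter_mem V hV.1 W hW.1, Set.subset_inter hV.2 hW.2⟩)
      (fun _ hV _ hW hVW => ⟨hW, hV.2.trans hVW⟩)
  letI : InfSet X := ⟨fun S => (hex S).choose⟩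
  completeLatticeOfInf X fun S =>
    ⟨fun x hx U hU hS => (((hex S).choose_spec U hU).1 hS).2 hx,
      fun x hx U hU hxU => ((hex S).choose_spec U hU).2 ⟨hU, fun s hs => hx hs U hU hxU⟩⟩

theorem IsFilterFamily.orderedBy (h : IsFilterFamily 𝒦) :
    letI := h.completeLattice
    OrderedBy 𝒦 := fun _ _ => Iff.rfl

theorem OrderedBy.ext [PartialOrder X] (ho : OrderedBy 𝒦) (x y : X)
    (hxy : ∀ U ∈ 𝒦, x ∈ U ↔ y ∈ U) : x = y :=
  le_antisymm ((ho x y).2 fun U hU => (hxy U hU).1) ((ho y x).2 fun U hU => (hxy U hU).2)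

/-! ### Infima, principal upsets and hulls in the order of a filter family. -/

namespace IsFilterFamily

variable [CompleteLattice X] (h : IsFilterFamily 𝒦) (ho : OrderedBy 𝒦)

include h ho

/-- The infimum of `S` is the point of the filter of all members containing `S`. Members of `𝒦` are
thus closed under arbitrary infima, not just finite ones, and are therefore principal. -/
theorem sInf_mem_iff {U S : Set X} (hU : U ∈ 𝒦) : sInf S ∈ U ↔ S ⊆ U := by
  obtain ⟨p, hp⟩ := h.exists_point {V | V ∈ 𝒦 ∧ S ⊆ V} (fun _ hV => hV.1)
    ⟨h.univ_mem, Set.subset_univ _⟩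
    (fun V hV W hW => ⟨h.inter_mem V hV.1 W hW.1, Set.subset_inter hV.2 hW.2⟩)
    (fun _ hV _ hW hVW => ⟨hW, hV.2.trans hVW⟩)
  have hglb : IsGLB S p :=
    ⟨fun x hx => (ho p x).2 fun U hU hS => ((hp U hU).1 hS).2 hx,
      fun x hx => (ho x p).2 fun U hU hxU => (hp U hU).2
        ⟨hU, fun s hs => (ho x s).1 (hx hs) U hU hxU⟩⟩
  rw [hglb.sInf_eq, hp U hU]
  exact and_iff_right hU

theorem inf_mem_iff {U : Set X} (hU : U ∈ 𝒦) {a b : X} : a ⊓ b ∈ U ↔ a ∈ U ∧ b ∈ U := by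
  rw [← sInf_pair, h.sInf_mem_iff ho hU, Set.pair_subset_iff]

theorem top_mem {U : Set X} (hU : U ∈ 𝒦) : ⊤ ∈ U := by
  rw [← sInf_empty, h.sInf_mem_iff ho hU]
  exact Set.empty_subset U

theorem isPFilter {U : Set X} (hU : U ∈ 𝒦) : IsPFilter U :=
  isPFilter_iff.2 ⟨h.top_mem ho hU, fun _ ha _ hb => (h.inf_mem_iff ho hU).2 ⟨ha, hb⟩,
    fun a ha b hab => (ho a b).1 hab U hU ha⟩

theorem exists_eq_Ici {U : Set X} (hU : U ∈ 𝒦) : ∃ u, U = Set.Ici u := by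
  refine ⟨sInf U, Set.Subset.antisymm (fun x hx => sInf_le hx) fun x hx => ?_⟩
  exact (ho _ _).1 hx U hU ((h.sInf_mem_iff ho hU).2 subset_rfl)

theorem hull_eq_Ici (A : Set X) : hull 𝒦 A = Set.Ici (sInf A) := by
  ext x
  rw [Set.mem_Ici, ho]
  exact ⟨fun hx U hU hA => hx U ⟨hU, (h.sInf_mem_iff ho hU).1 hA⟩,
    fun hx U hU => hx U hU.1 ((h.sInf_mem_iff ho hU.1).2 hU.2)⟩

theorem Gam_eq_hull (A : Set X) : Gam A = hull 𝒦 A := by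
  rw [h.hull_eq_Ici ho]
  ext x
  exact ⟨fun hx => hx fun a ha => sInf_le ha, fun hx y hy => (le_sInf hy).trans hx⟩

theorem mem_of_isClopen_Ici [t : TopologicalSpace X] (ht : t = patch 𝒦) {u : X}
    (hu : IsClopen (Set.Ici u)) : Set.Ici u ∈ 𝒦 :=
  have := h.compactSpace ht
  mem_of_isClopen h.toIsLatticeFamily (fun _ => isClopen_of_mem ht) hu fun x => ho u x

/-- Any filter containing the upsets of `u` and `v` contains `u ⊓ v`, whose upset is already the
join in `𝒦`. -/
theorem joinClosed_isPFilter : JoinClosed 𝒦 {G : Set X | IsPFilter G} := by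
  refine joinClosed_of_hull_eq h.joinClosed (fun U hU => h.isPFilter ho hU) ?_ ?_
  · rw [h.hull_eq_Ici ho, sInf_empty]
    rintro x hx G ⟨hG, -⟩
    exact (top_le_iff.1 hx) ▸ (isPFilter_iff.1 hG).1
  · intro U hU V hV
    obtain ⟨u, rfl⟩ := h.exists_eq_Ici ho hU
    obtain ⟨v, rfl⟩ := h.exists_eq_Ici ho hV
    rw [h.hull_eq_Ici ho, sInf_union, csInf_Ici, csInf_Ici]
    rintro x hx G ⟨hG, hsub⟩
    replace hG := isPFilter_iff.1 hG
    exact hG.2.2 _ (hG.2.1 _ (hsub (Or.inl Set.self_mem_Ici)) _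
      (hsub (Or.inr Set.self_mem_Ici))) _ hx

end IsFilterFamily

/-- If all principal lower sets are closed, then every compact closed filter is principal. -/
theorem exists_eq_Ici_of_isCompact [SemilatticeInf X] [OrderTop X] [TopologicalSpace X]
    (hcl : ∀ x : X, IsClosed (Set.Iic x)) {U : Set X} (hU : IsCompact U) (hU' : IsClosed U)
    (hF : IsPFilter U) : ∃ u, U = Set.Ici u := by
  have hF' := isPFilter_iff.1 hF
  have : Nonempty U := ⟨⟨⊤, hF'.1⟩⟩
  obtain ⟨u, hu⟩ := IsCompact.nonempty_iInter_of_directed_nonempty_isCompact_isClosed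
    (fun x : U => U ∩ Set.Iic x.1)
    (fun x y => ⟨⟨x.1 ⊓ y.1, hF'.2.1 _ x.2 _ y.2⟩,
      Set.inter_subset_inter_right _ (Set.Iic_subset_Iic.2 inf_le_left),
      Set.inter_subset_inter_right _ (Set.Iic_subset_Iic.2 inf_le_right)⟩)
    (fun x => ⟨x.1, x.2, le_rfl⟩) (fun x => hU.inter_right (hcl x.1))
    (fun x => hU'.inter (hcl x.1))
  rw [Set.mem_iInter] at hu
  exact ⟨u, Set.Subset.antisymm (fun x hx => (hu ⟨x, hx⟩).2)
    fun x hx => hF'.2.2 u (hu ⟨⊤, hF'.1⟩).1 x hx⟩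

theorem isClosed_Iic_of_orderedBy [Preorder X] [TopologicalSpace X] (ho : OrderedBy 𝒦)
    (hclopen : ∀ U ∈ 𝒦, IsClopen U) (x : X) : IsClosed (Set.Iic x) := by
  have : Set.Iic x = ⋂ U ∈ {U | U ∈ 𝒦 ∧ x ∉ U}, Uᶜ := by
    ext y
    simp only [Set.mem_Iic, ho y x, Set.mem_ofPred_eq, Set.mem_iInter, Set.mem_compl_iff, and_imp]
    exact forall₂_congr fun U hU => not_imp_not.symm
  rw [this]
  exact isClosed_biInter fun U hU => (hclopen U hU.1).compl.isClosed

theorem isClosed_Ici_of_orderedBy [Preorder X] [TopologicalSpace X] (ho : OrderedBy 𝒦)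
    (hclopen : ∀ U ∈ 𝒦, IsClopen U) (x : X) : IsClosed (Set.Ici x) := by
  have : Set.Ici x = ⋂ U ∈ {U | U ∈ 𝒦 ∧ x ∈ U}, U := by
    ext y
    simp only [Set.mem_Ici, ho x y, Set.mem_ofPred_eq, Set.mem_iInter, and_imp]
  rw [this]
  exact isClosed_biInter fun U hU => (hclopen U hU.1).isClosed

/-- A clopen filter is compact, hence principal, and clopen principal filters belong to `𝒦`. -/
theorem IsFilterFamily.CLF_eq [CompleteLattice X] [t : TopologicalSpace X]
    (h : IsFilterFamily 𝒦) (ho : OrderedBy 𝒦) (ht : t = patch 𝒦) : CLF X = 𝒦 := by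
  have := h.compactSpace ht
  refine Set.Subset.antisymm (fun U hU => ?_)
    fun U hU => ⟨isClopen_of_mem ht hU, h.isPFilter ho hU⟩
  obtain ⟨u, rfl⟩ := exists_eq_Ici_of_isCompact
    (isClosed_Iic_of_orderedBy ho fun _ => isClopen_of_mem ht) hU.1.isClosed.isCompact
    hU.1.isClosed hU.2
  exact h.mem_of_isClopen_Ici ho ht hU.1

end Patch

/-! ### Coherent lattices -/

section Coherent

variable {X : Type*} [CompleteLattice X]

/-- The principal filters of compact elements. -/
def compactUps (X : Type*) [CompleteLattice X] : Set (Set X) :=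
  {U | ∃ k, IsCompactElement k ∧ U = Set.Ici k}

theorem isCompactElement_sup {k l : X} (hk : IsCompactElement k) (hl : IsCompactElement l) :
    IsCompactElement (k ⊔ l) := by
  intro s u hs hd hu hkl
  obtain ⟨x, hx, hkx⟩ := hk s u hs hd hu (le_sup_left.trans hkl)
  obtain ⟨y, hy, hly⟩ := hl s u hs hd hu (le_sup_right.trans hkl)
  obtain ⟨z, hz, hxz, hyz⟩ := hd x hx y hy
  exact ⟨z, hz, sup_le (hkx.trans hxz) (hly.trans hyz)⟩

theorem isCompactElement_bot : IsCompactElement (⊥ : X) :=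
  fun _ _ hs _ _ _ => hs.imp fun _ hx => ⟨hx, bot_le⟩

theorem IsCoherent.orderedBy (h : IsCoherent X) : OrderedBy (compactUps X) := by
  intro x y
  refine ⟨?_, fun hxy => ?_⟩
  · rintro hxy _ ⟨k, -, rfl⟩ hk
    exact le_trans hk hxy
  · obtain ⟨s, hs, rfl⟩ := h.algebraic.exists_sSup_eq x
    exact sSup_le fun k hk => hxy _ ⟨k, hs k hk, rfl⟩ (le_sSup hk)

theorem hull_compactUps_empty (h : IsCompactElement (⊤ : X)) :
    hull (compactUps X) ∅ = Set.Ici ⊤ :=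
  Set.Subset.antisymm (hull_subset ⟨⊤, h, rfl⟩ (Set.empty_subset _)) (by
    rintro x hx _ ⟨⟨k, -, rfl⟩, -⟩
    exact le_top.trans hx)

theorem hull_compactUps_union {k l : X} (h : IsCompactElement (k ⊓ l)) :
    hull (compactUps X) (Set.Ici k ∪ Set.Ici l) = Set.Ici (k ⊓ l) :=
  Set.Subset.antisymm (hull_subset ⟨_, h, rfl⟩ (Set.union_subset
      (Set.Ici_subset_Ici.2 inf_le_left) (Set.Ici_subset_Ici.2 inf_le_right))) (by
    rintro x hx _ ⟨⟨m, -, rfl⟩, hm⟩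
    rw [Set.union_subset_iff, Set.Ici_subset_Ici, Set.Ici_subset_Ici] at hm
    exact (le_inf hm.1 hm.2).trans hx)

/-- Intersecting two principal filters takes the join of their generators, while joining them takes
the meet. Compactness of the top element and of binary meets is what the empty and binary joins
require. -/
theorem IsCoherent.isFilterFamily (h : IsCoherent X) : IsFilterFamily (compactUps X) where
  univ_mem := ⟨⊥, isCompactElement_bot, by simp⟩
  inter_mem := by
    rintro _ ⟨k, hk, rfl⟩ _ ⟨l, hl, rfl⟩
    exact ⟨k ⊔ l, isCompactElement_sup hk hl, Set.Ici_inter_Ici⟩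
  joinClosed :=
    { subset := subset_rfl
      hull_empty_mem := ⟨⊤, h.top_compact, hull_compactUps_empty h.top_compact⟩
      hull_union_mem := by
        rintro _ ⟨k, hk, rfl⟩ _ ⟨l, hl, rfl⟩
        exact ⟨k ⊓ l, h.inf_compact k l hk hl, hull_compactUps_union (h.inf_compact k l hk hl)⟩ }
  ext := h.orderedBy.ext
  exists_point φ hφ h1 h2 h3 := by
    -- The generators of the members of `φ` are up-directed, so a compact element below their
    -- supremum is below one of them.
    refine ⟨sSup {k | IsCompactElement k ∧ Set.Ici k ∈ φ}, ?_⟩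
    rintro _ ⟨k, hk, rfl⟩
    refine ⟨fun hkx => ?_, fun hkφ => le_sSup ⟨hk, hkφ⟩⟩
    obtain ⟨l, ⟨_, hl⟩, hkl⟩ := hk {k | IsCompactElement k ∧ Set.Ici k ∈ φ} _
      ⟨⊥, isCompactElement_bot, by simpa using h1⟩
      (fun a ha b hb => ⟨a ⊔ b, ⟨isCompactElement_sup ha.1 hb.1, by
        rw [← Set.Ici_inter_Ici]; exact h2 _ ha.2 _ hb.2⟩, le_sup_left, le_sup_right⟩)
      (isLUB_sSup _) hkx
    exact h3 _ hl _ ⟨k, hk, rfl⟩ (Set.Ici_subset_Ici.2 hkl)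

/-- For compact `k` the set `Set.Ici k` is Scott open and its complement is open in the lower
topology. Conversely, by algebraicity every Scott open set is a union of such sets, and every
principal upset is an intersection of them. -/
theorem IsCoherent.lawson_eq_patch (h : IsCoherent X) :
    Topology.lawson X = patch (compactUps X) := by
  refine le_antisymm (le_generateFrom ?_) (le_inf (le_generateFrom ?_) fun O hO => ?_)
  · rintro _ (⟨k, hk, rfl⟩ | ⟨_, ⟨k, hk, rfl⟩, rfl⟩)
    · refine (inf_le_right : Topology.lawson X ≤ _) _ ?_
      let _ := Topology.scott X Set.univ
      have : Topology.IsScott X Set.univ := ⟨rfl⟩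
      refine (Topology.IsScott.isOpen_iff_isUpperSet_and_dirSupInaccOn (D := Set.univ)).2
        ⟨isUpperSet_Ici k, ?_⟩
      intro d _ hd hdir a ha hka
      obtain ⟨x, hx, hkx⟩ := hk d a hd hdir ha hka
      exact ⟨x, hx, hkx⟩
    · refine (inf_le_left : Topology.lawson X ≤ _) _ ?_
      exact TopologicalSpace.isOpen_generateFrom_of_mem ⟨k, rfl⟩
  · rintro _ ⟨a, rfl⟩
    let _ := patch (compactUps X)
    exact (isClosed_Ici_of_orderedBy h.orderedBy (fun _ => isClopen_of_mem rfl) a).isOpen_compl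
  · let := patch (compactUps X)
    have hO' : IsUpperSet O ∧ DirSupInaccOn Set.univ O := by
      let _ := Topology.scott X Set.univ
      have : Topology.IsScott X Set.univ := ⟨rfl⟩
      exact (Topology.IsScott.isOpen_iff_isUpperSet_and_dirSupInaccOn (D := Set.univ)).1 hO
    refine isOpen_iff_forall_mem_open.2 fun x hx => ?_
    have hlub : IsLUB {k | IsCompactElement k ∧ k ≤ x} x := by
      refine ⟨fun k hk => hk.2, fun b hb => (h.orderedBy x b).2 ?_⟩
      rintro _ ⟨k, hk, rfl⟩ hkx
      exact hb ⟨hk, hkx⟩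
    obtain ⟨k, ⟨hk, hkx⟩, hkO⟩ := hO'.2 (d := {k | IsCompactElement k ∧ k ≤ x}) trivial
      ⟨⊥, isCompactElement_bot, bot_le⟩ (fun a ha b hb => ⟨a ⊔ b, ⟨isCompactElement_sup ha.1 hb.1, sup_le ha.2 hb.2⟩,
        le_sup_left, le_sup_right⟩) hlub hx
    exact ⟨Set.Ici k, fun y hy => hO'.1 hy hkO,
      (isClopen_of_mem (t := patch (compactUps X)) rfl ⟨k, hk, rfl⟩).isOpen, hkx⟩

variable {𝒦 : Set (Set X)} (h : IsFilterFamily 𝒦) (ho : OrderedBy 𝒦)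

include h ho

theorem IsFilterFamily.isLUB_below (x : X) : IsLUB {k | Set.Ici k ∈ 𝒦 ∧ k ≤ x} x := by
  refine ⟨fun k hk => hk.2, fun b hb => (ho x b).2 fun U hU hxU => ?_⟩
  obtain ⟨k, rfl⟩ := h.exists_eq_Ici ho hU
  exact hb ⟨hU, hxU⟩

/-- Each `k` is the directed supremum of the elements below it with upset in `𝒦`, so a compact `k`
is one of these. Conversely, for directed `s` the members of `𝒦` meeting `s` form a filter whose
point bounds `s` above; if `k` is below the supremum of `s`, then `Set.Ici k` is in that filter and
meets `s`. -/
theorem IsFilterFamily.isCompactElement_iff {k : X} : IsCompactElement k ↔ Set.Ici k ∈ 𝒦 := by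
  constructor
  · intro hk
    obtain ⟨l, hl, hkl⟩ := hk {l | Set.Ici l ∈ 𝒦 ∧ l ≤ k} k
      ⟨⊥, by simpa using h.univ_mem, bot_le⟩
      (fun a ha b hb => ⟨a ⊔ b, ⟨by
        rw [← Set.Ici_inter_Ici]; exact h.inter_mem _ ha.1 _ hb.1, sup_le ha.2 hb.2⟩,
        le_sup_left, le_sup_right⟩) (h.isLUB_below ho k) le_rfl
    rw [le_antisymm hkl hl.2]
    exact hl.1
  · intro hk s u hs hd hu hku
    obtain ⟨p, hp⟩ := h.exists_point {V | V ∈ 𝒦 ∧ ∃ x ∈ s, x ∈ V} (fun V hV => hV.1)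
      ⟨h.univ_mem, hs.imp fun x hx => ⟨hx, trivial⟩⟩
      (by
        rintro V ⟨hV, x, hx, hxV⟩ W ⟨hW, y, hy, hyW⟩
        obtain ⟨z, hz, hxz, hyz⟩ := hd x hx y hy
        exact ⟨h.inter_mem V hV W hW, z, hz, (ho x z).1 hxz V hV hxV, (ho y z).1 hyz W hW hyW⟩)
      (fun V hV W hW hVW => ⟨hW, hV.2.imp fun x hx => ⟨hx.1, hVW hx.2⟩⟩)
    have hup : u ≤ p := hu.2 fun x hx => (ho x p).2 fun U hU hxU => (hp U hU).2 ⟨hU, x, hx, hxU⟩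
    exact ((hp _ hk).1 (hku.trans hup)).2

theorem IsFilterFamily.compactUps_eq : compactUps X = 𝒦 := by
  ext U
  constructor
  · rintro ⟨k, hk, rfl⟩
    exact (h.isCompactElement_iff ho).1 hk
  · intro hU
    obtain ⟨k, rfl⟩ := h.exists_eq_Ici ho hU
    exact ⟨k, (h.isCompactElement_iff ho).2 hU, rfl⟩

/-- Through `isCompactElement_iff`, the two compactness conditions become closure of `𝒦` under empty
and binary joins. -/
theorem IsFilterFamily.isCoherent : IsCoherent X where
  algebraic := ⟨fun x => ⟨_, fun _ hk => (h.isCompactElement_iff ho).2 hk.1,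
    (h.isLUB_below ho x).sSup_eq⟩⟩
  top_compact := by
    rw [h.isCompactElement_iff ho]
    have := h.joinClosed.hull_empty_mem
    rwa [h.hull_eq_Ici ho, sInf_empty] at this
  inf_compact a b ha hb := by
    rw [h.isCompactElement_iff ho] at *
    have := h.joinClosed.hull_union_mem _ ha _ hb
    rwa [h.hull_eq_Ici ho, sInf_union, csInf_Ici, csInf_Ici] at this

theorem IsFilterFamily.lawson_eq_patch : Topology.lawson X = patch 𝒦 := by
  rw [(h.isCoherent ho).lawson_eq_patch, h.compactUps_eq ho]

end Coherent

theorem JoinClosed.self {X : Type*} {𝒦 𝒢 : Set (Set X)} (h : JoinClosed 𝒦 𝒢) :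
    JoinClosed 𝒦 𝒦 where
  subset := subset_rfl
  hull_empty_mem := h.hull_empty_eq ▸ h.hull_empty_mem
  hull_union_mem U hU V hV := h.hull_union_eq hU hV ▸ h.hull_union_mem U hU V hV

/-- Filter spaces with the same points and the same sets are isomorphic. -/
def FSpace.isoOfEq {X : Type u} {𝒦 ℒ : Set (Set X)} (h𝒦 : IsFilterFamily 𝒦)
    (hℒ : IsFilterFamily ℒ) (h : 𝒦 = ℒ) : FSpace.mk X 𝒦 h𝒦 ≅ FSpace.mk X ℒ hℒ :=
  eqToIso (by subst h; rfl)

/-! ### Jipsen–Moshier spaces are filter spaces -/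

section JM

/-- The closures of the points of `U` are down-directed because `U` is a filter, and each meets `U`.
By compactness some `u ∈ U` lies in all of them, so every point of `U` specializes to `u`. -/
theorem exists_least_of_mem_KOF {X : Type*} [TopologicalSpace X] {U : Set X} (hU : U ∈ KOF X) :
    ∃ u ∈ U, ∀ V, IsOpen V → u ∈ V → U ⊆ V := by
  have hne : Nonempty U := hU.1.2.1.to_subtype
  have hz : (U ∩ ⋂ x : U, closure {x.1}).Nonempty := by
    by_contra hc
    obtain ⟨x, hx⟩ := hU.2.elim_directed_family_closed (fun x : U => closure {x.1})
      (fun _ => isClosed_closure) (Set.not_nonempty_iff_eq_empty.1 hc)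
      (fun x y => by
        obtain ⟨z, hz, hxz, hyz⟩ := hU.1.2.2 x.1 x.2 y.1 y.2
        exact ⟨⟨z, hz⟩, hxz.closure_subset, hyz.closure_subset⟩)
    exact (Set.ext_iff.1 hx x.1).1 ⟨x.2, subset_closure rfl⟩
  obtain ⟨u, hu, hux⟩ := hz
  refine ⟨u, hu, fun V hV huV x hx => ?_⟩
  exact (specializes_iff_mem_closure.2 (Set.mem_iInter.1 hux ⟨x, hx⟩)).mem_open hV huV

theorem JM.joinClosed (X : JM.{u}) : JoinClosed (KOF X) (OF X) where
  subset _ hU := hU.1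
  hull_empty_mem := X.bot_mem
  hull_union_mem := X.sup_mem

/-- Sobriety produces the point of `φ` as the generic point of the set `S` of points all of whose
compact open filters belong to `φ`. The complement of `S` is the union of the members outside `φ`,
so `S` is closed. It is irreducible because each member of `φ` has its least point in `S` and `φ` is
closed under intersections. -/
theorem JM.isFilterFamily (X : JM.{u}) : IsFilterFamily (KOF X) where
  univ_mem := X.univ_mem
  inter_mem := X.inter_mem
  joinClosed := X.joinClosed.self
  ext x y hxy := by
    have := X.t0
    refine Inseparable.eq (inseparable_iff_forall_isOpen.2 fun O hO => ⟨fun hx => ?_, fun hy => ?_⟩)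
    · obtain ⟨V, hV, hxV, hVO⟩ := X.basis.exists_subset_of_mem_open hx hO
      exact hVO ((hxy V hV).1 hxV)
    · obtain ⟨V, hV, hyV, hVO⟩ := X.basis.exists_subset_of_mem_open hy hO
      exact hVO ((hxy V hV).2 hyV)
  exists_point φ hφ h1 h2 h3 := by
    have hqs := X.quasiSober
    let S : Set X := {y | ∀ V ∈ KOF X, y ∈ V → V ∈ φ}
    have hleast (U) (hU : U ∈ φ) : ∃ z ∈ U, z ∈ S := by
      obtain ⟨z, hz, hzU⟩ := exists_least_of_mem_KOF (hφ hU)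
      exact ⟨z, hz, fun V hV hzV => h3 U hU V hV (hzU V hV.1.1 hzV)⟩
    have hopen (O : Set X) (hO : IsOpen O) (hS : (S ∩ O).Nonempty) : ∃ V ∈ φ, V ⊆ O := by
      obtain ⟨y, hy, hyO⟩ := hS
      obtain ⟨V, hV, hyV, hVO⟩ := X.basis.exists_subset_of_mem_open hyO hO
      exact ⟨V, hy V hV hyV, hVO⟩
    have hclosed : IsClosed S := by
      rw [← isOpen_compl_iff]
      have : Sᶜ = ⋃₀ (KOF X \ φ) := by
        ext y
        constructor
        · intro hy
          by_contra hc
          exact hy fun V hV hyV => by_contra fun hVφ => hc ⟨V, ⟨hV, hVφ⟩, hyV⟩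
        · rintro ⟨V, hV, hyV⟩ hy
          exact hV.2 (hy V hV.1 hyV)
      rw [this]
      exact isOpen_sUnion fun V hV => hV.1.1.1
    have hirr : IsIrreducible S := by
      refine ⟨?_, fun O₁ O₂ hO₁ hO₂ hS₁ hS₂ => ?_⟩
      · obtain ⟨z, -, hz⟩ := hleast _ h1
        exact ⟨z, hz⟩
      · obtain ⟨V₁, hV₁, hVO₁⟩ := hopen O₁ hO₁ hS₁
        obtain ⟨V₂, hV₂, hVO₂⟩ := hopen O₂ hO₂ hS₂
        obtain ⟨z, hz, hzS⟩ := hleast _ (h2 V₁ hV₁ V₂ hV₂)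
        exact ⟨z, hzS, hVO₁ hz.1, hVO₂ hz.2⟩
    obtain ⟨x, hx⟩ := QuasiSober.sober hirr hclosed
    refine ⟨x, fun U hU => ?_⟩
    rw [hx.mem_open_set_iff hU.1.1]
    refine ⟨fun ⟨y, hy, hyU⟩ => hy U hU hyU, fun hUφ => ?_⟩
    obtain ⟨z, hz, hzS⟩ := hleast U hUφ
    exact ⟨z, hzS, hz⟩

/-- The filter space of compact open filters. -/
def jmFunctor : JM.{u} ⥤ FSpace.{u} where
  obj X := ⟨X, KOF X, X.isFilterFamily⟩
  map {X Y} a := ⟨JMHom.f a, isFamilyMap_of_preserves X.joinClosed Y.joinClosed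
    (JMHom.preimage_mem a) (JMHom.preimage_join a)⟩
  map_id _ := rfl
  map_comp _ _ := rfl

instance : jmFunctor.{u}.Faithful where
  map_injective h := JMHom.ext (congrArg FHom.f h)

instance : jmFunctor.{u}.Full where
  map_surjective {X Y} a := ⟨(⟨FHom.f a, (FHom.isFamilyMap a).preimage_mem,
    fun _ hfin h𝒮 => (FHom.isFamilyMap a).preserves X.joinClosed Y.joinClosed hfin h𝒮⟩ :
      JMHom X Y), rfl⟩

theorem IsFilterFamily.isTopologicalBasis {X : Type*} {𝒦 : Set (Set X)} (h : IsFilterFamily 𝒦) :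
    @TopologicalSpace.IsTopologicalBasis X (TopologicalSpace.generateFrom 𝒦) 𝒦 :=
  letI := TopologicalSpace.generateFrom 𝒦
  { exists_subset_inter := fun U hU V hV _ hx => ⟨U ∩ V, h.inter_mem U hU V hV, hx, subset_rfl⟩
    sUnion_eq := Set.eq_univ_of_forall fun _ => ⟨_, h.univ_mem, trivial⟩
    eq_generateFrom := rfl }

/-! ### Topologies with a filter family as basis: recovery of the compact open filters. -/

section

variable {X : Type*} [t : TopologicalSpace X] {𝒦 : Set (Set X)} (h : IsFilterFamily 𝒦)
  (ht : TopologicalSpace.IsTopologicalBasis 𝒦)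

include h ht

/-- Every open set containing the least point of `U` contains all of `U`; that one point witnesses
both compactness and the filter condition. -/
theorem IsFilterFamily.mem_KOF {U : Set X} (hU : U ∈ 𝒦) : U ∈ KOF X := by
  obtain ⟨u, hu, hmin⟩ := h.exists_least hU
  have hsub (O : Set X) (hO : IsOpen O) (huO : u ∈ O) : U ⊆ O := by
    obtain ⟨V, hV, huV, hVO⟩ := ht.exists_subset_of_mem_open huO hO
    exact (hmin V hV huV).trans hVO
  refine ⟨⟨ht.isOpen hU, ⟨u, hu⟩, fun x hx y hy => ⟨u, hu, ?_, ?_⟩⟩, ?_⟩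
  · exact specializes_iff_forall_open.2 fun O hO huO => hsub O hO huO hx
  · exact specializes_iff_forall_open.2 fun O hO huO => hsub O hO huO hy
  · refine isCompact_iff_ultrafilter_le_nhds.2 fun f hf => ⟨u, hu, fun O hO => ?_⟩
    obtain ⟨O', hO', hopen, huO'⟩ := mem_nhds_iff.1 hO
    exact Filter.mem_of_superset (Filter.le_principal_iff.1 hf) ((hsub O' hopen huO').trans hO')

theorem IsFilterFamily.KOF_eq : KOF X = 𝒦 := by
  refine Set.Subset.antisymm (fun U hU => ?_) fun U hU => h.mem_KOF ht hU
  obtain ⟨u, hu, hmin⟩ := exists_least_of_mem_KOF hU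
  obtain ⟨V, hV, huV, hVU⟩ := ht.exists_subset_of_mem_open hu hU.1.1
  rwa [(hmin V (ht.isOpen hV) huV).antisymm hVU]

/-- An open filter `G` containing `U ∪ V` contains a lower bound `z` of the two least points. A
basic neighbourhood of `z` inside `G` contains these points, hence `U` and `V`, and so takes part in
the hull in `𝒦`. -/
theorem IsFilterFamily.joinClosed_OF : JoinClosed 𝒦 (OF X) := by
  refine joinClosed_of_hull_eq h.joinClosed (fun U hU => (h.mem_KOF ht hU).1) ?_ ?_
  · rintro x hx G ⟨hG, -⟩
    obtain ⟨z, hz⟩ := hG.2.1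
    obtain ⟨V, hV, -, hVG⟩ := ht.exists_subset_of_mem_open hz hG.1
    exact hVG (hx V ⟨hV, Set.empty_subset _⟩)
  · rintro U hU V hV x hx G ⟨hG, hUV⟩
    obtain ⟨u, hu, hminu⟩ := h.exists_least hU
    obtain ⟨v, hv, hminv⟩ := h.exists_least hV
    obtain ⟨z, hz, huz, hvz⟩ := hG.2.2 u (hUV (Or.inl hu)) v (hUV (Or.inr hv))
    obtain ⟨W, hW, hzW, hWG⟩ := ht.exists_subset_of_mem_open hz hG.1
    exact hWG (hx W ⟨hW, Set.union_subset (hminu W hW (huz.mem_open (ht.isOpen hW) hzW))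
      (hminv W hW (hvz.mem_open (ht.isOpen hW) hzW))⟩)

theorem IsFilterFamily.t0Space : T0Space X :=
  ⟨fun x y hxy => h.ext x y fun U hU => inseparable_iff_forall_isOpen.1 hxy U (ht.isOpen hU)⟩

/-- The generic point of `S` is the point of the filter of members meeting `S`; irreducibility of
`S` gives closure under intersections. -/
theorem IsFilterFamily.quasiSober : QuasiSober X where
  sober {S} hS hcl := by
    obtain ⟨x, hx⟩ := h.exists_point {U | U ∈ 𝒦 ∧ (S ∩ U).Nonempty} (fun U hU => hU.1)
      ⟨h.univ_mem, by simpa using hS.1⟩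
      (fun U hU V hV => ⟨h.inter_mem U hU.1 V hV.1,
        hS.2 U V (ht.isOpen hU.1) (ht.isOpen hV.1) hU.2 hV.2⟩)
      (fun U hU V hV hUV => ⟨hV, hU.2.mono (Set.inter_subset_inter_right _ hUV)⟩)
    refine ⟨x, Set.Subset.antisymm (hcl.closure_subset_iff.2 ?_) fun y hy => ?_⟩
    · rw [Set.singleton_subset_iff, ← hcl.closure_eq, ht.mem_closure_iff]
      intro U hU hxU
      rw [Set.inter_comm]
      exact ((hx U hU).1 hxU).2
    · rw [ht.mem_closure_iff]
      exact fun U hU hyU => ⟨x, (hx U hU).2 ⟨hU, y, hy, hyU⟩, rfl⟩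

end

/-- Here the topology is generated by `𝒦` alone; the corresponding constructions for `BDGM` and `Hs`
use the patch topology. -/
instance : jmFunctor.{u}.EssSurj where
  mem_essImage P := by
    obtain ⟨X, 𝒦, h⟩ := P
    let t : TopologicalSpace X := TopologicalSpace.generateFrom 𝒦
    have ht := h.isTopologicalBasis
    have hK : KOF X = 𝒦 := h.KOF_eq ht
    have hj : JoinClosed (KOF X) (OF X) := by rw [hK]; exact h.joinClosed_OF ht
    exact ⟨{ carrier := X
             t0 := h.t0Space ht
             quasiSober := h.quasiSober ht
             basis := by rw [hK]; exact ht
             univ_mem := by rw [hK]; exact h.univ_mem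
             inter_mem := by rw [hK]; exact h.inter_mem
             bot_mem := hj.hull_empty_mem
             sup_mem := hj.hull_union_mem }, ⟨FSpace.isoOfEq _ _ hK⟩⟩

instance : jmFunctor.{u}.IsEquivalence where

end JM

/-! ### Bezhanishvili–Dmitrieva–de Groot–Moraschini spaces are filter spaces -/

section BDGM

theorem clopenFilterJoins_of_joinClosed {X : Type*} [SemilatticeInf X] [TopologicalSpace X]
    (h : JoinClosed (CLF X) {G : Set X | IsPFilter G}) :
    ClopenFilterJoins X := fun _ hfin h𝒮 => (h.hull_sUnion_mem hfin h𝒮).1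

section

variable {X : Type*} [SemilatticeInf X] [OrderTop X]

theorem filterGen_empty : filterGen (∅ : Set X) = {⊤} := by
  refine Set.Subset.antisymm (filterGen_subset ?_ (Set.empty_subset _)) ?_
  · rw [isPFilter_iff]
    refine ⟨rfl, ?_, ?_⟩
    · rintro _ rfl _ rfl
      exact inf_idem _
    · rintro _ rfl b hb
      exact top_le_iff.1 hb
  · rintro _ rfl
    exact (isPFilter_iff.1 (isPFilter_filterGen _)).1

theorem mem_filterGen_union {U V : Set X} (hU : IsPFilter U) (hV : IsPFilter V) {x : X} :
    x ∈ filterGen (U ∪ V) ↔ ∃ u ∈ U, ∃ v ∈ V, u ⊓ v ≤ x := by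
  have hU' := isPFilter_iff.1 hU
  have hV' := isPFilter_iff.1 hV
  constructor
  · intro hx
    refine filterGen_subset (G := {x | ∃ u ∈ U, ∃ v ∈ V, u ⊓ v ≤ x}) ?_ ?_ hx
    · rw [isPFilter_iff]
      refine ⟨⟨⊤, hU'.1, ⊤, hV'.1, le_top⟩, ?_, ?_⟩
      · rintro a ⟨u, hu, v, hv, ha⟩ b ⟨u', hu', v', hv', hb⟩
        refine ⟨u ⊓ u', hU'.2.1 u hu u' hu', v ⊓ v', hV'.2.1 v hv v' hv', ?_⟩
        rw [inf_inf_inf_comm]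
        exact inf_le_inf ha hb
      · rintro a ⟨u, hu, v, hv, ha⟩ b hab
        exact ⟨u, hu, v, hv, ha.trans hab⟩
    · rintro y (hy | hy)
      · exact ⟨y, hy, ⊤, hV'.1, inf_le_left⟩
      · exact ⟨⊤, hU'.1, y, hy, inf_le_right⟩
  · rintro ⟨u, hu, v, hv, hx⟩
    have h := isPFilter_iff.1 (isPFilter_filterGen (U ∪ V))
    exact h.2.2 _ (h.2.1 _ (subset_filterGen _ (Or.inl hu)) _ (subset_filterGen _ (Or.inr hv)))
      _ hx

variable [TopologicalSpace X]

theorem ClopenFilterJoins.joinClosed (h : ClopenFilterJoins X) :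
    JoinClosed (CLF X) {G : Set X | IsPFilter G} where
  subset _ hU := hU.2
  hull_empty_mem := ⟨by
    have := h ∅ Set.finite_empty (Set.empty_subset _)
    rwa [Set.sUnion_empty] at this, isPFilter_filterGen _⟩
  hull_union_mem U hU V hV := ⟨by
    have := h {U, V} (Set.toFinite _) (Set.pair_subset hU hV)
    rwa [Set.sUnion_pair] at this, isPFilter_filterGen _⟩

theorem orderedBy_CLF (hsep : ∀ x y : X, ¬ x ≤ y → ∃ F ∈ CLF X, x ∈ F ∧ y ∉ F) :
    OrderedBy (CLF X) := by
  refine fun x y => ⟨fun hxy U hU hx => (isPFilter_iff.1 hU.2).2.2 x hx y hxy, fun hxy => ?_⟩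
  by_contra hc
  obtain ⟨F, hF, hx, hy⟩ := hsep x y hc
  exact hy (hxy F hF hx)

theorem isFilterFamily_CLF [CompactSpace X] (ho : OrderedBy (CLF X)) (hj : ClopenFilterJoins X) :
    IsFilterFamily (CLF X) := by
  refine isFilterFamily_of_compact ⟨⟨isClopen_univ, by simp [isPFilter_iff]⟩, ?_,
    hj.joinClosed.self⟩ (fun U hU => hU.1) ho.ext ?_
  · intro U hU V hV
    have := isPFilter_sInter (𝒮 := {U, V}) (by simp [hU.2, hV.2])
    exact ⟨hU.1.inter hV.1, by simpa using this⟩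
  · intro U hU
    obtain ⟨u, rfl⟩ := exists_eq_Ici_of_isCompact
      (isClosed_Iic_of_orderedBy ho fun _ hU => hU.1) hU.1.isClosed.isCompact hU.1.isClosed hU.2
    exact ⟨u, Set.self_mem_Ici, fun V hV huV x hx => (ho u x).1 hx V hV huV⟩

end

theorem BDGM.orderedBy (X : BDGM.{u}) : OrderedBy (CLF X) := orderedBy_CLF X.separation

theorem BDGM.isFilterFamily (X : BDGM.{u}) : IsFilterFamily (CLF X) :=
  have := X.compact
  isFilterFamily_CLF X.orderedBy X.joins

theorem BDGM.joinClosed (X : BDGM.{u}) : JoinClosed (CLF X) {G : Set X | IsPFilter G} :=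
  X.joins.joinClosed

theorem BDGM.hull_empty (X : BDGM.{u}) : hull (CLF X) ∅ = {⊤} := by
  rw [← X.joinClosed.hull_empty_eq]
  exact filterGen_empty

theorem BDGM.mem_hull_union (X : BDGM.{u}) {U V : Set X} (hU : U ∈ CLF X) (hV : V ∈ CLF X)
    {x : X} : x ∈ hull (CLF X) (U ∪ V) ↔ ∃ u ∈ U, ∃ v ∈ V, u ⊓ v ≤ x := by
  rw [← X.joinClosed.hull_union_eq hU hV]
  exact mem_filterGen_union hU.2 hV.2

/-- The join of two clopen filters consists of the elements above some `u ⊓ v`, so `exists_inf_le`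
yields preservation of binary joins. The least filter is `{⊤}`, so `eq_top` handles the empty join.
-/
theorem BDGMHom.isFamilyMap {X Y : BDGM.{u}} (a : BDGMHom X Y) :
    IsFamilyMap (CLF X) (CLF Y) a.f := by
  have hmem (U) (hU : U ∈ CLF Y) : a.f ⁻¹' U ∈ CLF X := by
    have hU' := isPFilter_iff.1 hU.2
    refine ⟨hU.1.preimage a.continuous, isPFilter_iff.2 ⟨?_, fun x hx y hy => ?_,
      fun x hx y hxy => ?_⟩⟩
    · rw [Set.mem_preimage, a.map_top]
      exact hU'.1
    · rw [Set.mem_preimage, a.map_inf]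
      exact hU'.2.1 _ hx _ hy
    · exact hU'.2.2 _ hx _ (monotone_of_map_inf a.map_inf hxy)
  refine ⟨hmem, ?_, fun U hU V hV => ?_⟩
  · rw [X.hull_empty, Y.hull_empty]
    ext x
    exact ⟨fun hx => a.eq_top x hx, fun hx => hx ▸ a.map_top⟩
  · ext x
    rw [X.mem_hull_union (hmem U hU) (hmem V hV), Set.mem_preimage, Y.mem_hull_union hU hV]
    constructor
    · rintro ⟨u, hu, v, hv, huv⟩
      obtain ⟨y, z, hy, hz, hyz⟩ := a.exists_inf_le x u v huv
      exact ⟨y, (Y.orderedBy _ _).1 hy U hU hu, z, (Y.orderedBy _ _).1 hz V hV hv, hyz⟩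
    · rintro ⟨u, hu, v, hv, huv⟩
      refine ⟨_, hu, _, hv, ?_⟩
      rw [← a.map_inf]
      exact monotone_of_map_inf a.map_inf huv

/-- This is compactness of `X × X`. For clopen filters `U ∋ y'` and `V ∋ z'`, the pairs `(y, z)`
with `f y ∈ U`, `f z ∈ V` and `y ⊓ z ≤ x` form a closed set, nonempty because the inverse image
preserves the join of `U` and `V`. These sets are directed, and a common point works because clopen
filters determine the order. -/
theorem BDGM.exists_inf_le {X Y : BDGM.{u}} {f : X → Y} (hf : IsFamilyMap (CLF X) (CLF Y) f)
    (x : X) (y' z' : Y) (h : y' ⊓ z' ≤ f x) :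
    ∃ y z : X, y' ≤ f y ∧ z' ≤ f z ∧ y ⊓ z ≤ x := by
  have := X.compact
  let ι := {p : Set Y × Set Y // (p.1 ∈ CLF Y ∧ y' ∈ p.1) ∧ p.2 ∈ CLF Y ∧ z' ∈ p.2}
  let T (p : ι) : Set (X × X) :=
    {q | (q.1 ∈ f ⁻¹' p.1.1 ∧ q.2 ∈ f ⁻¹' p.1.2) ∧ q.1 ⊓ q.2 ≤ x}
  have hne : Nonempty ι := ⟨⟨(Set.univ, Set.univ), ⟨Y.isFilterFamily.univ_mem, trivial⟩,
    Y.isFilterFamily.univ_mem, trivial⟩⟩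
  have hcl (p : ι) : IsClosed (T p) := by
    -- The inequality `q.1 ⊓ q.2 ≤ x` fails exactly when a clopen filter missing `x` contains both
    -- coordinates, which is an open condition on `q`.
    have : T p = (Prod.fst ⁻¹' (f ⁻¹' p.1.1) ∩ Prod.snd ⁻¹' (f ⁻¹' p.1.2)) ∩
        ⋂ W ∈ {W | W ∈ CLF X ∧ x ∉ W}, (Prod.fst ⁻¹' W ∩ Prod.snd ⁻¹' W)ᶜ := by
      ext q
      refine and_congr_right fun _ => ?_
      rw [X.orderedBy]
      simp only [Set.mem_iInter, Set.mem_ofPred_eq, and_imp]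
      refine forall₂_congr fun W hW => ?_
      have hW' := isPFilter_iff.1 hW.2
      have : q.1 ⊓ q.2 ∈ W ↔ q.1 ∈ W ∧ q.2 ∈ W :=
        ⟨fun hq => ⟨hW'.2.2 _ hq _ inf_le_left, hW'.2.2 _ hq _ inf_le_right⟩,
          fun hq => hW'.2.1 _ hq.1 _ hq.2⟩
      rw [this]
      exact not_imp_not.symm
    rw [this]
    refine ((((hf.preimage_mem _ p.2.1.1).1.isClosed).preimage continuous_fst).inter
      (((hf.preimage_mem _ p.2.2.1).1.isClosed).preimage continuous_snd)).inter
      (isClosed_biInter fun W hW => IsOpen.isClosed_compl ?_)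
    exact (hW.1.1.isOpen.preimage continuous_fst).inter (hW.1.1.isOpen.preimage continuous_snd)
  obtain ⟨q, hq⟩ := IsCompact.nonempty_iInter_of_directed_nonempty_isCompact_isClosed T
    (fun p p' => ⟨⟨(p.1.1 ∩ p'.1.1, p.1.2 ∩ p'.1.2),
      ⟨Y.isFilterFamily.inter_mem _ p.2.1.1 _ p'.2.1.1, p.2.1.2, p'.2.1.2⟩,
      ⟨Y.isFilterFamily.inter_mem _ p.2.2.1 _ p'.2.2.1, p.2.2.2, p'.2.2.2⟩⟩,
      fun q hq => ⟨⟨hq.1.1.1, hq.1.2.1⟩, hq.2⟩, fun q hq => ⟨⟨hq.1.1.2, hq.1.2.2⟩, hq.2⟩⟩)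
    (fun p => by
      have hx : x ∈ f ⁻¹' hull (CLF Y) (p.1.1 ∪ p.1.2) :=
        (Y.mem_hull_union p.2.1.1 p.2.2.1).2 ⟨y', p.2.1.2, z', p.2.2.2, h⟩
      rw [hf.preimage_hull_union _ p.2.1.1 _ p.2.2.1,
        X.mem_hull_union (hf.preimage_mem _ p.2.1.1) (hf.preimage_mem _ p.2.2.1)] at hx
      obtain ⟨y, hy, z, hz, hyz⟩ := hx
      exact ⟨(y, z), ⟨hy, hz⟩, hyz⟩)
    (fun p => (hcl p).isCompact) hcl
  rw [Set.mem_iInter] at hq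
  refine ⟨q.1, q.2, (Y.orderedBy _ _).2 fun U hU hy => ?_,
    (Y.orderedBy _ _).2 fun U hU hz => ?_, (hq hne.some).2⟩
  · exact (hq ⟨(U, Set.univ), ⟨hU, hy⟩, Y.isFilterFamily.univ_mem, trivial⟩).1.1
  · exact (hq ⟨(Set.univ, U), ⟨Y.isFilterFamily.univ_mem, trivial⟩, hU, hz⟩).1.2

theorem BDGM.top_eq_patch (X : BDGM.{u}) : X.top = patch (CLF X) :=
  have := X.compact
  eq_patch (fun _ hU => hU.1) X.orderedBy.ext

theorem BDGM.top_mem (X : BDGM.{u}) {U : Set X} (hU : U ∈ CLF X) : ⊤ ∈ U :=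
  (isPFilter_iff.1 hU.2).1

theorem BDGM.inf_mem_iff (X : BDGM.{u}) {U : Set X} (hU : U ∈ CLF X) {a b : X} :
    a ⊓ b ∈ U ↔ a ∈ U ∧ b ∈ U :=
  have h := isPFilter_iff.1 hU.2
  ⟨fun hq => ⟨h.2.2 _ hq _ inf_le_left, h.2.2 _ hq _ inf_le_right⟩, fun hq => h.2.1 _ hq.1 _ hq.2⟩

/-- A map whose inverse image map is a homomorphism between the lattices of clopen filters is a
morphism. -/
def BDGM.homOfFamilyMap {X Y : BDGM.{u}} {f : X → Y} (hf : IsFamilyMap (CLF X) (CLF Y) f) :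
    BDGMHom X Y where
  f := f
  continuous := continuous_of_isClopen_preimage Y.top_eq_patch fun U hU => (hf.preimage_mem U hU).1
  map_top := Y.orderedBy.ext _ _ fun U hU =>
    ⟨fun _ => Y.top_mem hU, fun _ => X.top_mem (hf.preimage_mem U hU)⟩
  map_inf x y := Y.orderedBy.ext _ _ fun U hU => by
    rw [Y.inf_mem_iff hU]
    exact X.inf_mem_iff (hf.preimage_mem U hU)
  eq_top x hx := by
    have : x ∈ f ⁻¹' hull (CLF Y) ∅ := by
      rw [Y.hull_empty]
      exact hx
    rw [hf.preimage_hull_empty, X.hull_empty] at this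
    exact this
  exists_inf_le := BDGM.exists_inf_le hf

/-- The filter space of clopen filters. -/
def bdgmFunctor : BDGM.{u} ⥤ FSpace.{u} where
  obj X := ⟨X, CLF X, X.isFilterFamily⟩
  map a := ⟨BDGMHom.f a, BDGMHom.isFamilyMap a⟩
  map_id _ := rfl
  map_comp _ _ := rfl

instance : bdgmFunctor.{u}.Faithful where
  map_injective h := BDGMHom.ext (congrArg FHom.f h)

instance : bdgmFunctor.{u}.Full where
  map_surjective a := ⟨BDGM.homOfFamilyMap (f := FHom.f a) (FHom.isFamilyMap a), rfl⟩

instance : bdgmFunctor.{u}.EssSurj where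
  mem_essImage P := by
    obtain ⟨X, 𝒦, h⟩ := P
    let t : TopologicalSpace X := patch 𝒦
    let l : CompleteLattice X := h.completeLattice
    have ho : OrderedBy 𝒦 := h.orderedBy
    have hK : CLF X = 𝒦 := h.CLF_eq ho rfl
    exact ⟨{ carrier := X
             compact := h.compactSpace rfl
             separation := fun x y hxy => by
               rw [ho] at hxy
               push Not at hxy
               rw [hK]
               exact hxy
             joins := clopenFilterJoins_of_joinClosed
               (by rw [hK]; exact h.joinClosed_isPFilter ho) }, ⟨FSpace.isoOfEq _ _ hK⟩⟩

instance : bdgmFunctor.{u}.IsEquivalence where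

end BDGM

/-! ### Hartonas spaces are filter spaces -/

section Hs

section

variable {X : Type*} [PartialOrder X]

theorem subset_Gam (A : Set X) : A ⊆ Gam A := fun _ ha _ hb => hb ha

theorem isUpperSet_Gam (A : Set X) : IsUpperSet (Gam A) :=
  fun _ _ hab ha _ hc => (ha hc).trans hab

theorem Gam_eq_hull_GamSets (A : Set X) : Gam A = hull (GamSets X) A := by
  refine Set.Subset.antisymm ?_ (hull_subset ⟨A, rfl⟩ (subset_Gam A))
  rintro x hx _ ⟨⟨B, rfl⟩, hAB⟩ b hb
  exact hx fun a ha => hAB ha hb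

end

theorem Hs.joinClosed (X : Hs.{u}) : JoinClosed (LamSets X) (GamSets X) where
  subset _ hU := hU.1
  hull_empty_mem := Gam_eq_hull_GamSets (∅ : Set X) ▸ X.bot_mem
  hull_union_mem U hU V hV := Gam_eq_hull_GamSets (U ∪ V) ▸ X.sup_mem U hU V hV

theorem Gam_singleton {X : Type*} [PartialOrder X] (x : X) : Gam {x} = Set.Ici x :=
  Set.ext fun _ => ⟨fun hy => hy fun _ ha => ha ▸ le_rfl, fun hy _ hb => (hb rfl).trans hy⟩

/-- A principal upset is Galois closed, hence an intersection of clopen Galois closed sets, so these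
detect the order. -/
theorem Hs.orderedBy (X : Hs.{u}) : OrderedBy (LamSets X) := by
  intro x y
  constructor
  · rintro hxy _ ⟨⟨A, rfl⟩, -⟩ hx
    exact isUpperSet_Gam A hxy hx
  · intro hxy
    obtain ⟨𝒮, h𝒮, heq⟩ := X.meetDense (Gam {x}) ⟨_, rfl⟩
    have hy : y ∈ Gam {x} := by
      rw [heq]
      intro U hU
      have hx : x ∈ Gam {x} := subset_Gam _ rfl
      rw [heq] at hx
      exact hxy U (h𝒮 hU) (hx U hU)
    rwa [Gam_singleton] at hy

/-- The set `Gam A` has the least point `sInf A`, as `isFilterFamily_of_compact` requires. -/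
theorem Hs.isFilterFamily (X : Hs.{u}) : IsFilterFamily (LamSets X) := by
  have := X.compact
  refine isFilterFamily_of_compact ⟨X.univ_mem, X.inter_mem, X.joinClosed.self⟩
    (fun U hU => hU.2) X.orderedBy.ext ?_
  rintro _ ⟨⟨A, rfl⟩, -⟩
  refine ⟨sInf A, fun b hb => le_sInf hb, fun V hV hA x hx => ?_⟩
  exact (X.orderedBy _ x).1 (hx fun a ha => sInf_le ha) V hV hA

theorem Hs.top_eq_patch (X : Hs.{u}) : X.top = patch (LamSets X) := X.generate

/-- The filter space of clopen Galois closed sets. -/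
def hsFunctor : Hs.{u} ⥤ FSpace.{u} where
  obj X := ⟨X, LamSets X, X.isFilterFamily⟩
  map {X Y} a := ⟨HsHom.f a, isFamilyMap_of_preserves X.joinClosed Y.joinClosed
    (HsHom.preimage_mem a) fun 𝒮 hfin h𝒮 => by
      rw [← Gam_eq_hull_GamSets, ← Gam_eq_hull_GamSets]
      exact HsHom.preimage_join a 𝒮 hfin h𝒮⟩
  map_id _ := rfl
  map_comp _ _ := rfl

instance : hsFunctor.{u}.Faithful where
  map_injective h := HsHom.ext (congrArg FHom.f h)

instance : hsFunctor.{u}.Full where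
  map_surjective {X Y} a := by
    have hf : IsFamilyMap (LamSets X) (LamSets Y) (FHom.f a) := FHom.isFamilyMap a
    refine ⟨(⟨FHom.f a, continuous_of_isClopen_preimage Y.top_eq_patch
      fun U hU => (hf.preimage_mem U hU).2, hf.preimage_mem, fun 𝒮 hfin h𝒮 => ?_⟩ : HsHom X Y), rfl⟩
    rw [Gam_eq_hull_GamSets, Gam_eq_hull_GamSets]
    exact hf.preserves X.joinClosed Y.joinClosed hfin h𝒮

theorem IsFilterFamily.LamSets_eq {X : Type*} {𝒦 : Set (Set X)} [CompleteLattice X]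
    [t : TopologicalSpace X] (h : IsFilterFamily 𝒦) (ho : OrderedBy 𝒦) (ht : t = patch 𝒦) :
    LamSets X = 𝒦 := by
  ext U
  constructor
  · rintro ⟨⟨A, rfl⟩, hA⟩
    rw [h.Gam_eq_hull ho, h.hull_eq_Ici ho] at *
    exact h.mem_of_isClopen_Ici ho ht hA
  · intro hU
    exact ⟨⟨U, by rw [h.Gam_eq_hull ho, hull_eq_self hU]⟩, isClopen_of_mem ht hU⟩

instance : hsFunctor.{u}.EssSurj where
  mem_essImage P := by
    obtain ⟨X, 𝒦, h⟩ := P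
    let t : TopologicalSpace X := patch 𝒦
    let l : CompleteLattice X := h.completeLattice
    have ho : OrderedBy 𝒦 := h.orderedBy
    have hK : LamSets X = 𝒦 := h.LamSets_eq ho rfl
    have hsep : TotallySeparatedSpace X :=
      totallySeparatedSpace_of_clopen (𝒦 := 𝒦) (fun _ hU => isClopen_of_mem rfl hU) h.ext
    exact ⟨{ carrier := X
             compact := h.compactSpace rfl
             t2 := inferInstance
             totallyDisconnected := inferInstance
             generate := by rw [hK]
             meetDense := by
               rintro _ ⟨A, rfl⟩
               rw [h.Gam_eq_hull ho, hK]
               exact ⟨_, fun G hG => hG.1, rfl⟩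
             univ_mem := by rw [hK]; exact h.univ_mem
             bot_mem := by
               rw [h.Gam_eq_hull ho, hK]
               exact h.joinClosed.hull_empty_mem
             inter_mem := by rw [hK]; exact h.inter_mem
             sup_mem := fun U hU V hV => by
               rw [hK] at *
               rw [h.Gam_eq_hull ho]
               exact h.joinClosed.hull_union_mem U hU V hV }, ⟨FSpace.isoOfEq _ _ hK⟩⟩

instance : hsFunctor.{u}.IsEquivalence where

end Hs

/-! ### Celani–González spaces -/

section CG

theorem CG.empty_mem_compls (X : CG.{u}) : (∅ : Set X) ∈ compls X.𝒦 := by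
  rw [compls, Set.mem_ofPred_eq, Set.compl_empty]
  exact X.univ_mem

theorem CG.hull_empty (X : CG.{u}) : hull (compls X.𝒦) ∅ = ∅ := hull_eq_self X.empty_mem_compls

theorem CG.isLatticeFamily (X : CG.{u}) : IsLatticeFamily (compls X.𝒦) where
  univ_mem := by
    rw [compls, Set.mem_ofPred_eq, Set.compl_univ]
    exact X.empty_mem
  inter_mem A hA B hB := by
    rw [compls, Set.mem_ofPred_eq, Set.compl_inter]
    exact X.union_mem _ hA _ hB
  joinClosed :=
    { subset := subset_rfl
      hull_empty_mem := X.hull_empty.symm ▸ X.empty_mem_compls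
      hull_union_mem := by
        intro A hA B hB
        -- Complementation turns the join of `A` and `B` into the union formed in `meet_mem`.
        have h : (hull (compls X.𝒦) (A ∪ B))ᶜ = ⋃₀ {W | W ∈ X.𝒦 ∧ W ⊆ Aᶜ ∩ Bᶜ} := by
          ext x
          constructor
          · intro hx
            by_contra hc
            refine hx fun G hG => by_contra fun hxG => hc ⟨Gᶜ, ⟨hG.1, ?_⟩, hxG⟩
            rw [← Set.compl_union]
            exact Set.compl_subset_compl.2 hG.2
          · rintro ⟨W, ⟨hW, hWAB⟩, hxW⟩ hx
            rw [← Set.compl_union, Set.subset_compl_comm] at hWAB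
            exact hx Wᶜ ⟨by rwa [compls, Set.mem_ofPred_eq, compl_compl], hWAB⟩ hxW
        change (hull (compls X.𝒦) (A ∪ B))ᶜ ∈ X.𝒦
        rw [h]
        exact X.meet_mem _ hA _ hB }

theorem core_mono {X Y : Type*} (R : SetRel X Y) {A B : Set Y} (h : A ⊆ B) :
    R.core A ⊆ R.core B := fun _ hx _ hy => h (hx hy)

/-- The box operator of a morphism, as a bounded lattice homomorphism. -/
def cgMap {X Y : CG.{u}} (S : CGHom X Y) : famObj Y.isLatticeFamily ⟶ famObj X.isLatticeFamily :=
  famHom X.isLatticeFamily Y.isLatticeFamily S.rel.core S.core_mem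
    (Set.eq_univ_of_forall fun _ _ _ => trivial)
    (fun _ _ _ _ => Set.ext fun _ => ⟨fun h => ⟨fun _ hy => (h hy).1, fun _ hy => (h hy).2⟩,
      fun h _ hy => ⟨h.1 hy, h.2 hy⟩⟩)
    (by
      -- The least closed set is `∅`, since the whole space lies in the subbasis; seriality then
      -- preserves it.
      rw [X.hull_empty, Y.hull_empty]
      refine Set.eq_empty_of_forall_notMem fun x hx => ?_
      obtain ⟨y, _, rfl, hy⟩ := S.serial x
      exact hx hy)
    (fun B₁ h₁ B₂ h₂ => Set.Subset.antisymm (S.core_join B₁ h₁ B₂ h₂)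
      (hull_subset (S.core_mem _ (Y.isLatticeFamily.joinClosed.hull_union_mem B₁ h₁ B₂ h₂))
        (Set.union_subset
          (core_mono _ (Set.subset_union_left.trans (subset_hull _ _)))
          (core_mono _ (Set.subset_union_right.trans (subset_hull _ _))))))

/-- The bounded lattice of complements of members of the subbasis. -/
def cgFunctor : CG.{u}ᵒᵖ ⥤ BddLat.{u} where
  obj X := famObj X.unop.isLatticeFamily
  map φ := cgMap φ.unop
  map_id _ := famFun_ext fun U => Subtype.ext (core_specializes U.2)
  map_comp a b := famFun_ext fun U => Subtype.ext (core_CGStar b.unop a.unop U.2)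

instance : cgFunctor.{u}.Faithful where
  map_injective {X Y a b} h := by
    apply Quiver.Hom.unop_inj
    refine CGHom.ext_core fun B hB => ?_
    have h' : famFun (cgMap a.unop) ⟨B, hB⟩ = famFun (cgMap b.unop) ⟨B, hB⟩ :=
      congrArg (fun γ : famObj X.unop.isLatticeFamily ⟶ famObj Y.unop.isLatticeFamily =>
        famFun γ ⟨B, hB⟩) h
    exact congrArg Subtype.val h'

/-- The relation is the largest one allowed by `α`. If `x ∉ α B`, a successor of `x` outside `B` is
needed. The sets `C` with `x ∈ α C` are closed and down-directed and `Bᶜ` is compact; if no such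
point existed, some `C` would lie in `B`, forcing `x ∈ α B`. -/
theorem CG.exists_hom {X Y : CG.{u}} (α : famObj Y.isLatticeFamily ⟶ famObj X.isLatticeFamily) :
    ∃ S : CGHom X Y, ∀ B (hB : B ∈ compls Y.𝒦), S.rel.core B = famFun α ⟨B, hB⟩ := by
  let R : SetRel X Y := {p | ∀ B (hB : B ∈ compls Y.𝒦), p.1 ∈ (famFun α ⟨B, hB⟩ : Set X) → p.2 ∈ B}
  have hsep (x : X) (B) (hB : B ∈ compls Y.𝒦) (hx : x ∉ (famFun α ⟨B, hB⟩ : Set X)) :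
      ∃ y, (x, y) ∈ R ∧ y ∉ B := by
    let ι := {C : compls Y.𝒦 // x ∈ (famFun α C : Set X)}
    have hne : Nonempty ι := ⟨⟨⟨Set.univ, Y.isLatticeFamily.univ_mem⟩, by
      rw [famFun_univ]; trivial⟩⟩
    have hcl (C : ι) : IsClosed C.1.1 := isOpen_compl_iff.1 (Y.compact_open _ C.1.2).2
    have hnon : (Bᶜ ∩ ⋂ C : ι, C.1.1).Nonempty := by
      by_contra hc
      obtain ⟨C, hC⟩ := (Y.compact_open _ hB).1.elim_directed_family_closed (fun C : ι => C.1.1)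
        hcl (Set.not_nonempty_iff_eq_empty.1 hc)
        (fun C D => ⟨⟨⟨C.1.1 ∩ D.1.1, Y.isLatticeFamily.inter_mem _ C.1.2 _ D.1.2⟩, by
          rw [famFun_inter]; exact ⟨C.2, D.2⟩⟩, Set.inter_subset_left, Set.inter_subset_right⟩)
      refine hx (famFun_mono α (U := C.1) (V := ⟨B, hB⟩) (fun y hy => ?_) C.2)
      by_contra hyB
      exact (Set.ext_iff.1 hC y).1 ⟨hyB, hy⟩
    obtain ⟨y, hyB, hy⟩ := hnon
    exact ⟨y, fun C hC hxC => Set.mem_iInter.1 hy ⟨⟨C, hC⟩, hxC⟩, hyB⟩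
  have hcore (B) (hB : B ∈ compls Y.𝒦) : R.core B = famFun α ⟨B, hB⟩ := by
    refine Set.Subset.antisymm (fun x hx => ?_) fun x hx y hy => hy B hB hx
    by_contra hc
    obtain ⟨y, hy, hyB⟩ := hsep x B hB hc
    exact hyB (hx hy)
  refine ⟨⟨R, ?_, ?_, ?_, ?_⟩, hcore⟩
  · intro B hB
    rw [hcore B hB]
    exact Subtype.coe_prop _
  · intro x
    refine Set.Subset.antisymm (fun y hy => ⟨x, rfl, fun B hB hx => ?_⟩) (subset_Del _ _)
    refine hy B ⟨hB, ?_⟩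
    rintro z ⟨_, rfl, hz⟩
    exact hz B hB hx
  · intro x
    have hempty : (famFun α ⟨∅, Y.empty_mem_compls⟩ : Set X) = ∅ := by
      have h := famFun_empty α
      rw [X.hull_empty] at h
      rw [← h]
      exact congrArg (fun U => (famFun α U : Set X)) (Subtype.ext Y.hull_empty.symm)
    obtain ⟨y, hy, -⟩ := hsep x ∅ Y.empty_mem_compls (by rw [hempty]; exact fun h => h)
    exact ⟨y, x, rfl, hy⟩
  · intro B₁ h₁ B₂ h₂
    have h : R.core (hull (compls Y.𝒦) (B₁ ∪ B₂))
        = hull (compls X.𝒦) (famFun α ⟨B₁, h₁⟩ ∪ famFun α ⟨B₂, h₂⟩) := by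
      rw [hcore _ (Y.isLatticeFamily.joinClosed.hull_union_mem B₁ h₁ B₂ h₂)]
      exact famFun_union α ⟨B₁, h₁⟩ ⟨B₂, h₂⟩
    rw [hcore B₁ h₁, hcore B₂ h₂]
    exact h.le

instance : cgFunctor.{u}.Full where
  map_surjective {X Y} α := by
    obtain ⟨S, hS⟩ := CG.exists_hom (X := Y.unop) (Y := X.unop) α
    exact ⟨Quiver.Hom.op (show Y.unop ⟶ X.unop from S),
      famFun_ext fun U => Subtype.ext (hS U.1 U.2)⟩

/-! ### Irreducible filters -/

section Irreducible

variable {A : Type*} [Lattice A] [BoundedOrder A]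

/-- Irreducible filters of a lattice. -/
structure Filt.IsIrreducible (P : Filt A) : Prop where
  bot_notMem : ⊥ ∉ P
  exists_le : ∀ a b, a ∉ P → b ∉ P → ∃ c ∈ P, ∃ d ∉ P, a ⊓ c ≤ d ∧ b ⊓ c ≤ d

/-- Zorn's lemma gives a filter `P` maximal among those extending `F` and avoiding `Z`. Two elements
outside `P` can be pushed below elements of `Z` by meeting with elements of `P`; then `hZ` brings
both below a single element of `Z`, which is outside `P`. -/
theorem Filt.exists_isIrreducible (F : Filt A) {Z : Set A} (hne : Z.Nonempty)
    (hZ : ∀ a ∈ Z, ∀ b ∈ Z, ∃ h ∈ F, ∃ c ∈ Z, a ⊓ h ≤ c ∧ b ⊓ h ≤ c) (hFZ : ∀ z ∈ Z, z ∉ F) :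
    ∃ P : Filt A, P.IsIrreducible ∧ (∀ a ∈ F, a ∈ P) ∧ ∀ z ∈ Z, z ∉ P := by
  obtain ⟨P, hFP, hP⟩ := zorn_le_nonempty₀ {G : Filt A | ∀ z ∈ Z, z ∉ G} (by
    intro c hc hchain G hG
    refine ⟨Filt.mk {a | ∃ H ∈ c, a ∈ H} ⟨G, hG, G.top_mem⟩ ?_ ?_, ?_, ?_⟩
    · rintro a ⟨H, hH, ha⟩ b ⟨H', hH', hb⟩
      obtain h | h := hchain.total hH hH'
      · exact ⟨H', hH', H'.inf_mem (h ha) hb⟩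
      · exact ⟨H, hH, H.inf_mem ha (h hb)⟩
    · rintro a ⟨H, hH, ha⟩ b hab
      exact ⟨H, hH, H.mem_of_le ha hab⟩
    · rintro z hz ⟨H, hH, hzH⟩
      exact hc hH z hz hzH
    · exact fun H hH a ha => ⟨H, hH, ha⟩) F hFZ
  -- Otherwise the filter generated by `P` and `a` would still avoid `Z`, contradicting maximality.
  have hmax (a : A) (ha : a ∉ P) : ∃ p ∈ P, ∃ z ∈ Z, a ⊓ p ≤ z := by
    by_contra! hc
    let G : Filt A := Filt.mk {x | ∃ p ∈ P, a ⊓ p ≤ x} ⟨⊤, P.top_mem, le_top⟩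
      (by
        rintro x ⟨p, hp, hx⟩ y ⟨q, hq, hy⟩
        exact ⟨p ⊓ q, P.inf_mem hp hq, le_inf ((inf_le_inf_left a inf_le_left).trans hx)
          ((inf_le_inf_left a inf_le_right).trans hy)⟩)
      (by
        rintro x ⟨p, hp, hx⟩ y hxy
        exact ⟨p, hp, hx.trans hxy⟩)
    have hPG : P ≤ G := fun x hx => ⟨x, hx, inf_le_right⟩
    have hG : G ∈ {G : Filt A | ∀ z ∈ Z, z ∉ G} := by
      rintro z hz ⟨p, hp, hpz⟩
      exact hc p hp z hz hpz
    have haG : a ∈ G := ⟨⊤, P.top_mem, inf_le_left⟩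
    exact ha (hP.2 hG hPG haG)
  refine ⟨P, ⟨fun hbot => ?_, fun a b ha hb => ?_⟩, fun a ha => hFP ha, hP.1⟩
  · obtain ⟨z, hz⟩ := hne
    exact hP.1 z hz (P.mem_of_le hbot bot_le)
  · obtain ⟨p, hp, z, hz, haz⟩ := hmax a ha
    obtain ⟨q, hq, w, hw, hbw⟩ := hmax b hb
    obtain ⟨h, hh, c, hc, hzc, hwc⟩ := hZ z hz w hw
    refine ⟨p ⊓ q ⊓ h, P.inf_mem (P.inf_mem hp hq) (hFP hh), c, hP.1 c hc, ?_, ?_⟩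
    · refine le_trans (le_inf ?_ (inf_le_right.trans inf_le_right)) hzc
      exact (inf_le_inf_left a (inf_le_left.trans inf_le_left)).trans haz
    · refine le_trans (le_inf ?_ (inf_le_right.trans inf_le_right)) hwc
      exact (inf_le_inf_left b (inf_le_left.trans inf_le_right)).trans hbw

theorem Filt.exists_isIrreducible_notMem (F : Filt A) {b : A} (hb : b ∉ F) :
    ∃ P : Filt A, P.IsIrreducible ∧ (∀ a ∈ F, a ∈ P) ∧ b ∉ P := by
  obtain ⟨P, hP, hFP, hbP⟩ := F.exists_isIrreducible (Z := {b}) (Set.singleton_nonempty b)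
    (by rintro _ rfl _ rfl; exact ⟨⊤, F.top_mem, _, rfl, inf_le_left, inf_le_left⟩)
    (by rintro _ rfl; exact hb)
  exact ⟨P, hP, hFP, hbP b rfl⟩

variable (A) in
/-- The set of irreducible filters. -/
def IrrFilt : Type _ := {P : Filt A // P.IsIrreducible}

/-- The irreducible filters that do not contain a given element. -/
def irrCompl (a : A) : Set (IrrFilt A) := {P | a ∉ P.1}

theorem mem_irrCompl {a : A} {P : IrrFilt A} : P ∈ irrCompl a ↔ a ∉ P.1 := Iff.rfl

theorem irrCompl_subset_iff {a b : A} : irrCompl b ⊆ irrCompl a ↔ a ≤ b := by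
  constructor
  · intro h
    by_contra hab
    obtain ⟨P, hP, haP, hbP⟩ := (Filt.principal a).exists_isIrreducible_notMem (b := b) hab
    exact h (a := ⟨P, hP⟩) hbP (haP a (Filt.mem_principal.2 le_rfl))
  · exact fun hab P hP ha => hP (P.1.mem_of_le ha hab)

theorem irrCompl_union (a b : A) : irrCompl a ∪ irrCompl b = irrCompl (a ⊓ b) := by
  ext P
  rw [Set.mem_union, mem_irrCompl, mem_irrCompl, mem_irrCompl, ← not_and_or, not_iff_not]
  exact ⟨fun h => P.1.inf_mem h.1 h.2, fun h => ⟨P.1.mem_of_le h inf_le_left,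
    P.1.mem_of_le h inf_le_right⟩⟩

theorem irrCompl_top : irrCompl (⊤ : A) = ∅ :=
  Set.eq_empty_of_forall_notMem fun P hP => hP P.1.top_mem

theorem irrCompl_bot : irrCompl (⊥ : A) = Set.univ :=
  Set.eq_univ_of_forall fun P => P.2.bot_notMem

theorem sUnion_irrCompl (a b : A) :
    ⋃₀ {W | W ∈ Set.range irrCompl ∧ W ⊆ irrCompl a ∩ irrCompl b} = irrCompl (a ⊔ b) := by
  refine Set.Subset.antisymm (Set.sUnion_subset ?_) (Set.subset_sUnion_of_mem ⟨⟨_, rfl⟩, ?_⟩)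
  · rintro _ ⟨⟨c, rfl⟩, hc⟩
    rw [Set.subset_inter_iff, irrCompl_subset_iff, irrCompl_subset_iff] at hc
    exact irrCompl_subset_iff.2 (sup_le hc.1 hc.2)
  · rw [Set.subset_inter_iff, irrCompl_subset_iff, irrCompl_subset_iff]
    exact ⟨le_sup_left, le_sup_right⟩

/-- This is the finite subcover condition of Alexander's subbase theorem. The filter generated by
the `b` with `irrCompl b ∈ 𝒬` contains `a`, since an irreducible extension avoiding `a` would be an
uncovered point. So `a` lies above a finite meet of such `b`. -/
theorem exists_finset_cover {a : A} {𝒬 : Set (Set (IrrFilt A))} (h𝒬 : 𝒬 ⊆ Set.range irrCompl)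
    (hcov : irrCompl a ⊆ ⋃₀ 𝒬) : ∃ 𝒬' ⊆ 𝒬, 𝒬'.Finite ∧ irrCompl a ⊆ ⋃₀ 𝒬' := by
  classical
  let G : Filt A := Filt.mk {x | ∃ s : Finset A, (∀ b ∈ s, irrCompl b ∈ 𝒬) ∧ s.inf id ≤ x}
    ⟨∅, by simp, le_top⟩
    (by
      rintro x ⟨s, hs, hx⟩ y ⟨t, ht, hy⟩
      refine ⟨s ∪ t, fun b hb => (Finset.mem_union.1 hb).elim (hs b) (ht b), ?_⟩
      rw [Finset.inf_union]
      exact inf_le_inf hx hy)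
    (by
      rintro x ⟨s, hs, hx⟩ y hxy
      exact ⟨s, hs, hx.trans hxy⟩)
  have haG : a ∈ G := by
    by_contra haG
    obtain ⟨P, hP, hGP, haP⟩ := G.exists_isIrreducible_notMem haG
    obtain ⟨U, hU, hPU⟩ := hcov (a := ⟨P, hP⟩) haP
    obtain ⟨b, rfl⟩ := h𝒬 hU
    exact hPU (hGP b ⟨{b}, by simpa using hU, by simp⟩)
  obtain ⟨s, hs, hsa⟩ := haG
  refine ⟨irrCompl '' (s : Set A), by rintro _ ⟨b, hb, rfl⟩; exact hs b hb,
    s.finite_toSet.image _, fun P hP => ?_⟩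
  by_contra hc
  refine hP (P.1.mem_of_le ?_ hsa)
  refine Finset.inf_induction P.1.top_mem (fun x hx y hy => P.1.inf_mem hx hy) fun b hb => ?_
  by_contra hbP
  exact hc ⟨_, ⟨b, hb, rfl⟩, hbP⟩

/-- Translated to `A`, the family condition is the hypothesis on `Z` in `Filt.exists_isIrreducible`,
with `F` the elements common to all filters in `Y`. The resulting filter extends `F`, so it lies in
`Y` because `Y` is closed. -/
theorem exists_mem_of_isFam (Y : Set (IrrFilt A)) (𝒵 : Set (Set (IrrFilt A)))
    (hY : Del (Set.range irrCompl) Y = Y) (hne : 𝒵.Nonempty)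
    (hfam : IsFam (Set.range irrCompl) Y 𝒵) (h : ∀ B ∈ 𝒵, (Y \ B).Nonempty) :
    (Y ∩ ⋂ B ∈ 𝒵, Bᶜ).Nonempty := by
  let F : Filt A := Filt.mk {a | ∀ P ∈ Y, a ∈ P.1} (fun P _ => P.1.top_mem)
    (fun a ha b hb P hP => P.1.inf_mem (ha P hP) (hb P hP))
    (fun a ha b hab P hP => P.1.mem_of_le (ha P hP) hab)
  have hform (B) (hB : B ∈ compls (Set.range (irrCompl (A := A)))) : ∃ b, B = (irrCompl b)ᶜ := by
    obtain ⟨b, hb⟩ := hB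
    exact ⟨b, by rw [hb, compl_compl]⟩
  have hmem (b : A) : (irrCompl b)ᶜ ∈ compls (Set.range (irrCompl (A := A))) :=
    ⟨b, (compl_compl _).symm⟩
  obtain ⟨P, hP, hFP, hPZ⟩ := F.exists_isIrreducible (Z := {b | (irrCompl b)ᶜ ∈ 𝒵})
    (by
      obtain ⟨B, hB⟩ := hne
      obtain ⟨b, rfl⟩ := hform B (hfam.1 hB)
      exact ⟨b, hB⟩)
    (by
      intro a ha b hb
      obtain ⟨H, hH, C, hC, hYH, hAC, hBC⟩ := hfam.2 _ ha _ hb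
      obtain ⟨h, rfl⟩ := hform H hH
      obtain ⟨c, rfl⟩ := hform C (hfam.1 hC)
      rw [← Set.compl_union, Set.compl_subset_compl, irrCompl_union, irrCompl_subset_iff] at hAC hBC
      exact ⟨h, fun P hP => not_not.1 (hYH hP), c, hC, hAC, hBC⟩)
    (by
      intro z hz hzF
      obtain ⟨P, hP, hPz⟩ := h _ hz
      exact hPz fun hn => hn (hzF P hP))
  refine ⟨⟨P, hP⟩, ?_, ?_⟩
  · rw [← hY]
    rintro B ⟨hB, hYB⟩
    obtain ⟨b, rfl⟩ := hform B hB
    exact fun hn => hn (hFP b fun Q hQ => not_not.1 (hYB hQ))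
  · refine Set.mem_iInter₂.2 fun B hB => ?_
    obtain ⟨b, rfl⟩ := hform B (hfam.1 hB)
    exact not_not.2 (hPZ b hB)

end Irreducible

/-- The Celani–González space of irreducible filters of a bounded lattice. -/
def irrSpace (A : Type u) [Lattice A] [BoundedOrder A] : CG.{u} :=
  letI : TopologicalSpace (IrrFilt A) := TopologicalSpace.generateFrom (Set.range irrCompl)
  { carrier := IrrFilt A
    𝒦 := Set.range irrCompl
    subbasis := rfl
    t0 := ⟨fun P Q hPQ => Subtype.ext (SetLike.ext fun a => not_iff_not.1
      (inseparable_iff_forall_isOpen.1 hPQ (irrCompl a)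
        (TopologicalSpace.isOpen_generateFrom_of_mem ⟨a, rfl⟩)))⟩
    sUnion_eq := Set.eq_univ_of_forall fun P => ⟨_, ⟨⊥, rfl⟩, P.2.bot_notMem⟩
    compact_open := by
      rintro _ ⟨a, rfl⟩
      exact ⟨isCompact_generateFrom rfl fun _ => exists_finset_cover,
        TopologicalSpace.isOpen_generateFrom_of_mem ⟨a, rfl⟩⟩
    empty_mem := ⟨⊤, irrCompl_top⟩
    union_mem := by
      rintro _ ⟨a, rfl⟩ _ ⟨b, rfl⟩
      exact ⟨a ⊓ b, (irrCompl_union a b).symm⟩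
    exists_diff := by
      rintro _ ⟨a, rfl⟩ _ ⟨b, rfl⟩ P ⟨ha, hb⟩
      obtain ⟨c, hc, d, hd, hacd, hbcd⟩ := P.2.exists_le a b ha hb
      refine ⟨_, ⟨c, rfl⟩, _, ⟨d, rfl⟩, ⟨hd, fun hn => hn hc⟩, ?_⟩
      rw [Set.inter_union_distrib_right, irrCompl_union, irrCompl_union]
      exact Set.subset_inter (irrCompl_subset_iff.2 hacd) (irrCompl_subset_iff.2 hbcd)
    fam := exists_mem_of_isFam
    univ_mem := ⟨⊥, irrCompl_bot⟩
    meet_mem := by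
      rintro _ ⟨a, rfl⟩ _ ⟨b, rfl⟩
      exact ⟨a ⊔ b, (sUnion_irrCompl a b).symm⟩ }

/-- A bounded lattice is isomorphic to the lattice of its space of irreducible filters. -/
noncomputable def irrIso (A : Type u) [Lattice A] [BoundedOrder A] :
    A ≃o compls (irrSpace A).𝒦 where
  toEquiv := Equiv.ofBijective (fun a => ⟨(irrCompl a)ᶜ, a, (compl_compl _).symm⟩)
    ⟨fun a b h => by
      have h' : irrCompl a = irrCompl b := compl_injective (congrArg Subtype.val h)
      exact le_antisymm (irrCompl_subset_iff.1 h'.ge) (irrCompl_subset_iff.1 h'.le),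
    by
      rintro ⟨B, a, ha⟩
      exact ⟨a, Subtype.ext ((congrArg compl ha).trans (compl_compl B))⟩⟩
  map_rel_iff' := Set.compl_subset_compl.trans irrCompl_subset_iff

instance : cgFunctor.{u}.EssSurj where
  mem_essImage A :=
    ⟨Opposite.op (irrSpace A), ⟨(famIso (irrSpace A).isLatticeFamily A (irrIso A)).symm⟩⟩

instance : cgFunctor.{u}.IsEquivalence where

end CG

/-! ### Clopen filters of coherent lattices -/

section CohLat

theorem CohLat.CLF_eq (X : CohLat.{u}) : CLF X = compactUps X :=
  X.coherent.isFilterFamily.CLF_eq X.coherent.orderedBy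
    (X.lawson.topology_eq_lawson.trans X.coherent.lawson_eq_patch)

theorem CohLat.isFilterFamily (X : CohLat.{u}) : IsFilterFamily (CLF X) :=
  X.CLF_eq ▸ X.coherent.isFilterFamily

theorem CohLat.orderedBy (X : CohLat.{u}) : OrderedBy (CLF X) :=
  X.CLF_eq ▸ X.coherent.orderedBy

theorem CohLat.top_eq_patch (X : CohLat.{u}) : X.top = patch (CLF X) := by
  rw [X.CLF_eq]
  exact X.lawson.topology_eq_lawson.trans X.coherent.lawson_eq_patch

theorem CohLat.compactSpace (X : CohLat.{u}) : CompactSpace X :=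
  X.isFilterFamily.compactSpace X.top_eq_patch

theorem CohLat.joinClosed (X : CohLat.{u}) : JoinClosed (CLF X) {G : Set X | IsPFilter G} :=
  X.isFilterFamily.joinClosed_isPFilter X.orderedBy

theorem CohLat.clopenFilterJoins (X : CohLat.{u}) : ClopenFilterJoins X :=
  clopenFilterJoins_of_joinClosed X.joinClosed

/-- The inverse image of the upset of `y` is the upset of `l y` for the left adjoint `l`. As joins
of principal filters come from meets of generators, preservation of finite meets by `l` is
preservation of finite joins by the inverse image. -/
theorem IsCohHom.isFamilyMap {X Y : CohLat.{u}} {f : X → Y} (hf : IsCohHom f) :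
    IsFamilyMap (CLF X) (CLF Y) f := by
  obtain ⟨l, hl, hltop, hlinf⟩ := hf.adjoint
  have hpre (y : Y) : f ⁻¹' Set.Ici y = Set.Ici (l y) := Set.ext fun x => (hl y x).symm
  refine ⟨fun U hU => preimage_mem_CLF hf hU, ?_, fun U hU V hV => ?_⟩
  · rw [X.isFilterFamily.hull_eq_Ici X.orderedBy, Y.isFilterFamily.hull_eq_Ici Y.orderedBy,
      sInf_empty, sInf_empty, hpre, hltop]
  · obtain ⟨u, rfl⟩ := Y.isFilterFamily.exists_eq_Ici Y.orderedBy hU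
    obtain ⟨v, rfl⟩ := Y.isFilterFamily.exists_eq_Ici Y.orderedBy hV
    rw [X.isFilterFamily.hull_eq_Ici X.orderedBy, Y.isFilterFamily.hull_eq_Ici Y.orderedBy,
      sInf_union, csInf_Ici, csInf_Ici, hpre, hpre, hpre, sInf_union, csInf_Ici, csInf_Ici, hlinf]

theorem IsCohHom.preservesClopenFilterJoins {X Y : CohLat.{u}} {f : X → Y} (hf : IsCohHom f) :
    PreservesClopenFilterJoins f :=
  fun _ hfin h𝒮 => hf.isFamilyMap.preserves X.joinClosed Y.joinClosed hfin h𝒮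

theorem isCompactElement_orderIso {X Y : Type*} [PartialOrder X] [PartialOrder Y] (e : X ≃o Y)
    {k : X} (hk : IsCompactElement k) : IsCompactElement (e k) := by
  intro s u hs hd hu hku
  obtain ⟨x, hx, hkx⟩ := hk (e ⁻¹' s) (e.symm u)
    (by obtain ⟨y, hy⟩ := hs; exact ⟨e.symm y, by simpa using hy⟩)
    (fun a ha b hb => by
      obtain ⟨c, hc, hac, hbc⟩ := hd _ ha _ hb
      exact ⟨e.symm c, by simpa using hc, (e.le_symm_apply).2 hac, (e.le_symm_apply).2 hbc⟩)
    (by rwa [e.isLUB_preimage, e.apply_symm_apply])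
    ((e.le_symm_apply).2 hku)
  exact ⟨e x, hx, e.le_iff_le.2 hkx⟩

theorem isCohHom_orderIso {X Y : CohLat.{u}} (e : X ≃o Y) : IsCohHom (e : X → Y) where
  continuous := by
    refine continuous_of_isClopen_preimage Y.top_eq_patch fun U hU => ?_
    rw [Y.CLF_eq] at hU
    obtain ⟨k, hk, rfl⟩ := hU
    refine isClopen_of_mem X.top_eq_patch ?_
    rw [X.CLF_eq, e.preimage_Ici]
    exact ⟨_, isCompactElement_orderIso e.symm hk, rfl⟩
  map_top := map_top e
  map_inf := map_inf e
  adjoint := ⟨e.symm, fun _ _ => e.symm_apply_le, map_top e.symm, map_inf e.symm⟩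

end CohLat

/-! ### Relations between coherent lattices -/

section Relation

theorem mem_image_singleton {X Y : Type*} {R : SetRel X Y} {x : X} {y : Y} :
    y ∈ R.image {x} ↔ (x, y) ∈ R :=
  ⟨by rintro ⟨_, rfl, h⟩; exact h, fun h => ⟨x, rfl, h⟩⟩

theorem mem_preimage_singleton {X Y : Type*} {R : SetRel X Y} {x : X} {y : Y} :
    x ∈ R.preimage {y} ↔ (x, y) ∈ R :=
  ⟨by rintro ⟨_, rfl, h⟩; exact h, fun h => ⟨y, rfl, h⟩⟩

/-- The set of points that are not related to any point of `U`. -/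
def polar {X Y : Type*} (R : SetRel X Y) (U : Set X) : Set Y := (R.image U)ᶜ

theorem mem_polar {X Y : Type*} {R : SetRel X Y} {U : Set X} {y : Y} :
    y ∈ polar R U ↔ ∀ x ∈ U, (x, y) ∉ R :=
  ⟨fun h x hx hxy => h ⟨x, hx, hxy⟩, fun h ⟨x, hx, hxy⟩ => h x hx hxy⟩

theorem polar_anti {X Y : Type*} (R : SetRel X Y) {U V : Set X} (h : U ⊆ V) :
    polar R V ⊆ polar R U :=
  fun _ hy => mem_polar.2 fun x hx => mem_polar.1 hy x (h hx)

section

variable {X Y : Type*} [CompleteLattice X] [TopologicalSpace X] [CompleteLattice Y]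
  [TopologicalSpace Y] {R : SetRel X Y}

theorem IsDHRelation.inv (h : IsDHRelation R) : IsDHRelation R.inv where
  image_closed := h.preimage_closed
  image_clopen := h.preimage_clopen
  preimage_closed := h.image_closed
  preimage_clopen := h.image_clopen
  image_compl_filter := h.preimage_compl_filter
  preimage_compl_filter := h.image_compl_filter
  le_of_image := h.le_of_preimage
  le_of_preimage := h.le_of_image

theorem IsDHRelation.not_top_rel (h : IsDHRelation R) (y : Y) : (⊤, y) ∉ R := fun hy =>
  (isPFilter_iff.1 (h.preimage_compl_filter y)).1 (mem_preimage_singleton.2 hy)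

theorem IsDHRelation.rel_of_le (h : IsDHRelation R) {x x' : X} {y : Y} (hx : x' ≤ x)
    (hxy : (x, y) ∈ R) : (x', y) ∈ R := by
  by_contra hc
  exact (isPFilter_iff.1 (h.preimage_compl_filter y)).2.2 x'
    (fun hn => hc (mem_preimage_singleton.1 hn)) x hx (mem_preimage_singleton.2 hxy)

theorem IsDHRelation.rel_or_rel (h : IsDHRelation R) {x x' : X} {y : Y}
    (hxy : (x ⊓ x', y) ∈ R) : (x, y) ∈ R ∨ (x', y) ∈ R := by
  by_contra! hc
  exact (isPFilter_iff.1 (h.preimage_compl_filter y)).2.1 x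
    (fun hn => hc.1 (mem_preimage_singleton.1 hn)) x' (fun hn => hc.2 (mem_preimage_singleton.1 hn))
    (mem_preimage_singleton.2 hxy)

end

variable {X Y : CohLat.{u}} {R : SetRel X Y} (h : IsDHRelation R)

include h

/-- The relation is downward closed in its first argument, so the polar depends only on the
generator `k` of `U` and is the filter complementary to the image of `k`. -/
theorem IsDHRelation.polar_mem {U : Set X} (hU : U ∈ CLF X) : polar R U ∈ CLF Y := by
  refine ⟨(h.image_clopen U hU.1).compl, ?_⟩
  obtain ⟨k, rfl⟩ := X.isFilterFamily.exists_eq_Ici X.orderedBy hU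
  have : polar R (Set.Ici k) = (R.image {k})ᶜ := by
    ext y
    rw [mem_polar, Set.mem_compl_iff, mem_image_singleton]
    exact ⟨fun hy => hy k le_rfl, fun hy x hx hxy => hy (h.rel_of_le hx hxy)⟩
  rw [this]
  exact h.image_compl_filter k

/-- Let `m` generate `V`. If `y` is in the double polar, every `x` related to `y` is related to `m`,
for otherwise `x` would lie in the polar of `V`; `le_of_preimage` then gives `m ≤ y`. -/
theorem IsDHRelation.polar_polar {V : Set Y} (hV : V ∈ CLF Y) : polar R (polar R.inv V) = V := by
  obtain ⟨m, rfl⟩ := Y.isFilterFamily.exists_eq_Ici Y.orderedBy hV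
  ext y
  rw [mem_polar]
  refine ⟨fun hy => h.le_of_preimage y m fun x hx => ?_, fun hy x hx => mem_polar.1 hx y hy⟩
  by_contra hc
  refine hy x (mem_polar.2 fun z hz hzx => hc ?_) (mem_preimage_singleton.1 hx)
  exact mem_preimage_singleton.2 (h.inv.rel_of_le hz hzx)

theorem IsDHRelation.polar_subset_polar {U V : Set X} (hU : U ∈ CLF X) (hV : V ∈ CLF X) :
    polar R U ⊆ polar R V ↔ V ⊆ U := by
  refine ⟨fun hUV => ?_, polar_anti R⟩
  rw [← h.inv.polar_polar hU, ← h.inv.polar_polar hV]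
  exact polar_anti R.inv hUV

theorem IsDHRelation.polar_filterGen_union {U V : Set X} (hU : U ∈ CLF X) (hV : V ∈ CLF X) :
    polar R (filterGen (U ∪ V)) = polar R U ∩ polar R V := by
  refine Set.Subset.antisymm (Set.subset_inter
    (polar_anti R (Set.subset_union_left.trans (subset_filterGen _)))
    (polar_anti R (Set.subset_union_right.trans (subset_filterGen _)))) ?_
  rintro y ⟨hyU, hyV⟩
  refine mem_polar.2 fun x hx hxy => ?_
  obtain ⟨u, hu, v, hv, huv⟩ := (mem_filterGen_union hU.2 hV.2).1 hx
  obtain h' | h' := h.rel_or_rel (h.rel_of_le huv hxy)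
  · exact mem_polar.1 hyU u hu h'
  · exact mem_polar.1 hyV v hv h'

theorem IsDHRelation.polar_filterGen_empty : polar R (filterGen ∅) = Set.univ := by
  rw [filterGen_empty]
  refine Set.eq_univ_of_forall fun y => mem_polar.2 ?_
  rintro _ rfl
  exact h.not_top_rel y

/-- If `x` is not related to `y`, the upset of `x` lies in the open set of points not related to
`y`. By compactness a clopen filter around `x` does too, and its polar contains `y`. -/
theorem IsDHRelation.rel_iff {x : X} {y : Y} :
    (x, y) ∈ R ↔ ∀ U ∈ CLF X, x ∈ U → y ∉ polar R U := by
  refine ⟨fun hxy U _ hx hy => mem_polar.1 hy x hx hxy, fun hxy => ?_⟩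
  by_contra hc
  have := X.compactSpace
  obtain ⟨V, hV, hxV, hVy⟩ := exists_mem_subset_of_isOpen X.isFilterFamily.toIsLatticeFamily
    (fun _ hU => hU.1) (h.preimage_closed y).isOpen_compl (x := x) (fun z hz hzy =>
      hc (h.rel_of_le ((X.orderedBy x z).2 hz) (mem_preimage_singleton.1 hzy)))
  exact hxy V hV hxV (mem_polar.2 fun z hz hzy => hVy hz (mem_preimage_singleton.2 hzy))

end Relation

/-! ### Isomorphisms of Dunn–Hartonas spaces -/

/-- Order isomorphisms that preserve and reflect the relation form an isomorphism. -/
def DH.isoMk {D E : DH.{u}} (e : D.X ≃o E.X) (e' : D.Y ≃o E.Y)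
    (h : ∀ x y, (x, y) ∈ D.R ↔ (e x, e' y) ∈ E.R) : D ≅ E where
  hom := (⟨e, e', isCohHom_orderIso e, isCohHom_orderIso e', fun x y => (h x y).1,
    fun x' y hxy => ⟨e.symm x', by rw [h, e.apply_symm_apply]; exact hxy,
      (e.apply_symm_apply x').ge⟩,
    fun x y' hxy => ⟨e'.symm y', by rw [h, e'.apply_symm_apply]; exact hxy,
      (e'.apply_symm_apply y').ge⟩⟩ : DHHom D E)
  inv := (⟨e.symm, e'.symm, isCohHom_orderIso e.symm, isCohHom_orderIso e'.symm,
    fun x y hxy => by rw [h, e.apply_symm_apply, e'.apply_symm_apply]; exact hxy,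
    fun x' y hxy => ⟨e x', by rw [h, e'.apply_symm_apply] at hxy; exact hxy,
      (e.symm_apply_apply x').ge⟩,
    fun x y' hxy => ⟨e' y', by rw [h, e.apply_symm_apply] at hxy; exact hxy,
      (e'.symm_apply_apply y').ge⟩⟩ : DHHom E D)
  hom_inv_id := DHHom.ext (funext e.symm_apply_apply) (funext e'.symm_apply_apply)
  inv_hom_id := DHHom.ext (funext e.apply_symm_apply) (funext e'.apply_symm_apply)

/-! ### The space of filters and ideals -/

section FiltIdl

variable (A : Type*) [Lattice A] [BoundedOrder A]

theorem orderedBy_filtSets : OrderedBy (filtSets A) := fun F G =>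
  ⟨by rintro h _ ⟨a, rfl⟩ ha; exact h ha, fun h a ha => h _ ⟨a, rfl⟩ ha⟩

theorem orderedBy_idlSets : OrderedBy (idlSets A) := fun F G =>
  ⟨by rintro h _ ⟨a, rfl⟩ ha; exact h ha, fun h a ha => h _ ⟨a, rfl⟩ ha⟩

theorem isCoherent_filt : IsCoherent (Filt A) :=
  (isFilterFamily_filtSets A).isCoherent (orderedBy_filtSets A)

theorem isCoherent_idl : IsCoherent (Idl A) :=
  (isFilterFamily_idlSets A).isCoherent (orderedBy_idlSets A)

theorem filt_top_eq_patch :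
    (inferInstance : TopologicalSpace (Filt A)) = patch (filtSets A) :=
  (isFilterFamily_filtSets A).lawson_eq_patch (orderedBy_filtSets A)

theorem idl_top_eq_patch :
    (inferInstance : TopologicalSpace (Idl A)) = patch (idlSets A) :=
  (isFilterFamily_idlSets A).lawson_eq_patch (orderedBy_idlSets A)

theorem CLF_filt : CLF (Filt A) = filtSets A :=
  (isFilterFamily_filtSets A).CLF_eq (orderedBy_filtSets A) (filt_top_eq_patch A)

variable {A}

theorem isClopen_filtSet (a : A) : IsClopen {F : Filt A | a ∈ F} :=
  isClopen_of_mem (filt_top_eq_patch A) ⟨a, rfl⟩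

theorem isClopen_idlSet (a : A) : IsClopen {I : Idl A | a ∈ I} :=
  isClopen_of_mem (idl_top_eq_patch A) ⟨a, rfl⟩

theorem Filt.mem_inf {F G : Filt A} {a : A} : a ∈ F ⊓ G ↔ a ∈ F ∧ a ∈ G :=
  (isFilterFamily_filtSets A).inf_mem_iff (orderedBy_filtSets A) ⟨a, rfl⟩

theorem Filt.mem_top (a : A) : a ∈ (⊤ : Filt A) :=
  (isFilterFamily_filtSets A).top_mem (orderedBy_filtSets A) ⟨a, rfl⟩

theorem Idl.mem_inf {I J : Idl A} {a : A} : a ∈ I ⊓ J ↔ a ∈ I ∧ a ∈ J :=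
  (isFilterFamily_idlSets A).inf_mem_iff (orderedBy_idlSets A) ⟨a, rfl⟩

theorem Idl.mem_top (a : A) : a ∈ (⊤ : Idl A) :=
  (isFilterFamily_idlSets A).top_mem (orderedBy_idlSets A) ⟨a, rfl⟩

theorem mem_disjRel {F : Filt A} {I : Idl A} : (F, I) ∈ disjRel A ↔ ∀ a ∈ F, a ∉ I :=
  ⟨fun h a ha hI => (Set.ext_iff.1 h a).1 ⟨ha, hI⟩,
    fun h => Set.eq_empty_of_forall_notMem fun a ha => h a ha.1 ha.2⟩

/-- A nonempty basic set `V \ ⋃₀ 𝒮` contains the least point of `V`, which is related to everything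
related to a point of `V`. Hence it has the same image as `V`, and by compactness finitely many such
sets cover `O`. -/
theorem isClopen_image_of_patch {X Y : Type*} [t : TopologicalSpace X] [TopologicalSpace Y]
    {𝒦 : Set (Set X)} (h : IsFilterFamily 𝒦) (ht : t = patch 𝒦) {R : SetRel X Y}
    (hanti : ∀ x x' y, (∀ U ∈ 𝒦, x ∈ U → x' ∈ U) → (x', y) ∈ R → (x, y) ∈ R)
    (hR : ∀ U ∈ 𝒦, IsClopen (R.image U)) {O : Set X} (hO : IsClopen O) :
    IsClopen (R.image O) := by
  have := h.compactSpace ht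
  have hex (x) (hx : x ∈ O) : ∃ N, IsOpen N ∧ x ∈ N ∧ N ⊆ O ∧ IsClopen (R.image N) := by
    obtain ⟨V, hV, 𝒮, h𝒮, hfin, hxV, hx𝒮, hsub⟩ :=
      exists_basic_subset h.toIsLatticeFamily ht hO.isOpen x hx
    refine ⟨V \ ⋃₀ 𝒮, ?_, ⟨hxV, hx𝒮⟩, hsub, ?_⟩
    · exact (isClopen_of_mem ht hV).isOpen.sdiff
        (by
          rw [Set.sUnion_eq_biUnion]
          exact hfin.isClosed_biUnion fun W hW => (isClopen_of_mem ht (h𝒮 hW)).isClosed)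
    · obtain ⟨v, hv, hmin⟩ := h.exists_least hV
      have : R.image (V \ ⋃₀ 𝒮) = R.image V := by
        refine Set.Subset.antisymm (fun y ⟨z, hz, hzy⟩ => ⟨z, hz.1, hzy⟩) ?_
        rintro y ⟨z, hz, hzy⟩
        refine ⟨v, ⟨hv, ?_⟩, hanti v z y (fun U hU hvU => hmin U hU hvU hz) hzy⟩
        rintro ⟨W, hW, hvW⟩
        exact hx𝒮 ⟨W, hW, hmin W (h𝒮 hW) hvW hxV⟩
      rw [this]
      exact hR V hV
  choose! N hN hxN hNO hRN using hex
  obtain ⟨s, hs, hcov⟩ := hO.isClosed.isCompact.elim_nhds_subcover N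
    fun x hx => (hN x hx).mem_nhds (hxN x hx)
  have : R.image O = ⋃ x ∈ s, R.image (N x) := by
    refine Set.Subset.antisymm ?_ (Set.iUnion₂_subset fun x hx => ?_)
    · rintro y ⟨z, hz, hzy⟩
      obtain ⟨x, hx, hzx⟩ := Set.mem_iUnion₂.1 (hcov hz)
      exact Set.mem_iUnion₂.2 ⟨x, hx, z, hzx, hzy⟩
    · rintro y ⟨z, hz, hzy⟩
      exact ⟨z, hNO x (hs x hx) hz, hzy⟩
  rw [this]
  exact s.finite_toSet.isClopen_biUnion fun x hx => hRN x (hs x hx)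

variable (A)

/-- Principal filters and ideals serve as test points: the image of `{F | a ∈ F}` is the set of
ideals missing `a`, witnessed by the principal filter of `a`, and both order conditions are tested
in the same way. -/
theorem isDHRelation_disjRel : IsDHRelation (disjRel A) where
  image_closed F := by
    have : (disjRel A).image {F} = ⋂ a ∈ F, {I : Idl A | a ∈ I}ᶜ := by
      ext I
      rw [mem_image_singleton, mem_disjRel, Set.mem_iInter₂]
      rfl
    rw [this]
    exact isClosed_biInter fun a _ => (isClopen_idlSet a).compl.isClosed
  image_clopen U hU := by
    refine isClopen_image_of_patch (isFilterFamily_filtSets A) (filt_top_eq_patch A) ?_ ?_ hU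
    · intro F G I hFG hGI
      rw [mem_disjRel] at *
      exact fun a ha => hGI a (hFG _ ⟨a, rfl⟩ ha)
    · rintro _ ⟨a, rfl⟩
      have : (disjRel A).image {F | a ∈ F} = {I : Idl A | a ∈ I}ᶜ := by
        ext I
        refine ⟨fun ⟨F, hF, hFI⟩ => mem_disjRel.1 hFI a hF, fun hI => ?_⟩
        exact ⟨Filt.principal a, Filt.mem_principal.2 le_rfl,
          mem_disjRel.2 fun b hb hbI => hI (I.mem_of_le hbI hb)⟩
      rw [this]
      exact (isClopen_idlSet a).compl
  preimage_closed I := by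
    have : (disjRel A).preimage {I} = ⋂ a ∈ I, {F : Filt A | a ∈ F}ᶜ := by
      ext F
      rw [mem_preimage_singleton, mem_disjRel, Set.mem_iInter₂]
      exact forall_congr' fun a => ⟨fun h h1 h2 => h h2 h1, fun h h1 h2 => h h2 h1⟩
    rw [this]
    exact isClosed_biInter fun a _ => (isClopen_filtSet a).compl.isClosed
  preimage_clopen V hV := by
    refine isClopen_image_of_patch (R := (disjRel A).inv) (isFilterFamily_idlSets A)
      (idl_top_eq_patch A) ?_ ?_ hV
    · intro I J F hIJ hJF
      have hJF' := mem_disjRel.1 hJF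
      exact mem_disjRel.2 fun a ha haI => hJF' a ha (hIJ _ ⟨a, rfl⟩ haI)
    · rintro _ ⟨a, rfl⟩
      have : (disjRel A).inv.image {I | a ∈ I} = {F : Filt A | a ∈ F}ᶜ := by
        ext F
        refine ⟨fun ⟨I, hI, hFI⟩ hF => mem_disjRel.1 hFI a hF hI, fun hF => ?_⟩
        exact ⟨Idl.principal a, Idl.mem_principal.2 le_rfl,
          mem_disjRel.2 fun b hb hba => hF (F.mem_of_le hb hba)⟩
      rw [this]
      exact (isClopen_filtSet a).compl
  image_compl_filter F := by
    have : ((disjRel A).image {F})ᶜ = {I : Idl A | ∃ a ∈ F, a ∈ I} := by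
      ext I
      rw [Set.mem_compl_iff, mem_image_singleton, mem_disjRel]
      push Not
      rfl
    rw [this, isPFilter_iff]
    refine ⟨⟨⊤, F.top_mem, Idl.mem_top _⟩, ?_, ?_⟩
    · rintro I ⟨a, ha, haI⟩ J ⟨b, hb, hbJ⟩
      exact ⟨a ⊓ b, F.inf_mem ha hb, Idl.mem_inf.2
        ⟨I.mem_of_le haI inf_le_left, J.mem_of_le hbJ inf_le_right⟩⟩
    · rintro I ⟨a, ha, haI⟩ J hIJ
      exact ⟨a, ha, hIJ haI⟩
  preimage_compl_filter I := by
    have : ((disjRel A).preimage {I})ᶜ = {F : Filt A | ∃ a ∈ F, a ∈ I} := by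
      ext F
      rw [Set.mem_compl_iff, mem_preimage_singleton, mem_disjRel]
      push Not
      rfl
    rw [this, isPFilter_iff]
    refine ⟨⟨⊥, Filt.mem_top _, I.bot_mem⟩, ?_, ?_⟩
    · rintro F ⟨a, ha, haI⟩ G ⟨b, hb, hbI⟩
      exact ⟨a ⊔ b, Filt.mem_inf.2 ⟨F.mem_of_le ha le_sup_left, G.mem_of_le hb le_sup_right⟩,
        I.sup_mem haI hbI⟩
    · rintro F ⟨a, ha, haI⟩ G hFG
      exact ⟨a, hFG ha, haI⟩
  le_of_image F G h a haG := by
    by_contra haF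
    have hF : Idl.principal a ∈ (disjRel A).image {F} :=
      mem_image_singleton.2 (mem_disjRel.2 fun b hb hba => haF (F.mem_of_le hb hba))
    exact mem_disjRel.1 (mem_image_singleton.1 (h hF)) a haG (Idl.mem_principal.2 le_rfl)
  le_of_preimage I J h a haJ := by
    by_contra haI
    have hI : Filt.principal a ∈ (disjRel A).preimage {I} :=
      mem_preimage_singleton.2 (mem_disjRel.2 fun b hb hbI => haI (I.mem_of_le hbI hb))
    exact mem_disjRel.1 (mem_preimage_singleton.1 (h hI)) a (Filt.mem_principal.2 le_rfl) haJ

/-! ### Inverse images of filters and ideals, and their left adjoints. -/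

variable {A} {B : Type*} [Lattice B] [BoundedOrder B] (α : BoundedLatticeHom A B)

/-- The filter generated by the image of a filter. -/
def filtMap (F : Filt A) : Filt B :=
  Filt.mk {b | ∃ a ∈ F, α a ≤ b} ⟨⊤, F.top_mem, le_top⟩
    (by
      rintro b ⟨a, ha, hab⟩ b' ⟨a', ha', hab'⟩
      refine ⟨a ⊓ a', F.inf_mem ha ha', ?_⟩
      rw [map_inf]
      exact inf_le_inf hab hab')
    (by
      rintro b ⟨a, ha, hab⟩ c hbc
      exact ⟨a, ha, hab.trans hbc⟩)

/-- The ideal generated by the image of an ideal. -/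
def idlMap (I : Idl A) : Idl B :=
  Idl.mk {b | ∃ a ∈ I, b ≤ α a} ⟨⊥, I.bot_mem, bot_le⟩
    (by
      rintro b ⟨a, ha, hab⟩ b' ⟨a', ha', hab'⟩
      refine ⟨a ⊔ a', I.sup_mem ha ha', ?_⟩
      rw [map_sup]
      exact sup_le_sup hab hab')
    (by
      rintro b ⟨a, ha, hab⟩ c hbc
      exact ⟨a, ha, hbc.trans hab⟩)

theorem mem_filtMap {F : Filt A} {b : B} : b ∈ filtMap α F ↔ ∃ a ∈ F, α a ≤ b := Iff.rfl

theorem mem_idlMap {I : Idl A} {b : B} : b ∈ idlMap α I ↔ ∃ a ∈ I, b ≤ α a := Iff.rfl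

theorem mem_filtComap {F : Filt B} {a : A} : a ∈ filtComap α F ↔ α a ∈ F := Iff.rfl

theorem mem_idlComap {I : Idl B} {a : A} : a ∈ idlComap α I ↔ α a ∈ I := Iff.rfl

theorem filtMap_gc : GaloisConnection (filtMap α) (filtComap α) := fun F G =>
  ⟨fun h a ha => h (show α a ∈ filtMap α F from ⟨a, ha, le_rfl⟩), by
    rintro h b ⟨a, ha, hab⟩
    exact G.mem_of_le (h ha) hab⟩

theorem idlMap_gc : GaloisConnection (idlMap α) (idlComap α) := fun F G =>
  ⟨fun h a ha => h (show α a ∈ idlMap α F from ⟨a, ha, le_rfl⟩), by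
    rintro h b ⟨a, ha, hab⟩
    exact G.mem_of_le (h ha) hab⟩

/-- The left adjoint preserves binary meets because `α` preserves joins: if `α a ≤ b` and `α a' ≤ b`
with `a ∈ F` and `a' ∈ G`, then `a ⊔ a'` lies in both filters and `α (a ⊔ a') ≤ b`. It preserves the
top filter because `α ⊥ = ⊥`. -/
theorem isCohHom_filtComap : IsCohHom (filtComap α) where
  continuous := by
    refine continuous_of_isClopen_preimage (filt_top_eq_patch A) ?_
    rintro _ ⟨a, rfl⟩
    exact isClopen_filtSet (α a)
  map_top := SetLike.ext fun a => ⟨fun _ => Filt.mem_top a, fun _ => Filt.mem_top (α a)⟩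
  map_inf F G := SetLike.ext fun a => by
    rw [Filt.mem_inf, mem_filtComap, Filt.mem_inf]
    rfl
  adjoint := by
    refine ⟨filtMap α, filtMap_gc α, SetLike.ext fun b => ⟨fun _ => Filt.mem_top b, fun _ => ?_⟩,
      fun F G => SetLike.ext fun b => ?_⟩
    · exact ⟨⊥, Filt.mem_top _, by rw [map_bot]; exact bot_le⟩
    · rw [Filt.mem_inf, mem_filtMap, mem_filtMap, mem_filtMap]
      constructor
      · rintro ⟨a, ha, hab⟩
        rw [Filt.mem_inf] at ha
        exact ⟨⟨a, ha.1, hab⟩, ⟨a, ha.2, hab⟩⟩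
      · rintro ⟨⟨a, ha, hab⟩, ⟨a', ha', hab'⟩⟩
        refine ⟨a ⊔ a', Filt.mem_inf.2 ⟨F.mem_of_le ha le_sup_left,
          G.mem_of_le ha' le_sup_right⟩, ?_⟩
        rw [map_sup]
        exact sup_le hab hab'

theorem isCohHom_idlComap : IsCohHom (idlComap α) where
  continuous := by
    refine continuous_of_isClopen_preimage (idl_top_eq_patch A) ?_
    rintro _ ⟨a, rfl⟩
    exact isClopen_idlSet (α a)
  map_top := SetLike.ext fun a => ⟨fun _ => Idl.mem_top a, fun _ => Idl.mem_top (α a)⟩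
  map_inf F G := SetLike.ext fun a => by
    rw [Idl.mem_inf, mem_idlComap, Idl.mem_inf]
    rfl
  adjoint := by
    refine ⟨idlMap α, idlMap_gc α, SetLike.ext fun b => ⟨fun _ => Idl.mem_top b, fun _ => ?_⟩,
      fun F G => SetLike.ext fun b => ?_⟩
    · exact ⟨⊤, Idl.mem_top _, by rw [map_top]; exact le_top⟩
    · rw [Idl.mem_inf, mem_idlMap, mem_idlMap, mem_idlMap]
      constructor
      · rintro ⟨a, ha, hab⟩
        rw [Idl.mem_inf] at ha
        exact ⟨⟨a, ha.1, hab⟩, ⟨a, ha.2, hab⟩⟩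
      · rintro ⟨⟨a, ha, hab⟩, ⟨a', ha', hab'⟩⟩
        refine ⟨a ⊓ a', Idl.mem_inf.2 ⟨F.mem_of_le ha inf_le_left,
          G.mem_of_le ha' inf_le_right⟩, ?_⟩
        rw [map_inf]
        exact le_inf hab hab'

/-- The left adjoints provide the lifts: the filter generated by the image of `F` stays disjoint
from `I` when `F` is disjoint from the inverse image of `I`, and dually for ideals. -/
theorem isDHMorphism_comap :
    IsDHMorphism (disjRel B) (disjRel A) (filtComap α) (idlComap α) where
  left := isCohHom_filtComap α
  right := isCohHom_idlComap α
  map_rel F I h := mem_disjRel.2 fun a ha haI => mem_disjRel.1 h (α a) ha haI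
  lift_left F I h := by
    refine ⟨filtMap α F, mem_disjRel.2 ?_, (filtMap_gc α).le_u_l F⟩
    rintro b ⟨a, ha, hab⟩ hb
    exact mem_disjRel.1 h a ha (I.mem_of_le hb hab)
  lift_right F I h := by
    refine ⟨idlMap α I, mem_disjRel.2 ?_, (idlMap_gc α).le_u_l I⟩
    rintro b hb ⟨a, ha, hab⟩
    exact mem_disjRel.1 h a (F.mem_of_le hb hab) ha

end FiltIdl

/-! ### The duality between Dunn–Hartonas spaces and bounded lattices -/

section Duality

theorem DH.clopenFilterJoins (D : DH.{u}) : ClopenFilterJoins D.X := D.X.clopenFilterJoins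

theorem DHHom.preservesClopenFilterJoins (D E : DH.{u}) (φ : D ⟶ E) :
    PreservesClopenFilterJoins (DHHom.f φ) :=
  IsCohHom.preservesClopenFilterJoins (DHHom.isDHMorphism φ).left

/-- The bounded lattice of a Dunn–Hartonas space. -/
abbrev DH.lattice (D : DH.{u}) : BddLat.{u} := clfObj D.clopenFilterJoins

/-- The Dunn–Hartonas space of a bounded lattice. -/
noncomputable abbrev dhSpace (A : BddLat.{u}) : DH.{u} :=
  filtIdlObj A (isCoherent_filt A) (isCoherent_idl A) (isDHRelation_disjRel A)

/-! ### Points of a Dunn–Hartonas space as filters and ideals of its lattice. -/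

section Unit

variable (D : DH.{u})

/-- The clopen filter underlying an element of the lattice. -/
def DH.toSet (U : D.lattice) : Set D.X := Subtype.val (show CLF D.X from U)

theorem DH.toSet_mem (U : D.lattice) : D.toSet U ∈ CLF D.X :=
  Subtype.prop (show CLF D.X from U)

/-- The element of the lattice given by a clopen filter. -/
def DH.ofSet {U : Set D.X} (hU : U ∈ CLF D.X) : D.lattice := (⟨U, hU⟩ : CLF D.X)

theorem DH.toSet_subset {U V : D.lattice} : D.toSet U ⊆ D.toSet V ↔ U ≤ V := Iff.rfl

theorem DH.toSet_sup (U V : D.lattice) :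
    D.toSet (U ⊔ V) = filterGen (D.toSet U ∪ D.toSet V) := by
  rw [← Set.sUnion_pair]
  rfl

theorem DH.toSet_bot : D.toSet ⊥ = filterGen ∅ := by
  rw [← Set.sUnion_empty]
  rfl

/-- The filter of clopen filters that contain a point. -/
def DH.pointFilter (x : D.X) : Filt D.lattice :=
  Filt.mk {U | x ∈ D.toSet U} (show x ∈ Set.univ from trivial) (fun _ ha _ hb => ⟨ha, hb⟩)
    (fun _ ha _ hab => hab ha)

theorem DH.mem_pointFilter {x : D.X} {U : D.lattice} : U ∈ D.pointFilter x ↔ x ∈ D.toSet U :=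
  Iff.rfl

/-- The ideal of clopen filters whose polar contains a point. -/
def DH.pointIdeal (y : D.Y) : Idl D.lattice :=
  Idl.mk {U | y ∈ polar D.R (D.toSet U)}
    (by
      rw [Set.mem_ofPred_eq, D.toSet_bot, D.isDHRelation.polar_filterGen_empty]
      trivial)
    (fun U hU V hV => by
      rw [Set.mem_ofPred_eq, D.toSet_sup,
        D.isDHRelation.polar_filterGen_union (D.toSet_mem U) (D.toSet_mem V)]
      exact ⟨hU, hV⟩)
    (fun _ hU _ hVU => polar_anti D.R (D.toSet_subset.2 hVU) hU)

theorem DH.mem_pointIdeal {y : D.Y} {U : D.lattice} :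
    U ∈ D.pointIdeal y ↔ y ∈ polar D.R (D.toSet U) := Iff.rfl

theorem DH.pointFilter_le_iff {x x' : D.X} : D.pointFilter x ≤ D.pointFilter x' ↔ x ≤ x' := by
  rw [D.X.orderedBy]
  exact ⟨fun h U hU hx => h (show D.ofSet hU ∈ D.pointFilter x from hx),
    fun h U hU => h _ (D.toSet_mem U) hU⟩

theorem DH.pointFilter_surjective : Function.Surjective D.pointFilter := by
  intro F
  obtain ⟨x, hx⟩ := D.X.isFilterFamily.exists_point {U | ∃ hU : U ∈ CLF D.X, D.ofSet hU ∈ F}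
    (fun U hU => hU.1) ⟨D.X.isFilterFamily.univ_mem, F.top_mem⟩
    (fun U hU V hV => ⟨D.X.isFilterFamily.inter_mem U hU.1 V hV.1, F.inf_mem hU.2 hV.2⟩)
    (fun U hU V hV hUV => ⟨hV, F.mem_of_le hU.2 hUV⟩)
  refine ⟨x, SetLike.ext fun U => ?_⟩
  rw [D.mem_pointFilter, hx _ (D.toSet_mem U)]
  exact ⟨fun h => h.2, fun h => ⟨D.toSet_mem U, h⟩⟩

/-- Every clopen filter of `D.Y` is a polar, so the ideals of points see all of them and hence the
order. -/
theorem DH.pointIdeal_le_iff {y y' : D.Y} : D.pointIdeal y ≤ D.pointIdeal y' ↔ y ≤ y' := by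
  rw [D.Y.orderedBy]
  refine ⟨fun h V hV hy => ?_, fun h U hU => h _ (D.isDHRelation.polar_mem (D.toSet_mem U)) hU⟩
  rw [← D.isDHRelation.polar_polar hV] at hy ⊢
  exact h (show D.ofSet (D.isDHRelation.inv.polar_mem hV) ∈ D.pointIdeal y from hy)

/-- Polars reverse the order, so an ideal of clopen filters of `D.X` becomes a filter of clopen
filters of `D.Y`, whose point is the one sought. -/
theorem DH.pointIdeal_surjective : Function.Surjective D.pointIdeal := by
  intro I
  have hR := D.isDHRelation
  obtain ⟨y, hy⟩ := D.Y.isFilterFamily.exists_point {V | ∃ U ∈ I, V = polar D.R (D.toSet U)}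
    (by
      rintro _ ⟨U, -, rfl⟩
      exact hR.polar_mem (D.toSet_mem U))
    ⟨⊥, I.bot_mem, by rw [D.toSet_bot, hR.polar_filterGen_empty]⟩
    (by
      rintro _ ⟨U, hU, rfl⟩ _ ⟨V, hV, rfl⟩
      refine ⟨U ⊔ V, I.sup_mem hU hV, ?_⟩
      rw [D.toSet_sup, hR.polar_filterGen_union (D.toSet_mem U) (D.toSet_mem V)])
    (by
      rintro _ ⟨U, hU, rfl⟩ V hV hUV
      refine ⟨D.ofSet (hR.inv.polar_mem hV), I.mem_of_le hU (D.toSet_subset.1 ?_),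
        (hR.polar_polar hV).symm⟩
      rw [← hR.polar_subset_polar (D.toSet_mem _) (D.toSet_mem _)]
      exact hUV.trans (hR.polar_polar hV).ge)
  refine ⟨y, SetLike.ext fun U => ?_⟩
  rw [D.mem_pointIdeal, hy _ (hR.polar_mem (D.toSet_mem U))]
  refine ⟨?_, fun hU => ⟨U, hU, rfl⟩⟩
  rintro ⟨V, hV, hUV⟩
  exact I.mem_of_le hV
    (D.toSet_subset.1 ((hR.polar_subset_polar (D.toSet_mem V) (D.toSet_mem U)).1 hUV.ge))

theorem DH.rel_iff_disjRel (x : D.X) (y : D.Y) :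
    (x, y) ∈ D.R ↔ (D.pointFilter x, D.pointIdeal y) ∈ disjRel D.lattice := by
  rw [D.isDHRelation.rel_iff, mem_disjRel]
  exact ⟨fun h U => h _ (D.toSet_mem U), fun h U hU => h (D.ofSet hU)⟩

/-- A Dunn–Hartonas space is isomorphic to the space of its lattice of clopen filters. -/
noncomputable def DH.unitIso : D ≅ dhSpace D.lattice :=
  DH.isoMk (D := D) (E := dhSpace D.lattice)
    (RelIso.ofSurjective (OrderEmbedding.ofMapLEIff D.pointFilter fun _ _ => D.pointFilter_le_iff)
      D.pointFilter_surjective)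
    (RelIso.ofSurjective (OrderEmbedding.ofMapLEIff D.pointIdeal fun _ _ => D.pointIdeal_le_iff)
      D.pointIdeal_surjective) D.rel_iff_disjRel

end Unit

/-- The functor of clopen filters. -/
abbrev dhToLat : DH.{u}ᵒᵖ ⥤ BddLat.{u} :=
  clfFunctor DH.clopenFilterJoins DHHom.preservesClopenFilterJoins

/-- The functor of filters and ideals. -/
noncomputable abbrev latToDH : BddLat.{u} ⥤ DH.{u}ᵒᵖ :=
  filtIdlFunctor (fun A => isCoherent_filt A) (fun A => isCoherent_idl A)
    (fun A => isDHRelation_disjRel A) (fun _ _ α => isDHMorphism_comap α.hom)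

/-- The ideal of `y` sees `y` only through the relation, so polars are compared: `map_rel` gives one
direction and `lift_left` the other. The inequality `x' ≤ f x` suffices there because `U` is an
upset. -/
theorem DH.pointIdeal_naturality {D E : DH.{u}} (φ : D ⟶ E) (y : D.Y) :
    idlComap (dhToLat.map φ.op).hom (D.pointIdeal y) = E.pointIdeal (DHHom.g φ y) := by
  have hφ := DHHom.isDHMorphism φ
  refine SetLike.ext fun (U : E.lattice) => ?_
  change y ∈ polar D.R (DHHom.f φ ⁻¹' E.toSet U) ↔ DHHom.g φ y ∈ polar E.R (E.toSet U)
  rw [mem_polar, mem_polar]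
  constructor
  · intro h x' hx' hxy
    obtain ⟨x, hx, hle⟩ := hφ.lift_left x' y hxy
    exact h x ((E.X.orderedBy _ _).1 hle _ (E.toSet_mem U) hx') hx
  · exact fun h x hx hxy => h (DHHom.f φ x) hx (hφ.map_rel x y hxy)

theorem DH.unitIso_naturality {D E : DH.{u}} (φ : D ⟶ E) :
    D.unitIso.hom ≫ (latToDH.map (dhToLat.map φ.op)).unop = φ ≫ E.unitIso.hom :=
  DHHom.ext rfl (funext fun y => DH.pointIdeal_naturality φ y)

/-- The unit of the duality. -/
noncomputable def dhUnit : 𝟭 DH.{u}ᵒᵖ ≅ dhToLat ⋙ latToDH :=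
  (NatIso.ofComponents (fun D => D.unop.unitIso.op) fun φ =>
    Quiver.Hom.unop_inj (DH.unitIso_naturality φ.unop)).symm

/-- A bounded lattice is isomorphic to the lattice of clopen filters of its space. -/
noncomputable def latIso (A : BddLat.{u}) : A ≅ dhToLat.obj (latToDH.obj A) :=
  letI := clfLattice (dhSpace A).clopenFilterJoins
  letI := clfBounded (dhSpace A).clopenFilterJoins
  BddLat.Iso.mk (α := A) (β := BddLat.of (CLF (dhSpace A).X))
    ((filtSetsIso A).trans (OrderIso.setCongr _ _ (CLF_filt A).symm))

/-- The counit of the duality. -/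
noncomputable def latCounit : latToDH ⋙ dhToLat ≅ 𝟭 BddLat.{u} :=
  (NatIso.ofComponents latIso fun _ => rfl).symm

/-- The duality between Dunn–Hartonas spaces and bounded lattices. -/
noncomputable def dhDuality : DH.{u}ᵒᵖ ≌ BddLat.{u} :=
  CategoryTheory.Equivalence.mk dhToLat latToDH dhUnit latCounit

/-- The equivalence between Dunn–Hartonas spaces and a category that is dual to that of bounded
lattices. -/
noncomputable def dhEquivOfDuality {C : Type*} [Category C] (e : Cᵒᵖ ≌ BddLat.{u}) :
    DH.{u} ≌ C := dhDuality.rightOp.trans e.rightOp.symm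

/-- The equivalence between Dunn–Hartonas spaces and filter spaces. -/
noncomputable def dhEquivFSpace : DH.{u} ≌ FSpace.{u} := dhEquivOfDuality famFunctor.asEquivalence

end Duality

end LatDual

theorem mainTheorem3 :
    Nonempty (LatDual.DH.{u} ≌ LatDual.JM.{u}) ∧
    Nonempty (LatDual.DH.{u} ≌ LatDual.BDGM.{u}) ∧
    Nonempty (LatDual.DH.{u} ≌ LatDual.Hs.{u}) ∧
    Nonempty (LatDual.DH.{u} ≌ LatDual.CG.{u}) ∧
    ∃ (hj : ∀ D : LatDual.DH.{u}, LatDual.ClopenFilterJoins D.X)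
      (hp : ∀ (D E : LatDual.DH.{u}) (φ : D ⟶ E),
        LatDual.PreservesClopenFilterJoins (LatDual.DHHom.f φ))
      (hF : ∀ A : BddLat.{u}, LatDual.IsCoherent (LatDual.Filt A))
      (hI : ∀ A : BddLat.{u}, LatDual.IsCoherent (LatDual.Idl A))
      (hR : ∀ A : BddLat.{u}, LatDual.IsDHRelation (LatDual.disjRel A))
      (hα : ∀ (A B : BddLat.{u}) (α : A ⟶ B),
        LatDual.IsDHMorphism (LatDual.disjRel B) (LatDual.disjRel A)
          (LatDual.filtComap α.hom) (LatDual.idlComap α.hom))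
      (e : LatDual.DH.{u}ᵒᵖ ≌ BddLat.{u}),
        e.functor = LatDual.clfFunctor hj hp ∧
        e.inverse = LatDual.filtIdlFunctor hF hI hR hα :=
  ⟨⟨LatDual.dhEquivFSpace.trans LatDual.jmFunctor.asEquivalence.symm⟩,
    ⟨LatDual.dhEquivFSpace.trans LatDual.bdgmFunctor.asEquivalence.symm⟩,
    ⟨LatDual.dhEquivFSpace.trans LatDual.hsFunctor.asEquivalence.symm⟩,
    -- The points of a `CG` space are not all filters of its lattice, so the route passes through
    -- bounded lattices rather than filter spaces.
    ⟨LatDual.dhEquivOfDuality LatDual.cgFunctor.asEquivalence⟩,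
    LatDual.DH.clopenFilterJoins, LatDual.DHHom.preservesClopenFilterJoins,
    fun A => LatDual.isCoherent_filt A, fun A => LatDual.isCoherent_idl A,
    fun A => LatDual.isDHRelation_disjRel A, fun _ _ α => LatDual.isDHMorphism_comap α.hom,
    -- `Equivalence.mk` changes only the unit, so both functors are the prescribed ones by
    -- definition.
    LatDual.dhDuality, rfl, rfl⟩
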